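/- Let $p$ be a prime, $S$ a finite $p$-group and $T\le S$. Let $\mathcal F$ and $\mathcal E$ be saturated fusion systems over $S$ and $T$, with $\mathcal E$ weakly normal in $\mathcal F$: $\mathcal E\subseteq\mathcal F$, $T$ is strongly $\mathcal F$-closed, $\alpha\mathcal E\alpha^{-1}=\mathcal E$ for all $\alpha\in\operatorname{Aut}_{\mathcal F}(T)$, and every $\varphi\in\operatorname{Hom}_{\mathcal F}(P,T)$ with $P\le T$ has the form $\varphi=\alpha\circ\varphi_0$ with $\alpha\in\operatorname{Aut}_{\mathcal F}(T)$ and $\varphi_0\in\operatorname{Hom}_{\mathcal E}(P,T)$. A linking system associated to $\mathcal F$ is a finite category $\mathcal L$ whose object set is a set of subgroups of $S$, together with functors $\delta$ from the transporter category of $S$ on $\operatorname{Ob}(\mathcal L)$ to $\mathcal L$ and $\pi:\mathcal L\to\mathcal F$, such that: (A1) $\operatorname{Ob}(\mathcal L)$ is closed under $\mathcal F$-conjugacy and overgroups and contains all $\mathcal F$-centric $\mathcal F$-radical subgroups, and each object is isomorphic in $\mathcal L$ to one that is fully centralized in $\mathcal F$; (A2) $\delta$ is the identity and $\pi$ the inclusion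 on objects, and if $P$ is fully centralized then $C_S(P)$ acts freely on $\operatorname{Mor}_{\mathcal L}(P,Q)$ via $\delta_P$ and precomposition, and $\pi$ induces a bijection $\operatorname{Mor}_{\mathcal L}(P,Q)/C_S(P)\to\operatorname{Hom}_{\mathcal F}(P,Q)$; (B) $\pi(\delta_{P,Q}(g))=c_g$; (C) $\psi\circ\delta_P(g)=\delta_Q(\pi(\psi)(g))\circ\psi$ for $\psi\in\operatorname{Mor}_{\mathcal L}(P,Q)$ and $g\in P$. The inclusions are $\iota_P^Q=\delta_{P,Q}(1)$, and the restriction $\psi|_{P_0,Q_0}$ of $\psi\in\operatorname{Mor}_{\mathcal L}(P,Q)$ is the morphism with $\iota_{Q_0}^{Q}\circ\psi|_{P_0,Q_0}=\psi\circ\iota_{P_0}^{P}$. Let $\mathcal L$ and $\mathcal L_0$ be linking systems associated to $\mathcal F$ and $\mathcal E$, with $\mathcal L_0\subseteq\mathcal L$ (a subcategory, with the restricted structure functors) weakly normal in $\mathcal L$: $\operatorname{Ob}(\mathcal L)=\{P\le S\mid P\cap T\in\operatorname{Ob}(\mathcal L_0)\}$, and for all $\gamma\in\operatorname{Aut}_{\mathcal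 L}(T)$ and $\psi\in\operatorname{Mor}_{\mathcal L_0}(P,Q)$ the morphism $c_\gamma(\psi):=\gamma|_{Q,\gamma(Q)}\circ\psi\circ(\gamma|_{P,\gamma(P)})^{-1}$ lies in $\mathcal L_0$, where $\gamma(P):=\pi(\gamma)(P)$. Let $\operatorname{Aut}_{typ}(\mathcal L_0)$ be the set of isotypical self-equivalences of $\mathcal L_0$, i.e. equivalences of categories $\alpha:\mathcal L_0\to\mathcal L_0$ with $\alpha(\delta_P(P))=\delta_{\alpha(P)}(\alpha(P))$ for all objects $P$, and let $\operatorname{Aut}^I_{typ}(\mathcal L_0)$ be the set of those that send inclusions to inclusions. Call $\alpha,\beta\in\operatorname{Aut}_{typ}(\mathcal L_0)$ $\mathcal L$-naturally isomorphic if there are $\eta_R\in\operatorname{Mor}_{\mathcal L}(\alpha(R),\beta(R))$ for $R\in\operatorname{Ob}(\mathcal L_0)$ such that $\eta_{R'}\circ\alpha(\varphi)=\beta(\varphi)\circ\eta_R$ for all $\varphi\in\operatorname{Mor}_{\mathcal L_0}(R,R')$. Put $C_S(\mathcal E):=\{g\in S\mid \mathcal E\subseteq C_{\mathcal F}(\langle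 g\rangle)\}$. Then $\mathcal L$-natural isomorphism is an equivalence relation on $\operatorname{Aut}_{typ}(\mathcal L_0)$, with set of classes denoted $\operatorname{Out}^{\mathcal L}_{typ}(\mathcal L_0)$; $\operatorname{Aut}^I_{typ}(\mathcal L_0)$ is a group under composition; $T\in\operatorname{Ob}(\mathcal L)$; $C_S(\mathcal E)$ is a subgroup of $S$; $\gamma\mapsto c_\gamma$ (with $c_\gamma(P)=\gamma(P)$ on objects) is a well-defined homomorphism $\operatorname{Aut}_{\mathcal L}(T)\to\operatorname{Aut}^I_{typ}(\mathcal L_0)$; and the sequence $$1\to C_S(\mathcal E)\xrightarrow{\ \delta_T\ }\operatorname{Aut}_{\mathcal L}(T)\xrightarrow{\ \gamma\mapsto c_\gamma\ }\operatorname{Aut}^I_{typ}(\mathcal L_0)\to\operatorname{Out}^{\mathcal L}_{typ}(\mathcal L_0)\to 1$$ is exact, where the last map sends $\alpha$ to its class and $\operatorname{Out}^{\mathcal L}_{typ}(\mathcal L_0)$ is a set pointed by the class of the identity. That is, $\delta_T$ is injective on $C_S(\mathcal E)$ with image the kernel of $\gamma\mapsto c_\gamma$; the functors $\alpha\in\operatorname{Aut}^I_{typ}(\mathcal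 L_0)$ in the class of the identity are exactly the $c_\gamma$; and the last map is surjective. Moreover, $C_S(\mathcal E)$ is strongly $\mathcal F$-closed. -/

import Mathlib

open CategoryTheory

universe u v w

-- so that `P ⟶ Q` is found through `CategoryStruct.toQuiver` (the two are definitionally equal)
attribute [-instance] catToReflQuiver

/-! ### Fusion systems

All groups are subgroups of an ambient group `G`, so that subgroups of `T ≤ S` are literally
subgroups of `S`. -/

section Fusion

variable {G : Type u} [Group G]

/-- The transporter set `T_S(P, Q) = {g ∈ S | gPg⁻¹ ≤ Q}`. -/
def transporter (S P Q : Subgroup G) : Set G :=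
  {g | g ∈ S ∧ ∀ x ∈ P, g * x * g⁻¹ ∈ Q}

theorem one_mem_transporter (S : Subgroup G) {P Q : Subgroup G} (h : P ≤ Q) :
    (1 : G) ∈ transporter S P Q :=
  ⟨S.one_mem, fun x hx => by simpa using h hx⟩

theorem mul_mem_transporter {S P Q R : Subgroup G} {g h : G}
    (hg : g ∈ transporter S P Q) (hh : h ∈ transporter S Q R) :
    h * g ∈ transporter S P R :=
  ⟨S.mul_mem hh.1 hg.1, fun x hx => by
    have := hh.2 _ (hg.2 x hx)
    simpa [mul_assoc] using this⟩

theorem self_mem_transporter {S P : Subgroup G} (hP : P ≤ S) {g : G} (hg : g ∈ P) :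
    g ∈ transporter S P P :=
  ⟨hP hg, fun _ hx => P.mul_mem (P.mul_mem hg hx) (P.inv_mem hg)⟩

theorem normalizer_mem_transporter {S P : Subgroup G} {g : G}
    (hg : g ∈ S ⊓ Subgroup.normalizer (P : Set G)) : g ∈ transporter S P P :=
  ⟨hg.1, fun x hx => (Subgroup.mem_normalizer_iff.1 hg.2 x).1 hx⟩

/-- The image of (the part in `P` of) a subgroup `R` under `φ : P → Q`, as a subgroup of `G`. -/
def imageOf {P Q : Subgroup G} (φ : P →* Q) (R : Subgroup G) : Subgroup G :=
  ((R.subgroupOf P).map φ).map Q.subtype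

/-- `C_S(P)`. -/
def centralizerIn (S P : Subgroup G) : Subgroup G :=
  S ⊓ Subgroup.centralizer (P : Set G)

/-- A fusion system over `S`: a category whose objects are the subgroups of `S`, with
`Hom_S(P,Q) ⊆ Hom(P,Q) ⊆ Inj(P,Q)`, in which every morphism is an isomorphism of the category
followed by an inclusion. -/
structure FusionSystem (S : Subgroup G) where
  Hom : ∀ P Q : Subgroup G, Set (P →* Q)
  le_of_mem : ∀ {P Q : Subgroup G} {φ : P →* Q}, φ ∈ Hom P Q → P ≤ S ∧ Q ≤ S
  injective : ∀ {P Q : Subgroup G} {φ : P →* Q}, φ ∈ Hom P Q → Function.Injective φ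
  conj_mem : ∀ {P Q : Subgroup G}, P ≤ S → Q ≤ S → ∀ g ∈ transporter S P Q, ∀ φ : P →* Q,
    (∀ x : P, (φ x : G) = g * x * g⁻¹) → φ ∈ Hom P Q
  comp_mem : ∀ {P Q R : Subgroup G} {φ : P →* Q} {ψ : Q →* R},
    φ ∈ Hom P Q → ψ ∈ Hom Q R → ψ.comp φ ∈ Hom P R
  factor : ∀ {P Q : Subgroup G} {φ : P →* Q}, φ ∈ Hom P Q →
    ∃ (R : Subgroup G) (h : R ≤ Q) (e : P ≃* R),
      e.toMonoidHom ∈ Hom P R ∧ e.symm.toMonoidHom ∈ Hom R P ∧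
        φ = (Subgroup.inclusion h).comp e.toMonoidHom

/-- `Aut_S(P)`: the automorphisms of `P` induced by conjugation by elements of `S`. -/
def autIn (S P : Subgroup G) : Subgroup (MulAut P) where
  carrier := {e | ∃ g ∈ S, ∀ x : P, (e x : G) = g * x * g⁻¹}
  mul_mem' := by
    rintro a b ⟨g, hg, ha⟩ ⟨h, hh, hb⟩
    exact ⟨g * h, S.mul_mem hg hh, fun x => by simp [ha, hb, mul_assoc]⟩
  one_mem' := ⟨1, S.one_mem, fun x => by simp⟩
  inv_mem' := by
    rintro a ⟨g, hg, ha⟩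
    refine ⟨g⁻¹, S.inv_mem hg, fun x => ?_⟩
    have h := ha (a⁻¹ x)
    rw [MulAut.apply_inv_self] at h
    rw [h]
    group

namespace FusionSystem

variable {S T : Subgroup G}

theorem id_mem (F : FusionSystem S) {P : Subgroup G} (hP : P ≤ S) :
    MonoidHom.id P ∈ F.Hom P P :=
  F.conj_mem hP hP 1 (one_mem_transporter S le_rfl) _ (fun x => by simp)

theorem symm_mem (F : FusionSystem S) {P Q : Subgroup G} {e : P ≃* Q}
    (he : e.toMonoidHom ∈ F.Hom P Q) : e.symm.toMonoidHom ∈ F.Hom Q P := by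
  obtain ⟨R, h, e', -, h2, h3⟩ := F.factor he
  have hRQ : R = Q := by
    apply le_antisymm h
    intro x hx
    obtain ⟨y, hy⟩ := e.surjective ⟨x, hx⟩
    have := congrArg (fun f : P →* Q => ((f y : Q) : G)) h3
    simp only [MulEquiv.toMonoidHom_eq_coe, MonoidHom.coe_coe, hy] at this
    rw [this]
    exact (e' y).2
  subst hRQ
  have : e = e' := by
    ext x
    exact congrArg (fun f : P →* R => ((f x : R) : G)) h3
  rw [this]
  exact h2

/-- `Aut_F(P)` for `P ≤ S`. -/
def autGroup (F : FusionSystem S) (P : Subgroup G) (hP : P ≤ S) : Subgroup (MulAut P) where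
  carrier := {e | MulEquiv.toMonoidHom e ∈ F.Hom P P}
  mul_mem' := fun ha hb => F.comp_mem hb ha
  one_mem' := F.id_mem hP
  inv_mem' := fun ha => F.symm_mem ha

/-- `P` and `Q` are `F`-conjugate: isomorphic in the category `F`. -/
def Conj (F : FusionSystem S) (P Q : Subgroup G) : Prop :=
  ∃ e : P ≃* Q, e.toMonoidHom ∈ F.Hom P Q

/-- `Aut_S(P)` is a Sylow `p`-subgroup of `Aut_F(P)`. -/
def FullyAutomized (p : ℕ) (F : FusionSystem S) (P : Subgroup G) : Prop :=
  ∃ hP : P ≤ S, ∃ A : Sylow p (F.autGroup P hP),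
    (A : Subgroup (F.autGroup P hP)) = (autIn S P).subgroupOf (F.autGroup P hP)

end FusionSystem

/-- `N_φ = {g ∈ N_S(Q) | φ c_g φ⁻¹ ∈ Aut_S(P)}` for an isomorphism `φ : Q → P`. -/
def extensionGroup (S : Subgroup G) {Q P : Subgroup G} (φ : Q ≃* P) : Subgroup G where
  carrier := {g | g ∈ S ⊓ Subgroup.normalizer (Q : Set G) ∧
    ∃ h ∈ S, ∀ x y : Q, (y : G) = g * x * g⁻¹ → (φ y : G) = h * φ x * h⁻¹}
  mul_mem' := by
    rintro a b ⟨ha, h, hh, hah⟩ ⟨hb, k, hk, hbk⟩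
    refine ⟨Subgroup.mul_mem _ ha hb, h * k, S.mul_mem hh hk, fun x y hy => ?_⟩
    have hz : b * x * b⁻¹ ∈ Q := (Subgroup.mem_normalizer_iff.1 hb.2 _).1 x.2
    rw [hah ⟨_, hz⟩ y (by simp [hy, mul_assoc]), hbk x ⟨_, hz⟩ rfl]
    group
  one_mem' := ⟨Subgroup.one_mem _, 1, S.one_mem, fun x y hy => by
    have : y = x := Subtype.ext (by simpa using hy)
    simp [this]⟩
  inv_mem' := by
    rintro a ⟨ha, h, hh, hah⟩
    refine ⟨Subgroup.inv_mem _ ha, h⁻¹, S.inv_mem hh, fun x y hy => ?_⟩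
    rw [hah y x (by rw [hy]; group)]
    group

instance innNormal (P : Type u) [Group P] : (MulAut.conj : P →* MulAut P).range.Normal := by
  constructor
  rintro _ ⟨g, rfl⟩ a
  refine ⟨a g, ?_⟩
  ext x
  simp

namespace FusionSystem

variable {S T : Subgroup G}

/-- Every `φ ∈ Iso_F(Q,P)` extends to a morphism `N_φ → S` of `F`. -/
def Receptive (F : FusionSystem S) (P : Subgroup G) : Prop :=
  ∀ (Q : Subgroup G) (φ : Q ≃* P), φ.toMonoidHom ∈ F.Hom Q P →
    ∃ ψ ∈ F.Hom (extensionGroup S φ) S,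
      ∀ (x : Q) (y : extensionGroup S φ), (y : G) = x → (ψ y : G) = φ x

/-- Every subgroup of `S` is `F`-conjugate to a fully automized receptive one. -/
def Saturated (p : ℕ) (F : FusionSystem S) : Prop :=
  ∀ P ≤ S, ∃ Q, F.Conj P Q ∧ F.FullyAutomized p Q ∧ F.Receptive Q

def FullyCentralized (F : FusionSystem S) (P : Subgroup G) : Prop :=
  P ≤ S ∧ ∀ Q, F.Conj P Q → Nat.card (centralizerIn S Q) ≤ Nat.card (centralizerIn S P)

def Centric (F : FusionSystem S) (P : Subgroup G) : Prop :=
  P ≤ S ∧ ∀ Q, F.Conj P Q → centralizerIn S Q ≤ Q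

/-- `Out_F(P) = Aut_F(P) / Inn(P)` has no nontrivial normal `p`-subgroup. -/
def Radical (p : ℕ) (F : FusionSystem S) (P : Subgroup G) : Prop :=
  ∃ hP : P ≤ S, ∀ N : Subgroup
      (F.autGroup P hP ⧸ ((MulAut.conj : P →* MulAut P).range.subgroupOf (F.autGroup P hP))),
    N.Normal → IsPGroup p N → N = ⊥

/-- No element of `T` is `F`-conjugate to an element of `S` outside `T`. -/
def StronglyClosed (F : FusionSystem S) (T : Subgroup G) : Prop :=
  T ≤ S ∧ ∀ (P Q : Subgroup G), ∀ φ ∈ F.Hom P Q, ∀ x : P, (x : G) ∈ T → (φ x : G) ∈ T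

/-- Morphism sets of the centralizer fusion system `C_F(X)` over `C_S(X)`: the morphisms of `F`
between subgroups of `C_S(X)` that extend to `PX → QX` in `F` with the identity on `X`. -/
def centralizerHom (F : FusionSystem S) (X P Q : Subgroup G) : Set (P →* Q) :=
  {φ | P ≤ centralizerIn S X ∧ Q ≤ centralizerIn S X ∧ φ ∈ F.Hom P Q ∧
    ∃ ψ ∈ F.Hom (P ⊔ X) (Q ⊔ X),
      (∀ (x : P) (y : ↥(P ⊔ X)), (y : G) = x → (ψ y : G) = φ x) ∧
      ∀ y : ↥(P ⊔ X), (y : G) ∈ X → (ψ y : G) = y}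

/-- `E ⊆ C_F(X)`. -/
def CentralizedBy (F : FusionSystem S) (E : FusionSystem T) (X : Subgroup G) : Prop :=
  T ≤ centralizerIn S X ∧ ∀ P Q : Subgroup G, E.Hom P Q ⊆ F.centralizerHom X P Q

/-- The set `C_S(E) = {g ∈ S | E ⊆ C_F(⟨g⟩)}`. -/
def subsystemCentralizer (F : FusionSystem S) (E : FusionSystem T) : Set G :=
  {g | g ∈ S ∧ F.CentralizedBy E (Subgroup.zpowers g)}

/-- `E` is a weakly normal subsystem of `F`: both are saturated, `T` is strongly closed, `E` is
invariant under conjugation by `Aut_F(T)`, and the Frattini condition holds. -/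
structure WeaklyNormal (p : ℕ) (F : FusionSystem S) (E : FusionSystem T) : Prop where
  saturated : F.Saturated p
  saturated_sub : E.Saturated p
  subsystem : ∀ P Q : Subgroup G, E.Hom P Q ⊆ F.Hom P Q
  stronglyClosed : F.StronglyClosed T
  invariant : ∀ α : T ≃* T, α.toMonoidHom ∈ F.Hom T T →
    ∀ (P Q : Subgroup G) (hP : P ≤ T) (hQ : Q ≤ T), ∀ φ ∈ E.Hom P Q,
      ∃ φ' ∈ E.Hom (imageOf α.toMonoidHom P) (imageOf α.toMonoidHom Q),
        ∀ (x : P) (y : imageOf α.toMonoidHom P), (y : G) = α (Subgroup.inclusion hP x) →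
          (φ' y : G) = α (Subgroup.inclusion hQ (φ x))
  frattini : ∀ P ≤ T, ∀ φ ∈ F.Hom P T,
    ∃ α : T ≃* T, α.toMonoidHom ∈ F.Hom T T ∧ ∃ φ₀ ∈ E.Hom P T, φ = α.toMonoidHom.comp φ₀

end FusionSystem

end Fusion

/-! ### Linking systems -/

section Linking

variable {G : Type u} [Group G]

/-- Objects of a linking system with object set `X`. (A separate structure, so that the order on
subgroups does not induce a category structure on it.) -/
@[ext]
structure ObjectOf (X : Set (Subgroup G)) where
  grp : Subgroup G
  mem : grp ∈ X

/-- A linking system associated to `F`: a finite category with object set `Obj`, and functors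
`δ` from the transporter category of `S` on `Obj`, and `π` to `F`. In the notation below,
`f ≫ g` is `g ∘ f`. -/
structure LinkingSystem (p : ℕ) {S : Subgroup G} (F : FusionSystem S) where
  Obj : Set (Subgroup G)
  cat : Category.{v} (ObjectOf Obj)
  finite_hom : ∀ P Q : ObjectOf Obj, Finite (P ⟶ Q)
  /-- the functor `δ`, the identity on objects -/
  δ : ∀ P Q : ObjectOf Obj, transporter S P.grp Q.grp → (P ⟶ Q)
  δ_one : ∀ P : ObjectOf Obj, δ P P ⟨1, one_mem_transporter S le_rfl⟩ = 𝟙 P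
  δ_mul : ∀ (P Q R : ObjectOf Obj) (g : transporter S P.grp Q.grp)
    (h : transporter S Q.grp R.grp),
    δ P R ⟨h * g, mul_mem_transporter g.2 h.2⟩ = δ P Q g ≫ δ Q R h
  /-- the functor `π`, the inclusion on objects -/
  π : ∀ {P Q : ObjectOf Obj}, (P ⟶ Q) → (P.grp →* Q.grp)
  π_mem : ∀ {P Q : ObjectOf Obj} (ψ : P ⟶ Q), π ψ ∈ F.Hom P.grp Q.grp
  π_id : ∀ P : ObjectOf Obj, π (𝟙 P) = MonoidHom.id P.grp
  π_comp : ∀ {P Q R : ObjectOf Obj} (ψ : P ⟶ Q) (χ : Q ⟶ R), π (ψ ≫ χ) = (π χ).comp (π ψ)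
  /-- (A1) -/
  obj_le : ∀ P ∈ Obj, P ≤ S
  obj_conj : ∀ P ∈ Obj, ∀ Q, F.Conj P Q → Q ∈ Obj
  obj_overgroup : ∀ P ∈ Obj, ∀ Q, P ≤ Q → Q ≤ S → Q ∈ Obj
  obj_centric_radical : ∀ P, F.Centric P → F.Radical p P → P ∈ Obj
  iso_fullyCentralized : ∀ P : ObjectOf Obj, ∃ Q : ObjectOf Obj,
    F.FullyCentralized Q.grp ∧ Nonempty (P ≅ Q)
  /-- (A2): for `P` fully centralized, `C_S(P)` acts freely on `Mor(P,Q)` by precomposition, and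
  `π` induces a bijection from the set of orbits to `Hom_F(P,Q)`. -/
  free : ∀ P Q : ObjectOf Obj, F.FullyCentralized P.grp → ∀ (ψ : P ⟶ Q)
    (a : transporter S P.grp P.grp), (a : G) ∈ centralizerIn S P.grp →
    δ P P a ≫ ψ = ψ → (a : G) = 1
  π_surjective : ∀ P Q : ObjectOf Obj, F.FullyCentralized P.grp →
    ∀ φ ∈ F.Hom P.grp Q.grp, ∃ ψ : P ⟶ Q, π ψ = φ
  π_eq_iff : ∀ P Q : ObjectOf Obj, F.FullyCentralized P.grp → ∀ ψ ψ' : P ⟶ Q,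
    π ψ = π ψ' ↔ ∃ a : transporter S P.grp P.grp, (a : G) ∈ centralizerIn S P.grp ∧
      ψ' = δ P P a ≫ ψ
  /-- (B) -/
  π_δ : ∀ (P Q : ObjectOf Obj) (g : transporter S P.grp Q.grp) (x : P.grp),
    (π (δ P Q g) x : G) = g * x * (g : G)⁻¹
  /-- (C): `ψ ∘ δ_P(g) = δ_Q(π(ψ)(g)) ∘ ψ` for `g ∈ P` -/
  δ_comm : ∀ {P Q : ObjectOf Obj} (ψ : P ⟶ Q) (g : P.grp) (a : transporter S P.grp P.grp)
    (b : transporter S Q.grp Q.grp), (a : G) = g → (b : G) = π ψ g →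
    δ P P a ≫ ψ = ψ ≫ δ Q Q b

namespace LinkingSystem

variable {p : ℕ} {S T : Subgroup G} {F : FusionSystem S} {E : FusionSystem T}

/-- The objects of `L`. -/
abbrev Ob (L : LinkingSystem.{u, v} p F) : Type u := ObjectOf L.Obj

instance instCategory (L : LinkingSystem.{u, v} p F) : Category.{v} L.Ob := L.cat

/-- The inclusion `ι_P^Q = δ_{P,Q}(1)`. -/
def incl (L : LinkingSystem.{u, v} p F) {P Q : L.Ob} (h : P.grp ≤ Q.grp) : P ⟶ Q :=
  L.δ P Q ⟨1, one_mem_transporter S h⟩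

/-- `δ_P` on elements of `P`. -/
def deltaSelf (L : LinkingSystem.{u, v} p F) (P : L.Ob) (g : P.grp) : P ⟶ P :=
  L.δ P P ⟨g, self_mem_transporter (L.obj_le _ P.mem) g.2⟩

/-- The homomorphism `δ_P : N_S(P) → Aut_L(P)`. -/
def deltaAut (L : LinkingSystem.{u, v} p F) (P : L.Ob) :
    ↥(S ⊓ Subgroup.normalizer (P.grp : Set G)) →* Aut P where
  toFun g :=
    { hom := L.δ P P ⟨g, normalizer_mem_transporter g.2⟩
      inv := L.δ P P ⟨(g⁻¹ : _), normalizer_mem_transporter (g⁻¹).2⟩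
      hom_inv_id := by
        rw [← L.δ_mul, ← L.δ_one]
        congr 2
        simp
      inv_hom_id := by
        rw [← L.δ_mul, ← L.δ_one]
        congr 2
        simp }
  map_one' := by
    apply Iso.ext
    exact L.δ_one P
  map_mul' g h := by
    apply Iso.ext
    exact L.δ_mul P P P ⟨h, normalizer_mem_transporter h.2⟩ ⟨g, normalizer_mem_transporter g.2⟩

/-- `ψ₀ : P₀ → Q₀` is the restriction of `ψ : P → Q`. -/
def IsRestriction (L : LinkingSystem.{u, v} p F) {P Q P₀ Q₀ : L.Ob} (hP : P₀.grp ≤ P.grp)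
    (hQ : Q₀.grp ≤ Q.grp) (ψ : P ⟶ Q) (ψ₀ : P₀ ⟶ Q₀) : Prop :=
  ψ₀ ≫ L.incl hQ = L.incl hP ≫ ψ

/-- An isotypical self-equivalence: an equivalence of categories `α : L → L` with
`α(δ_P(P)) = δ_{α(P)}(α(P))` for every object `P`. -/
def IsIsotypicalEquivalence (L : LinkingSystem.{u, v} p F) (α : L.Ob ⥤ L.Ob) : Prop :=
  α.IsEquivalence ∧ ∀ P : L.Ob,
    Set.range (fun g : P.grp => α.map (L.deltaSelf P g)) = Set.range (L.deltaSelf (α.obj P))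

/-- `α` sends inclusions to inclusions. -/
def PreservesInclusions (L : LinkingSystem.{u, v} p F) (α : L.Ob ⥤ L.Ob) : Prop :=
  ∀ (P Q : L.Ob) (h : P.grp ≤ Q.grp), ∃ h' : (α.obj P).grp ≤ (α.obj Q).grp,
    α.map (L.incl h) = L.incl h'

/-- `Aut_typ(L)`: the isotypical self-equivalences of `L`. -/
def AutTyp (L : LinkingSystem.{u, v} p F) : Type (max u v) :=
  {α : L.Ob ⥤ L.Ob // L.IsIsotypicalEquivalence α}

/-- `Aut_typ^I(L)`: the isotypical self-equivalences of `L` that send inclusions to inclusions. -/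
def AutTypI (L : LinkingSystem.{u, v} p F) : Type (max u v) :=
  {α : L.Ob ⥤ L.Ob // L.IsIsotypicalEquivalence α ∧ L.PreservesInclusions α}

theorem isIsotypicalEquivalence_id (L : LinkingSystem.{u, v} p F) :
    L.IsIsotypicalEquivalence (𝟭 L.Ob) :=
  ⟨inferInstance, fun _ => rfl⟩

theorem IsIsotypicalEquivalence.comp {L : LinkingSystem.{u, v} p F} {α β : L.Ob ⥤ L.Ob}
    (hα : L.IsIsotypicalEquivalence α) (hβ : L.IsIsotypicalEquivalence β) :
    L.IsIsotypicalEquivalence (β ⋙ α) := by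
  refine ⟨?_, fun P => ?_⟩
  · have := hα.1
    have := hβ.1
    infer_instance
  · have h := congrArg (fun s => (fun f => α.map f) '' s) (hβ.2 P)
    simp only [← Set.range_comp] at h
    exact h.trans (hα.2 (β.obj P))

theorem PreservesInclusions.comp {L : LinkingSystem.{u, v} p F} {α β : L.Ob ⥤ L.Ob}
    (hα : L.PreservesInclusions α) (hβ : L.PreservesInclusions β) :
    L.PreservesInclusions (β ⋙ α) := by
  intro P Q h
  obtain ⟨h₁, e₁⟩ := hβ P Q h
  obtain ⟨h₂, e₂⟩ := hα _ _ h₁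
  exact ⟨h₂, by rw [Functor.comp_map, e₁, e₂]⟩

/-- Composition of functors: `α * β = α ∘ β`. -/
instance instMonoidAutTypI (L : LinkingSystem.{u, v} p F) : Monoid L.AutTypI where
  mul α β := ⟨β.1 ⋙ α.1, α.2.1.comp β.2.1, α.2.2.comp β.2.2⟩
  one := ⟨𝟭 _, L.isIsotypicalEquivalence_id, fun _ _ h => ⟨h, rfl⟩⟩
  mul_assoc _ _ _ := rfl
  one_mul _ := rfl
  mul_one _ := rfl

/-- `L₀ ⊆ L`: an identification of `L₀` with a subcategory of `L`, the structure functors of `L₀`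
being the restrictions of those of `L`. -/
structure Inclusion (L₀ : LinkingSystem.{u, w} p E) (L : LinkingSystem.{u, v} p F) where
  obj_subset : L₀.Obj ⊆ L.Obj
  map : ∀ {P Q : L₀.Ob}, (P ⟶ Q) →
    ((⟨P.grp, obj_subset P.mem⟩ : L.Ob) ⟶ (⟨Q.grp, obj_subset Q.mem⟩ : L.Ob))
  map_id : ∀ P : L₀.Ob, map (𝟙 P) = 𝟙 _
  map_comp : ∀ {P Q R : L₀.Ob} (ψ : P ⟶ Q) (χ : Q ⟶ R), map (ψ ≫ χ) = map ψ ≫ map χ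
  map_injective : ∀ {P Q : L₀.Ob} (ψ χ : P ⟶ Q), map ψ = map χ → ψ = χ
  map_δ : ∀ (P Q : L₀.Ob) (g : transporter T P.grp Q.grp) (g' : transporter S P.grp Q.grp),
    (g : G) = g' → map (L₀.δ P Q g) = L.δ _ _ g'
  π_map : ∀ {P Q : L₀.Ob} (ψ : P ⟶ Q), L.π (map ψ) = L₀.π ψ

namespace Inclusion

variable {L₀ : LinkingSystem.{u, w} p E} {L : LinkingSystem.{u, v} p F}

/-- An object of `L₀`, as an object of `L`. -/
def obj (J : L₀.Inclusion L) (P : L₀.Ob) : L.Ob := ⟨P.grp, J.obj_subset P.mem⟩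

/-- `L₀` is weakly normal in `L`: `Ob(L) = {P ≤ S | P ∩ T ∈ Ob(L₀)}`, and
`γψγ⁻¹ = γ|_{Q,γ(Q)} ∘ ψ ∘ (γ|_{P,γ(P)})⁻¹` is in `L₀` for `γ ∈ Aut_L(T)` and
`ψ ∈ Mor_{L₀}(P,Q)`. -/
structure WeaklyNormal (J : L₀.Inclusion L) : Prop where
  obj_iff : ∀ P ≤ S, (P ∈ L.Obj ↔ P ⊓ T ∈ L₀.Obj)
  conj_mem : ∀ (hT : T ∈ L.Obj) (γ : Aut (⟨T, hT⟩ : L.Ob)) (P Q P' Q' : L₀.Ob)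
    (r : J.obj P ≅ J.obj P') (s : J.obj Q ≅ J.obj Q'),
    L.IsRestriction (L₀.obj_le _ P.mem) (L₀.obj_le _ P'.mem) γ.hom r.hom →
    L.IsRestriction (L₀.obj_le _ Q.mem) (L₀.obj_le _ Q'.mem) γ.hom s.hom →
    ∀ ψ : P ⟶ Q, ∃ ψ' : P' ⟶ Q', J.map ψ' = r.inv ≫ J.map ψ ≫ s.hom

/-- `Φ` is the conjugation functor `c_γ` on `L₀`: `c_γ(P) = π(γ)(P)` on objects, and
`c_γ(ψ) = γ|_{Q,γ(Q)} ∘ ψ ∘ (γ|_{P,γ(P)})⁻¹` on morphisms. -/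
def IsConjugation (J : L₀.Inclusion L) {hT : T ∈ L.Obj} (γ : Aut (⟨T, hT⟩ : L.Ob))
    (Φ : L₀.Ob ⥤ L₀.Ob) : Prop :=
  (∀ P : L₀.Ob, (Φ.obj P).grp = imageOf (L.π γ.hom) P.grp) ∧
  ∃ r : ∀ P : L₀.Ob, J.obj P ≅ J.obj (Φ.obj P),
    (∀ P : L₀.Ob, L.IsRestriction (L₀.obj_le _ P.mem) (L₀.obj_le _ (Φ.obj P).mem)
      γ.hom (r P).hom) ∧
    ∀ (P Q : L₀.Ob) (ψ : P ⟶ Q), J.map (Φ.map ψ) = (r P).inv ≫ J.map ψ ≫ (r Q).hom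

/-- `α` and `β` are `L`-naturally isomorphic. -/
def LNaturallyIso (J : L₀.Inclusion L) (α β : L₀.AutTyp) : Prop :=
  ∃ η : ∀ R : L₀.Ob, J.obj (α.1.obj R) ⟶ J.obj (β.1.obj R),
    ∀ (R R' : L₀.Ob) (φ : R ⟶ R'), J.map (α.1.map φ) ≫ η R' = η R ≫ J.map (β.1.map φ)

/-- `Out_typ^L(L₀)`: the classes of `Aut_typ(L₀)` under `L`-natural isomorphism. -/
def OutTyp (J : L₀.Inclusion L) : Type (max u w) := Quot J.LNaturallyIso

/-- The natural map `Aut_typ^I(L₀) → Out_typ^L(L₀)`. -/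
def toOutTyp (J : L₀.Inclusion L) (α : L₀.AutTypI) : J.OutTyp :=
  Quot.mk _ ⟨α.1, α.2.1⟩

end Inclusion

end LinkingSystem

end Linking

/-! Every morphism of `L` is monic and is invertible once its ends have equal order, and `δ` is
injective. So restrictions of `γ` are unique, and `c_γ` is a well-defined functor with inverse
`c_{γ⁻¹}`. Axiom (C) and injectivity of `δ` translate between equations in `S` and commutation
relations in `L`.

Kernel. If `c_γ` is the identity, then `γ` commutes with each `δ_T(t)`, so `π(γ)` is the identity by
(C). As `T` is fully centralized, `γ = δ_T(a)` with `a ∈ C_S(T)`, and `δ(a)` commutes with all of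
`L₀`. The heart of the proof is that such commutation is equivalent to `a ∈ C_S(E)`.

From commutation to `C_S(E)`: by Alperin's theorem for `E` it suffices to extend automorphisms of
centric radical subgroups by the identity on `⟨a⟩`. A lift to `L₀` commutes with `δ(a)`, and
`extendsOver_of_commute` produces the extension.

Conversely, let `a ∈ C_S(E)`. A morphism of `E` has some lift to `L` commuting with `δ(a)`, but
perhaps none visibly in `L₀`. For `g ∈ Aut_{L₀}(P)` of order prime to `p`, such a lift is `g` times
an element of the `p`-group `ker π`. Since `Aut_{L₀}(P)` is normal in `Aut_L(P)` (Frattini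
condition), a power of the lift is `g` up to an element of both normal subgroups, and those elements
commute with `δ(a)`. A Sylow argument covers the other automorphisms, and extension to normalizers
covers all morphisms (`commutes`).

The remaining points: a natural isomorphism from the identity to `α` makes `α` conjugation by its
component at `T`; any isotypical equivalence is made inclusion-preserving by replacing each `α(P)`
by its image in `α(T)`; and `Aut_typ^I(L₀)` is finite and left cancellative, hence a group. `C_S(E)`
is a subgroup because it is the preimage under `δ_T` of the kernel of `c`. It is strongly closed by
Alperin's theorem for `F`: an automorphism of `R` restricts to `R ∩ T`, factors there as a morphism
of `L₀` followed by an element of `Aut_L(T)`, and the latter normalizes the kernel of `c`. -/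

/-! ### Restriction, conjugacy and extension in fusion systems -/

section FusionBasics

variable {G : Type u} [Group G] {S : Subgroup G}

/-- The restriction of `φ : P → Q` to `P₀ → Q₀`. -/
def restrictHom {P Q P₀ Q₀ : Subgroup G} (φ : P →* Q) (hP : P₀ ≤ P)
    (h : ∀ x : P₀, (φ (Subgroup.inclusion hP x) : G) ∈ Q₀) : P₀ →* Q₀ :=
  (Q.subtype.comp (φ.comp (Subgroup.inclusion hP))).codRestrict Q₀ h

theorem mem_imageOf {P Q R : Subgroup G} {φ : P →* Q} {y : G} :
    y ∈ imageOf φ R ↔ ∃ x : P, (x : G) ∈ R ∧ (φ x : G) = y := by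
  constructor
  · rintro ⟨_, ⟨x, hx, rfl⟩, rfl⟩
    exact ⟨x, hx, rfl⟩
  · rintro ⟨x, hx, rfl⟩
    exact ⟨_, ⟨x, hx, rfl⟩, rfl⟩

namespace FusionSystem

variable {F : FusionSystem S}

theorem inclusion_mem (F : FusionSystem S) {P Q : Subgroup G} (h : P ≤ Q) (hQ : Q ≤ S) :
    Subgroup.inclusion h ∈ F.Hom P Q :=
  F.conj_mem (h.trans hQ) hQ 1 (one_mem_transporter S h) _ (fun x => by simp)

/-- Membership in a fusion system depends only on the underlying map. -/
theorem mem_of_agree {P Q P₀ Q₀ : Subgroup G} {φ : P →* Q} (hφ : φ ∈ F.Hom P Q)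
    {φ₀ : P₀ →* Q₀} (hP : P₀ ≤ P) (hQ : Q₀ ≤ S)
    (h : ∀ x : P₀, (φ₀ x : G) = φ (Subgroup.inclusion hP x)) : φ₀ ∈ F.Hom P₀ Q₀ := by
  obtain ⟨R, hR, e, he, -, h3⟩ :=
    F.factor (F.comp_mem (F.inclusion_mem hP (F.le_of_mem hφ).1) hφ)
  have key : ∀ x, (φ₀ x : G) = e x := fun x => by
    rw [h]
    exact congrArg (fun f : P₀ →* Q => ((f x : Q) : G)) h3
  have hRQ : R ≤ Q₀ := by
    intro r hr
    obtain ⟨x, hx⟩ := e.surjective ⟨r, hr⟩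
    have := key x
    rw [hx] at this
    rw [show r = (φ₀ x : G) from this.symm]
    exact (φ₀ x).2
  have : φ₀ = (Subgroup.inclusion hRQ).comp e.toMonoidHom := by
    ext x
    exact key x
  rw [this]
  exact F.comp_mem he (F.inclusion_mem hRQ hQ)

theorem restrictHom_mem {P Q P₀ Q₀ : Subgroup G} {φ : P →* Q} (hφ : φ ∈ F.Hom P Q)
    (hP : P₀ ≤ P) (hQ : Q₀ ≤ S) (h : ∀ x : P₀, (φ (Subgroup.inclusion hP x) : G) ∈ Q₀) :
    restrictHom φ hP h ∈ F.Hom P₀ Q₀ :=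
  mem_of_agree hφ hP hQ fun _ => rfl

theorem Conj.refl {P : Subgroup G} (hP : P ≤ S) : F.Conj P P :=
  ⟨MulEquiv.refl P, F.id_mem hP⟩

theorem Conj.symm {P Q : Subgroup G} (h : F.Conj P Q) : F.Conj Q P := by
  obtain ⟨e, he⟩ := h
  exact ⟨e.symm, F.symm_mem he⟩

theorem Conj.trans {P Q R : Subgroup G} (h : F.Conj P Q) (h' : F.Conj Q R) : F.Conj P R := by
  obtain ⟨e, he⟩ := h
  obtain ⟨e', he'⟩ := h'
  exact ⟨e.trans e', F.comp_mem he he'⟩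

theorem Conj.card_eq {P Q : Subgroup G} (h : F.Conj P Q) : Nat.card P = Nat.card Q := by
  obtain ⟨e, -⟩ := h
  exact Nat.card_congr e.toEquiv

theorem Conj.le_left {P Q : Subgroup G} (h : F.Conj P Q) : P ≤ S := by
  obtain ⟨e, he⟩ := h
  exact (F.le_of_mem he).1

theorem Conj.le_right {P Q : Subgroup G} (h : F.Conj P Q) : Q ≤ S :=
  h.symm.le_left

theorem eq_of_le_of_card_eq {P Q : Subgroup G} [Finite Q] (h : P ≤ Q)
    (hc : Nat.card P = Nat.card Q) : P = Q :=
  Subgroup.eq_of_le_of_card_ge h hc.ge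

theorem finite_of_le [Finite S] {P : Subgroup G} (h : P ≤ S) : Finite P :=
  Finite.of_injective _ (Subgroup.inclusion_injective h)

theorem Conj.eq_of_self [Finite S] {Q : Subgroup G} (h : F.Conj S Q) : Q = S :=
  eq_of_le_of_card_eq h.le_right h.card_eq.symm

theorem conj_of_mem_of_card_eq {P Q : Subgroup G} [Finite S] {φ : P →* Q} (hφ : φ ∈ F.Hom P Q)
    (hc : Nat.card P = Nat.card Q) : ∃ e : P ≃* Q, e.toMonoidHom = φ := by
  have := finite_of_le (F.le_of_mem hφ).1
  have := finite_of_le (F.le_of_mem hφ).2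
  have hb := (Nat.bijective_iff_injective_and_card φ).2 ⟨F.injective hφ, hc⟩
  exact ⟨MulEquiv.ofBijective φ hb, rfl⟩

theorem isPGroup_of_le {p : ℕ} (hS : IsPGroup p S) {P : Subgroup G} (h : P ≤ S) :
    IsPGroup p P :=
  hS.of_injective _ (Subgroup.inclusion_injective h)

theorem card_lt_of_lt {P Q : Subgroup G} [Finite Q] (h : P < Q) : Nat.card P < Nat.card Q := by
  refine lt_of_le_of_ne (Nat.card_le_card_of_injective _ (Subgroup.inclusion_injective h.le)) ?_
  exact fun hc => h.ne (eq_of_le_of_card_eq h.le hc)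

/-- Normalizers grow in the nilpotent group `S`; the rest transports this to subgroups of `G`. -/
theorem lt_normalizer {p : ℕ} [Fact p.Prime] [Finite S] (hS : IsPGroup p S) {P : Subgroup G}
    (h : P < S) : P < S ⊓ Subgroup.normalizer (P : Set G) := by
  have := hS.isNilpotent
  have hlt := Group.normalizerCondition_of_isNilpotent (G := S) (P.subgroupOf S) (by
    rw [lt_top_iff_ne_top]
    intro h'
    exact h.not_ge (Subgroup.subgroupOf_eq_top.1 h'))
  obtain ⟨x, hx, hxn⟩ := SetLike.exists_of_lt hlt
  refine lt_of_le_of_ne (le_inf h.le Subgroup.le_normalizer) fun he => hxn ?_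
  rw [Subgroup.mem_subgroupOf, he]
  refine ⟨x.2, Subgroup.mem_normalizer_iff.2 fun y => ?_⟩
  rw [Subgroup.mem_normalizer_iff] at hx
  constructor
  · intro hy
    simpa [Subgroup.mem_subgroupOf] using (hx ⟨y, h.le hy⟩).1 hy
  · intro hy
    have hyS : y ∈ S := by
      have := S.mul_mem (S.mul_mem (S.inv_mem x.2) (h.le hy)) x.2
      simpa [mul_assoc] using this
    have := (hx ⟨y, hyS⟩).2 (by simpa [Subgroup.mem_subgroupOf] using hy)
    simpa [Subgroup.mem_subgroupOf] using this

/-! ### Automizers and extensions -/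

theorem centralizerIn_le_normalizer (S P : Subgroup G) :
    centralizerIn S P ≤ S ⊓ Subgroup.normalizer (P : Set G) :=
  inf_le_inf_left _ (Subgroup.centralizer_le_normalizer _)

theorem mem_centralizerIn {P : Subgroup G} {g : G} :
    g ∈ centralizerIn S P ↔ g ∈ S ∧ ∀ x ∈ P, g * x * g⁻¹ = x := by
  simp only [centralizerIn, Subgroup.mem_inf, Subgroup.mem_centralizer_iff]
  refine and_congr_right fun _ => forall₂_congr fun x _ => ?_
  rw [mul_inv_eq_iff_eq_mul]
  exact eq_comm

theorem centralizerIn_le_extensionGroup {P Q : Subgroup G} (φ : Q ≃* P) :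
    centralizerIn S Q ≤ extensionGroup S φ := by
  intro g hg
  refine ⟨centralizerIn_le_normalizer S Q hg, 1, S.one_mem, fun x y hy => ?_⟩
  rw [(mem_centralizerIn.1 hg).2 x x.2] at hy
  rw [Subtype.ext hy]
  simp

theorem le_extensionGroup {P Q : Subgroup G} (hQ : Q ≤ S) (hP : P ≤ S) (φ : Q ≃* P) :
    Q ≤ extensionGroup S φ := by
  intro g hg
  refine ⟨⟨hQ hg, Subgroup.le_normalizer hg⟩, φ ⟨g, hg⟩, hP (φ ⟨g, hg⟩).2, fun x y hy => ?_⟩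
  have : y = ⟨g, hg⟩ * x * ⟨g, hg⟩⁻¹ := Subtype.ext hy
  rw [this]
  simp

theorem extensionGroup_le {P Q : Subgroup G} (φ : Q ≃* P) : extensionGroup S φ ≤ S :=
  fun _ hg => hg.1.1

theorem extension_centralizes {P Q R : Subgroup G} {φ : Q ≃* P} (hQ : Q ≤ R) {ψ : R →* S}
    (hψ : ∀ (x : Q) (y : R), (y : G) = x → (ψ y : G) = φ x) {g : R}
    (hg : (g : G) ∈ centralizerIn S Q) : (ψ g : G) ∈ centralizerIn S P := by
  refine mem_centralizerIn.2 ⟨(ψ g).2, fun x hx => ?_⟩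
  obtain ⟨y, hy⟩ := φ.surjective ⟨x, hx⟩
  have h1 : (ψ (Subgroup.inclusion hQ y) : G) = x := by
    rw [hψ y _ rfl, hy]
  have h2 : g * Subgroup.inclusion hQ y * g⁻¹ = Subgroup.inclusion hQ y :=
    Subtype.ext ((mem_centralizerIn.1 hg).2 y y.2)
  have := congrArg (fun z => (ψ z : G)) h2
  simpa [h1] using this

/-- Receptivity extends an isomorphism `Q → P` over `C_S(Q)`, and the extension embeds `C_S(Q)` in
`C_S(P)`. -/
theorem Receptive.fullyCentralized [Finite S] {P : Subgroup G} (hP : P ≤ S)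
    (h : F.Receptive P) : F.FullyCentralized P := by
  refine ⟨hP, fun Q hQ => ?_⟩
  obtain ⟨φ, hφ⟩ := hQ.symm
  obtain ⟨ψ, hψ, hext⟩ := h Q φ hφ
  have hle := centralizerIn_le_extensionGroup (S := S) φ
  have hQS := (F.le_of_mem hφ).1
  have : Finite (centralizerIn S P) :=
    finite_of_le (S := S) (inf_le_left : S ⊓ Subgroup.centralizer (P : Set G) ≤ S)
  refine Nat.card_le_card_of_injective
    (fun g : centralizerIn S Q => (⟨ψ ⟨g, hle g.2⟩,
      extension_centralizes (le_extensionGroup hQS hP φ) hext g.2⟩ : centralizerIn S P)) ?_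
  intro a b hab
  have := F.injective hψ (Subtype.ext (congrArg (fun z : centralizerIn S P => (z : G)) hab))
  exact Subtype.ext (congrArg (fun z : extensionGroup S φ => (z : G)) this)

theorem autIn_le_autGroup (F : FusionSystem S) {P : Subgroup G} (hP : P ≤ S) :
    autIn S P ≤ F.autGroup P hP := by
  rintro e ⟨g, hg, h⟩
  refine F.conj_mem hP hP g ⟨hg, fun x hx => ?_⟩ _ h
  rw [← h ⟨x, hx⟩]
  exact (e _).2

theorem isPGroup_autIn {p : ℕ} (hS : IsPGroup p S) (P : Subgroup G) :
    IsPGroup p (autIn S P) := by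
  rintro ⟨e, g, hg, h⟩
  obtain ⟨k, hk⟩ := hS ⟨g, hg⟩
  have hk' : g ^ p ^ k = 1 := congrArg (fun z : S => (z : G)) hk
  have key : ∀ (n : ℕ) (x : P), ((e ^ n) x : G) = g ^ n * x * (g ^ n)⁻¹ := by
    intro n
    induction n with
    | zero => simp
    | succ n ih =>
      intro x
      rw [pow_succ', MulAut.mul_apply, h, ih]
      simp [pow_succ', mul_assoc]
  refine ⟨k, Subtype.ext ?_⟩
  ext x
  simpa [hk'] using key (p ^ k) x

theorem exists_conj_mem_autIn {P : Subgroup G} {g : G}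
    (hg : g ∈ S ⊓ Subgroup.normalizer (P : Set G)) :
    ∃ e ∈ autIn S P, ∀ x : P, (e x : G) = g * x * g⁻¹ := by
  have h := Subgroup.mem_normalizer_iff.1 hg.2
  let e : MulAut P :=
    { toFun := fun x => ⟨g * x * g⁻¹, (h x).1 x.2⟩
      invFun := fun x => ⟨g⁻¹ * x * g, (h _).2 (by simp [mul_assoc])⟩
      left_inv := fun x => Subtype.ext (by simp [mul_assoc])
      right_inv := fun x => Subtype.ext (by simp [mul_assoc])
      map_mul' := fun x y => Subtype.ext (by simp [mul_assoc]) }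
  exact ⟨e, ⟨g, hg.1, fun _ => rfl⟩, fun _ => rfl⟩

/-- If `Q` is fully automized and receptive, some isomorphism `P → Q` extends to `N_S(P)`. -/
theorem exists_extension_normalizer {p : ℕ} [Fact p.Prime] [Finite S] (hS : IsPGroup p S)
    {P Q : Subgroup G} (hc : F.Conj P Q) (hA : F.FullyAutomized p Q) (hR : F.Receptive Q) :
    ∃ e : P ≃* Q, e.toMonoidHom ∈ F.Hom P Q ∧
      ∃ ψ ∈ F.Hom (S ⊓ Subgroup.normalizer (P : Set G)) S,
        ∀ (x : P) (y : ↥(S ⊓ Subgroup.normalizer (P : Set G))), (y : G) = x → (ψ y : G) = e x := by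
  obtain ⟨φ, hφ⟩ := hc
  obtain ⟨hQ, A, hA⟩ := hA
  have hP := (F.le_of_mem hφ).1
  have := finite_of_le hQ
  let B : Subgroup (MulAut Q) := (autIn S P).map (MulAut.congr φ).toMonoidHom
  have hB : IsPGroup p B := (isPGroup_autIn hS P).map _
  have hBF : B ≤ F.autGroup Q hQ := by
    rintro _ ⟨b, hb, rfl⟩
    exact F.comp_mem (F.symm_mem hφ) (F.comp_mem (F.autIn_le_autGroup hP hb) hφ)
  -- The transport of `Aut_S(P)` along `φ` lies in a Sylow subgroup of `Aut_F(Q)`. Following `φ` by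
  -- an `α` that conjugates this subgroup onto `Aut_S(Q)` makes the extension group contain all of
  -- `N_S(P)`.
  obtain ⟨B', hB'⟩ := (hB.comap_subtype (K := F.autGroup Q hQ)).exists_le_sylow
  obtain ⟨α, hα⟩ := MulAction.exists_smul_eq (F.autGroup Q hQ) B' A
  refine ⟨φ.trans (α : MulAut Q), F.comp_mem hφ α.2, ?_⟩
  have hN : S ⊓ Subgroup.normalizer (P : Set G) ≤ extensionGroup S (φ.trans (α : MulAut Q)) := by
    intro g hg
    obtain ⟨e, he, hge⟩ := exists_conj_mem_autIn hg
    have h1 : MulAut.congr φ e ∈ B := ⟨e, he, rfl⟩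
    let b : F.autGroup Q hQ := ⟨MulAut.congr φ e, hBF h1⟩
    have h2 : b ∈ B' := hB' (Subgroup.mem_subgroupOf.2 h1)
    have h3 : α * b * α⁻¹ ∈ A := by
      rw [← hα]
      exact ⟨b, h2, rfl⟩
    have h4 : α * b * α⁻¹ ∈ (autIn S Q).subgroupOf (F.autGroup Q hQ) := by
      rw [← hA]
      exact h3
    obtain ⟨h, hh, h5⟩ := Subgroup.mem_subgroupOf.1 h4
    refine ⟨hg, h, hh, fun x y hy => ?_⟩
    have hy' : y = e x := Subtype.ext (by rw [hy, hge])
    have := h5 ((α : MulAut Q) (φ x))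
    simpa [b, hy', MulAut.congr] using this
  obtain ⟨ψ, hψ, hext⟩ := hR P (φ.trans (α : MulAut Q)) (F.comp_mem hφ α.2)
  refine ⟨ψ.comp (Subgroup.inclusion hN),
    F.comp_mem (F.inclusion_mem hN (extensionGroup_le _)) hψ, fun x y hy => ?_⟩
  exact hext x _ hy

end FusionSystem

end FusionBasics

/-! ### Alperin's fusion theorem -/

section Alperin

variable {G : Type u} [Group G] {S : Subgroup G}

namespace FusionSystem

variable {F : FusionSystem S}

theorem centric_self [Finite S] (F : FusionSystem S) : F.Centric S :=
  ⟨le_rfl, fun Q hQ => by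
    rw [hQ.eq_of_self]
    exact inf_le_left⟩

theorem Saturated.fullyAutomized_self {p : ℕ} [Finite S] (hF : F.Saturated p) :
    F.FullyAutomized p S := by
  obtain ⟨Q, hQ, hA, -⟩ := hF S le_rfl
  rwa [hQ.eq_of_self] at hA

theorem mem_range_conj_of_mem {P : Subgroup G} {g : G} (hg : g ∈ P) {e : MulAut P}
    (he : ∀ x : P, (e x : G) = g * x * g⁻¹) : e ∈ (MulAut.conj : P →* MulAut P).range := by
  refine ⟨⟨g, hg⟩, ?_⟩
  ext x
  simp [he x]

/-- A fully automized subgroup that is not radical has an automizer element induced by some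
`g ∉ P` all of whose `Aut_F(P)`-conjugates are induced by elements of `S`. -/
theorem FullyAutomized.exists_of_not_radical {p : ℕ} [Fact p.Prime] (hS : IsPGroup p S)
    {P : Subgroup G} (hA : F.FullyAutomized p P) (hr : ¬ F.Radical p P) :
    ∃ g ∈ S, g ∉ P ∧ ∃ k : MulAut P, (∀ x : P, (k x : G) = g * x * g⁻¹) ∧
      ∀ α : MulAut P, MulEquiv.toMonoidHom α ∈ F.Hom P P → α * k * α⁻¹ ∈ autIn S P := by
  obtain ⟨hP, A, hA⟩ := hA
  have hr' : ∃ N : Subgroup (F.autGroup P hP ⧸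
      ((MulAut.conj : P →* MulAut P).range.subgroupOf (F.autGroup P hP))),
      N.Normal ∧ IsPGroup p N ∧ N ≠ ⊥ := by
    by_contra hcon
    push Not at hcon
    exact hr ⟨hP, hcon⟩
  obtain ⟨N, hN, hNp, hN1⟩ := hr'
  obtain ⟨⟨n, hn⟩, hn1⟩ := Subgroup.ne_bot_iff_exists_ne_one.1 hN1
  replace hn1 : n ≠ 1 := fun h => hn1 (Subtype.ext h)
  obtain ⟨k, rfl⟩ := QuotientGroup.mk_surjective n
  -- The preimage `K` of `N` in `Aut_F(P)` is again a `p`-group, because `Inn(P)` is one. Being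
  -- normal, it lies in every Sylow subgroup, in particular in `Aut_S(P)`.
  let K := N.comap (QuotientGroup.mk' _)
  have hKp : IsPGroup p K := by
    refine hNp.comap_of_ker_isPGroup _ ?_
    rw [QuotientGroup.ker_mk']
    have h1 : IsPGroup p (MulAut.conj : P →* MulAut P).range :=
      (isPGroup_of_le hS hP).of_surjective _ (MulAut.conj : P →* MulAut P).rangeRestrict_surjective
    exact h1.comap_subtype
  have hKA : K ≤ A := hKp.le_sylow_of_normal A
  have hK : ∀ b ∈ K, (b : MulAut P) ∈ autIn S P := by
    intro b hb
    exact (hA ▸ hKA) hb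
  have hk : k ∈ K := hn
  obtain ⟨g, hg, hkg⟩ := hK k hk
  refine ⟨g, hg, fun hgP => hn1 ?_, k, hkg, fun α hα => ?_⟩
  · rw [QuotientGroup.eq_one_iff]
    exact mem_range_conj_of_mem hgP hkg
  · have hKn : K.Normal := inferInstance
    exact hK _ (hKn.conj_mem k hk ⟨α, hα⟩)

/-- The element `g ∉ P` inducing a non-inner automorphism in the normal `p`-subgroup lies in `N_α`
whatever `α` is. -/
theorem FullyAutomized.lt_extensionGroup_of_not_radical {p : ℕ} [Fact p.Prime]
    (hS : IsPGroup p S) {P : Subgroup G} (hA : F.FullyAutomized p P) (hr : ¬ F.Radical p P)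
    (α : P ≃* P) (hα : α.toMonoidHom ∈ F.Hom P P) : P < extensionGroup S α := by
  have hP := hA.1
  obtain ⟨g, hg, hgP, k, hk, hconj⟩ := hA.exists_of_not_radical hS hr
  refine lt_of_le_of_ne (le_extensionGroup hP hP α) fun he => hgP ?_
  rw [he]
  have hgN : g ∈ Subgroup.normalizer (P : Set G) := by
    refine Subgroup.mem_normalizer_iff.2 fun x => ⟨fun hx => ?_, fun hx => ?_⟩
    · rw [← hk ⟨x, hx⟩]
      exact (k _).2
    · have h1 := hk (k⁻¹ ⟨_, hx⟩)
      rw [MulAut.apply_inv_self] at h1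
      have h2 : x = (k⁻¹ ⟨_, hx⟩ : P) := by simpa using h1
      rw [h2]
      exact (k⁻¹ ⟨_, hx⟩ : P).2
  obtain ⟨h, hh, hαk⟩ := hconj α hα
  refine ⟨⟨hg, hgN⟩, h, hh, fun x y hy => ?_⟩
  have hy' : y = k x := Subtype.ext (by rw [hy, hk])
  have h1 := hαk (α x)
  rw [← h1, hy', MulAut.mul_apply, MulAut.mul_apply]
  simp [MulAut.inv_def]

/-- Receptivity carries an element of `C_S(Q)` outside `Q` to an element of `C_S(P)` outside `P`,
and `C_S(P)` is contained in every `N_α`. -/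
theorem Receptive.lt_extensionGroup_of_not_centric {P : Subgroup G} (hP : P ≤ S)
    (hR : F.Receptive P) (hc : ¬ F.Centric P) (α : P ≃* P) : P < extensionGroup S α := by
  have : ∃ Q, F.Conj P Q ∧ ∃ c ∈ centralizerIn S Q, c ∉ Q := by
    by_contra hcon
    push Not at hcon
    exact hc ⟨hP, hcon⟩
  obtain ⟨Q, hQ, c, hcQ, hcn⟩ := this
  obtain ⟨e, he⟩ := hQ.symm
  obtain ⟨ψ, hψ, hext⟩ := hR Q e he
  have hle := le_extensionGroup hQ.le_right hP e
  let c' : extensionGroup S e := ⟨c, centralizerIn_le_extensionGroup e hcQ⟩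
  have h1 : (ψ c' : G) ∈ centralizerIn S P := extension_centralizes hle hext (g := c') hcQ
  refine lt_of_le_of_ne (le_extensionGroup hP hP α) fun heq => hcn ?_
  have h2 : (ψ c' : G) ∈ P := by
    have h3 := centralizerIn_le_extensionGroup (S := S) α h1
    rwa [← heq] at h3
  obtain ⟨q, hq⟩ := e.surjective ⟨_, h2⟩
  have h3 : ψ (Subgroup.inclusion hle q) = ψ c' := Subtype.ext (by rw [hext q _ rfl, hq])
  have h4 := congrArg (fun z : extensionGroup S e => (z : G)) (F.injective hψ h3)
  rw [show c = q from h4.symm]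
  exact q.2

/-- Otherwise the extension group of the identity would be strictly larger than `S`. -/
theorem Saturated.radical_self {p : ℕ} [Fact p.Prime] [Finite S] (hS : IsPGroup p S)
    (hF : F.Saturated p) : F.Radical p S := by
  by_contra hr
  have := hF.fullyAutomized_self.lt_extensionGroup_of_not_radical hS hr (MulEquiv.refl S)
    (F.id_mem le_rfl)
  exact this.not_ge (extensionGroup_le _)

/-- Alperin's fusion theorem: a property of morphisms that is stable under composition, inverses
and restriction, and holds for the automorphisms of centric radical subgroups, holds for all
morphisms. -/
theorem Saturated.alperin {p : ℕ} [Fact p.Prime] [Finite S] (hS : IsPGroup p S)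
    (hF : F.Saturated p) (C : ∀ P Q : Subgroup G, (P →* Q) → Prop)
    (comp : ∀ (P Q R : Subgroup G) (φ : P →* Q) (ψ : Q →* R), φ ∈ F.Hom P Q → ψ ∈ F.Hom Q R →
      C P Q φ → C Q R ψ → C P R (ψ.comp φ))
    (symm : ∀ (P Q : Subgroup G) (e : P ≃* Q), e.toMonoidHom ∈ F.Hom P Q →
      C P Q e.toMonoidHom → C Q P e.symm.toMonoidHom)
    (restrict : ∀ (P Q P₀ Q₀ : Subgroup G) (φ : P →* Q) (φ₀ : P₀ →* Q₀) (hP : P₀ ≤ P),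
      φ ∈ F.Hom P Q → φ₀ ∈ F.Hom P₀ Q₀ →
      (∀ x : P₀, (φ₀ x : G) = φ (Subgroup.inclusion hP x)) → C P Q φ → C P₀ Q₀ φ₀)
    (aut : ∀ (R : Subgroup G) (e : R ≃* R), F.Centric R → F.Radical p R →
      e.toMonoidHom ∈ F.Hom R R → C R R e.toMonoidHom)
    (P Q : Subgroup G) (φ : P →* Q) (hφ : φ ∈ F.Hom P Q) : C P Q φ := by
  -- Descending induction on the order of the source: morphisms that extend to a larger subgroup are
  -- already covered.
  induction hn : Nat.card S - Nat.card P using Nat.strong_induction_on generalizing P Q with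
  | _ n ih =>
  have hP := (F.le_of_mem hφ).1
  have ih' : ∀ P' Q' : Subgroup G, ∀ φ' ∈ F.Hom P' Q', Nat.card P < Nat.card P' →
      C P' Q' φ' := by
    intro P' Q' φ' hφ' hlt
    have := Nat.card_le_card_of_injective _ (Subgroup.inclusion_injective (F.le_of_mem hφ').1)
    exact ih _ (by omega) P' Q' φ' hφ' rfl
  obtain ⟨R, hR, e, he, -, h3⟩ := F.factor hφ
  suffices h : C P R e.toMonoidHom from
    restrict P R P Q _ φ le_rfl he hφ (fun x => congrArg (fun f : P →* Q => ((f x : Q) : G)) h3) h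
  by_cases hPS : P = S
  · subst hPS
    have : R = P := (show F.Conj P R from ⟨e, he⟩).eq_of_self
    subst this
    exact aut R e F.centric_self (hF.radical_self hS) he
  have hcard : ∀ P' : Subgroup G, F.Conj P' P →
      Nat.card P < Nat.card ↥(S ⊓ Subgroup.normalizer (P' : Set G)) := by
    intro P' hc
    have hne : P' ≠ S := by
      rintro rfl
      exact hPS hc.eq_of_self
    have := finite_of_le (S := S) (inf_le_left : S ⊓ Subgroup.normalizer (P' : Set G) ≤ S)
    rw [← hc.card_eq]
    exact card_lt_of_lt (lt_normalizer hS (lt_of_le_of_ne hc.le_left hne))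
  obtain ⟨Q', hQ', hA, hRec⟩ := hF P hP
  have hext : ∀ P' : Subgroup G, F.Conj P' P → ∃ e : P' ≃* Q', e.toMonoidHom ∈ F.Hom P' Q' ∧
      C P' Q' e.toMonoidHom := by
    intro P' hc
    obtain ⟨e, he, ψ, hψ, hx⟩ := exists_extension_normalizer hS (hc.trans hQ') hA hRec
    refine ⟨e, he, ?_⟩
    have hle : P' ≤ S ⊓ Subgroup.normalizer (P' : Set G) := le_inf hc.le_left Subgroup.le_normalizer
    exact restrict _ _ P' Q' ψ _ hle hψ he (fun x => (hx x _ rfl).symm)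
      (ih' _ _ ψ hψ (hcard P' hc))
  -- Both ends reach `Q'` by maps that extend to strictly larger normalizers, so only the
  -- automorphism `α = e₂ e e₁⁻¹` of `Q'` remains.
  obtain ⟨e₁, he₁, hC₁⟩ := hext P (Conj.refl hP)
  obtain ⟨e₂, he₂, hC₂⟩ := hext R (Conj.symm ⟨e, he⟩)
  let α : Q' ≃* Q' := (e₁.symm.trans e).trans e₂
  have hα : α.toMonoidHom ∈ F.Hom Q' Q' := F.comp_mem (F.comp_mem (F.symm_mem he₁) he) he₂
  have hCα : C Q' Q' α.toMonoidHom := by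
    have big : Q' < extensionGroup S α → C Q' Q' α.toMonoidHom := by
      intro hlt
      obtain ⟨ψ, hψ, hx⟩ := hRec Q' α hα
      have := finite_of_le (extensionGroup_le (S := S) α)
      refine restrict _ _ Q' Q' ψ _ hlt.le hψ hα (fun x => (hx x _ rfl).symm) (ih' _ _ ψ hψ ?_)
      rw [hQ'.card_eq]
      exact card_lt_of_lt hlt
    by_cases hc : F.Centric Q'
    · by_cases hr : F.Radical p Q'
      · exact aut Q' α hc hr hα
      · exact big (hA.lt_extensionGroup_of_not_radical hS hr α hα)
    · exact big (hRec.lt_extensionGroup_of_not_centric hQ'.le_right hc α)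
  have := comp _ _ _ _ _ (F.comp_mem he₁ hα) (F.symm_mem he₂)
    (comp _ _ _ _ _ he₁ hα hC₁ hCα) (symm _ _ e₂ he₂ hC₂)
  convert this using 1
  ext x
  simp [α]

end FusionSystem

end Alperin

/-! ### Lifts, factorizations and cancellation in a linking system -/

section LinkingBasics

variable {G : Type u} [Group G] {p : ℕ} {S : Subgroup G} {F : FusionSystem S}

namespace LinkingSystem

open FusionSystem

variable (L : LinkingSystem.{u, v} p F)

theorem δ_comp {P Q R : L.Ob} {g h : G} (hg : g ∈ transporter S P.grp Q.grp)
    (hh : h ∈ transporter S Q.grp R.grp) :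
    L.δ P Q ⟨g, hg⟩ ≫ L.δ Q R ⟨h, hh⟩ = L.δ P R ⟨h * g, mul_mem_transporter hg hh⟩ :=
  (L.δ_mul P Q R ⟨g, hg⟩ ⟨h, hh⟩).symm

theorem δ_congr {P Q : L.Ob} {g h : G} (hg : g ∈ transporter S P.grp Q.grp)
    (hh : h ∈ transporter S P.grp Q.grp) (e : g = h) : L.δ P Q ⟨g, hg⟩ = L.δ P Q ⟨h, hh⟩ := by
  subst e
  rfl

theorem δ_comp_congr {P Q Q' R : L.Ob} {g h g' h' : G} (hg : g ∈ transporter S P.grp Q.grp)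
    (hh : h ∈ transporter S Q.grp R.grp) (hg' : g' ∈ transporter S P.grp Q'.grp)
    (hh' : h' ∈ transporter S Q'.grp R.grp) (e : h * g = h' * g') :
    L.δ P Q ⟨g, hg⟩ ≫ L.δ Q R ⟨h, hh⟩ = L.δ P Q' ⟨g', hg'⟩ ≫ L.δ Q' R ⟨h', hh'⟩ := by
  rw [δ_comp, δ_comp]
  exact L.δ_congr _ _ e

theorem incl_comp_incl {P Q R : L.Ob} (h : P.grp ≤ Q.grp) (h' : Q.grp ≤ R.grp) :
    L.incl h ≫ L.incl h' = L.incl (h.trans h') := by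
  unfold incl
  rw [δ_comp]
  exact L.δ_congr _ _ (mul_one 1)

theorem incl_refl (P : L.Ob) (h : P.grp ≤ P.grp) : L.incl h = 𝟙 P := L.δ_one P

theorem δ_comp_incl {P Q P' Q' : L.Ob} (h : P.grp ≤ P'.grp) (h' : Q.grp ≤ Q'.grp) {g : G}
    (hg : g ∈ transporter S P.grp Q.grp) (hg' : g ∈ transporter S P'.grp Q'.grp) :
    L.δ P Q ⟨g, hg⟩ ≫ L.incl h' = L.incl h ≫ L.δ P' Q' ⟨g, hg'⟩ :=
  L.δ_comp_congr _ _ _ _ (by simp)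

theorem π_incl {P Q : L.Ob} (h : P.grp ≤ Q.grp) (x : P.grp) : (L.π (L.incl h) x : G) = x := by
  unfold incl
  rw [L.π_δ]
  simp

theorem π_comp_apply {P Q R : L.Ob} (ψ : P ⟶ Q) (χ : Q ⟶ R) (x : P.grp) :
    L.π (ψ ≫ χ) x = L.π χ (L.π ψ x) := by
  rw [L.π_comp]
  rfl

theorem π_injective {P Q : L.Ob} (ψ : P ⟶ Q) : Function.Injective (L.π ψ) :=
  F.injective (L.π_mem ψ)

theorem top_mem (P : L.Ob) : S ∈ L.Obj :=
  L.obj_overgroup _ P.mem S (L.obj_le _ P.mem) le_rfl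

theorem isIso_δ {P Q : L.Ob} {g : G} (hg : g ∈ transporter S P.grp Q.grp)
    (hg' : g⁻¹ ∈ transporter S Q.grp P.grp) : IsIso (L.δ P Q ⟨g, hg⟩) :=
  ⟨L.δ Q P ⟨g⁻¹, hg'⟩, by
    rw [δ_comp, ← L.δ_one]
    exact L.δ_congr _ _ (inv_mul_cancel g), by
    rw [δ_comp, ← L.δ_one]
    exact L.δ_congr _ _ (mul_inv_cancel g)⟩

theorem centralizer_mem_transporter {S P : Subgroup G} {g : G} (hg : g ∈ centralizerIn S P) :
    g ∈ transporter S P P :=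
  normalizer_mem_transporter (centralizerIn_le_normalizer S P hg)

/-- (A2) provides lifts only from fully centralized sources; an isomorphism of `L` to such an object
removes the restriction. -/
theorem exists_lift {P Q : L.Ob} {φ : P.grp →* Q.grp} (hφ : φ ∈ F.Hom P.grp Q.grp) :
    ∃ ψ : P ⟶ Q, L.π ψ = φ := by
  obtain ⟨P', hP', ⟨i⟩⟩ := L.iso_fullyCentralized P
  obtain ⟨χ, hχ⟩ := L.π_surjective P' Q hP' _ (F.comp_mem (L.π_mem i.inv) hφ)
  refine ⟨i.hom ≫ χ, ?_⟩
  rw [L.π_comp, hχ, MonoidHom.comp_assoc, ← L.π_comp, i.hom_inv_id, L.π_id, MonoidHom.comp_id]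

/-- After transport to a fully centralized object, the morphism has the same projection as the
identity, so it is some invertible `δ(a)`. -/
theorem isIso_of_π_eq_id {P : L.Ob} (θ : P ⟶ P) (h : L.π θ = MonoidHom.id P.grp) :
    IsIso θ := by
  obtain ⟨P', hP', ⟨i⟩⟩ := L.iso_fullyCentralized P
  have h1 : L.π (𝟙 P') = L.π (i.inv ≫ θ ≫ i.hom) := by
    rw [L.π_comp, L.π_comp, h, MonoidHom.comp_id, ← L.π_comp, i.inv_hom_id]
  obtain ⟨⟨a, ha⟩, haC, h2⟩ := (L.π_eq_iff P' P' hP' _ _).1 h1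
  have := L.isIso_δ ha (centralizer_mem_transporter (Subgroup.inv_mem _ haC))
  have h3 : θ = i.hom ≫ L.δ P' P' ⟨a, ha⟩ ≫ i.inv := by
    rw [Category.comp_id] at h2
    rw [← h2]
    simp
  rw [h3]
  infer_instance

/-- A morphism between objects of the same order is an isomorphism. -/
theorem isIso_of_card_eq [Finite S] {P Q : L.Ob} (ψ : P ⟶ Q)
    (h : Nat.card P.grp = Nat.card Q.grp) : IsIso ψ := by
  obtain ⟨e, he⟩ := conj_of_mem_of_card_eq (L.π_mem ψ) h
  have heF : e.toMonoidHom ∈ F.Hom P.grp Q.grp := he ▸ L.π_mem ψ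
  obtain ⟨χ, hχ⟩ := L.exists_lift (F.symm_mem heF)
  have h1 : IsIso (ψ ≫ χ) := L.isIso_of_π_eq_id _ (by
    rw [L.π_comp, hχ, ← he]
    ext x
    simp)
  have h2 : IsIso (χ ≫ ψ) := L.isIso_of_π_eq_id _ (by
    rw [L.π_comp, hχ, ← he]
    ext x
    simp)
  have h3 : ψ ≫ (χ ≫ inv (ψ ≫ χ)) = 𝟙 P := by
    rw [← Category.assoc]
    simp
  have h4 : (inv (χ ≫ ψ) ≫ χ) ≫ ψ = 𝟙 Q := by simp
  have h5 : inv (χ ≫ ψ) ≫ χ = χ ≫ inv (ψ ≫ χ) := by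
    calc inv (χ ≫ ψ) ≫ χ = (inv (χ ≫ ψ) ≫ χ) ≫ (ψ ≫ (χ ≫ inv (ψ ≫ χ))) := by
          rw [h3, Category.comp_id]
      _ = ((inv (χ ≫ ψ) ≫ χ) ≫ ψ) ≫ (χ ≫ inv (ψ ≫ χ)) := by simp only [Category.assoc]
      _ = _ := by rw [h4, Category.id_comp]
  exact ⟨_, h3, by rw [← h5, h4]⟩

theorem card_eq_of_iso {P Q : L.Ob} (i : P ≅ Q) : Nat.card P.grp = Nat.card Q.grp := by
  refine Nat.card_congr ⟨L.π i.hom, L.π i.inv, fun x => ?_, fun x => ?_⟩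
  · rw [← L.π_comp_apply, i.hom_inv_id, L.π_id]
    rfl
  · rw [← L.π_comp_apply, i.inv_hom_id, L.π_id]
    rfl

/-- A morphism factors through every subgroup containing its image. -/
theorem exists_factor {P Q Q₀ : L.Ob} (ψ : P ⟶ Q) (hQ : Q₀.grp ≤ Q.grp)
    (h : ∀ x : P.grp, (L.π ψ x : G) ∈ Q₀.grp) : ∃ ψ₀ : P ⟶ Q₀, ψ₀ ≫ L.incl hQ = ψ := by
  obtain ⟨P', hP', ⟨i⟩⟩ := L.iso_fullyCentralized P
  let ψ' := i.inv ≫ ψ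
  have h' : ∀ x : P'.grp, (L.π ψ' (Subgroup.inclusion le_rfl x) : G) ∈ Q₀.grp := fun x => by
    rw [L.π_comp_apply]
    exact h _
  obtain ⟨χ, hχ⟩ := L.exists_lift
    (restrictHom_mem (L.π_mem ψ') le_rfl (L.obj_le _ Q₀.mem) h')
  have h1 : L.π (χ ≫ L.incl hQ) = L.π ψ' := by
    ext x
    rw [L.π_comp_apply, L.π_incl, hχ]
    rfl
  -- The lift through `Q₀` agrees with `ψ'` only in `F`; the discrepancy `δ(a)` is absorbed at the
  -- source.
  obtain ⟨a, -, h2⟩ := (L.π_eq_iff P' Q hP' _ _).1 h1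
  refine ⟨i.hom ≫ L.δ P' P' a ≫ χ, ?_⟩
  rw [Category.assoc, Category.assoc, ← h2]
  simp [ψ']

/-- Two morphisms equalized by `χ` have the same projection, as projections are injective. They
therefore differ by some `δ(a)`, which then fixes the composite with `χ`, and freeness gives `a =
1`. -/
instance mono {Q R : L.Ob} (χ : Q ⟶ R) : Mono χ := by
  constructor
  intro P ψ ψ' h
  obtain ⟨P', hP', ⟨i⟩⟩ := L.iso_fullyCentralized P
  have h1 : L.π (i.inv ≫ ψ) = L.π (i.inv ≫ ψ') := by
    ext x
    apply congrArg
    apply L.π_injective χ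
    rw [← L.π_comp_apply, ← L.π_comp_apply, Category.assoc, Category.assoc, h]
  obtain ⟨⟨a, ha⟩, haC, h2⟩ := (L.π_eq_iff P' Q hP' _ _).1 h1
  have h3 : L.δ P' P' ⟨a, ha⟩ ≫ (i.inv ≫ ψ ≫ χ) = i.inv ≫ ψ ≫ χ := by
    have := congrArg (fun f => f ≫ χ) h2
    simp only [Category.assoc] at this
    rw [← this, h]
  have h4 : a = 1 := L.free P' R hP' _ ⟨a, ha⟩ haC h3
  subst h4
  rw [L.δ_one, Category.id_comp] at h2
  exact ((cancel_epi i.inv).1 h2).symm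

variable {L}

theorem exists_receptive_iso [Finite S] (hF : F.Saturated p) (P : L.Ob) :
    ∃ Q : L.Ob, F.FullyAutomized p Q.grp ∧ F.Receptive Q.grp ∧ F.Conj P.grp Q.grp := by
  obtain ⟨Q, hQ, hA, hR⟩ := hF P.grp (L.obj_le _ P.mem)
  exact ⟨⟨Q, L.obj_conj _ P.mem _ hQ⟩, hA, hR, hQ⟩

/-- Freeness is given only for fully centralized sources. Extending an isomorphism onto a receptive
`Q` over `c` carries `δ_P(c)` to `δ_Q(φ(c))`, where freeness applies; then `φ(c) = 1` forces `c =
1`. -/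
theorem eq_one_of_δ_eq_id [Finite S] (hF : F.Saturated p) {P : L.Ob} {c : G}
    (hc : c ∈ centralizerIn S P.grp) (ht : c ∈ transporter S P.grp P.grp)
    (h : L.δ P P ⟨c, ht⟩ = 𝟙 P) : c = 1 := by
  obtain ⟨Q, -, hR, e, he⟩ := exists_receptive_iso hF P
  have hP := L.obj_le _ P.mem
  have hQ := L.obj_le _ Q.mem
  obtain ⟨φ, hφ, hext⟩ := hR P.grp e he
  have hPN : P.grp ≤ extensionGroup S e := le_extensionGroup hP hQ e
  have hcN : c ∈ extensionGroup S e := centralizerIn_le_extensionGroup e hc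
  let N : L.Ob := ⟨extensionGroup S e, L.obj_overgroup _ P.mem _ hPN (extensionGroup_le e)⟩
  let S' : L.Ob := ⟨S, L.top_mem P⟩
  obtain ⟨ψ, hψ⟩ := L.exists_lift (P := N) (Q := S') hφ
  have hQS : Q.grp ≤ S'.grp := hQ
  obtain ⟨χ, hχ⟩ := L.exists_factor (L.incl (P := P) (Q := N) hPN ≫ ψ) hQS (fun x => by
    rw [L.π_comp_apply, hψ, hext x _ (L.π_incl _ x)]
    exact (e x).2)
  have hχi : IsIso χ := L.isIso_of_card_eq χ (Nat.card_congr e.toEquiv)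
  have hφc : (φ ⟨c, hcN⟩ : G) ∈ centralizerIn S Q.grp :=
    extension_centralizes hPN hext (g := ⟨c, hcN⟩) hc
  have hcomm := L.δ_comm ψ ⟨c, hcN⟩ ⟨c, self_mem_transporter (extensionGroup_le e) hcN⟩
    ⟨φ ⟨c, hcN⟩, self_mem_transporter le_rfl (φ ⟨c, hcN⟩).2⟩ rfl (by rw [hψ])
  have h1 : χ ≫ L.δ Q Q ⟨_, centralizer_mem_transporter hφc⟩ ≫ L.incl hQS = χ ≫ L.incl hQS := by
    rw [L.δ_comp_incl hQS hQS _ (self_mem_transporter le_rfl (φ ⟨c, hcN⟩).2), ← Category.assoc, hχ,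
      Category.assoc, ← hcomm, ← Category.assoc, ← L.δ_comp_incl hPN hPN ht, h, Category.id_comp]
  have h2 := L.free Q S' (hR.fullyCentralized hQ) _ _ hφc ((cancel_epi χ).1 h1)
  have h3 : φ ⟨c, hcN⟩ = 1 := Subtype.ext h2
  have h4 := F.injective hφ (h3.trans (map_one φ).symm)
  exact congrArg (fun z : extensionGroup S e => (z : G)) h4

theorem δ_injective [Finite S] (hF : F.Saturated p) {P Q : L.Ob} {g h : G}
    (hg : g ∈ transporter S P.grp Q.grp) (hh : h ∈ transporter S P.grp Q.grp)
    (e : L.δ P Q ⟨g, hg⟩ = L.δ P Q ⟨h, hh⟩) : g = h := by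
  have hC : h⁻¹ * g ∈ centralizerIn S P.grp := by
    refine mem_centralizerIn.2 ⟨S.mul_mem (S.inv_mem hh.1) hg.1, fun x hx => ?_⟩
    have h1 := L.π_δ P Q ⟨g, hg⟩ ⟨x, hx⟩
    rw [e, L.π_δ] at h1
    have h2 : h * x * h⁻¹ = g * x * g⁻¹ := h1
    calc h⁻¹ * g * x * (h⁻¹ * g)⁻¹ = h⁻¹ * (g * x * g⁻¹) * h := by group
      _ = x := by rw [← h2]; group
  have h3 : L.δ P P ⟨_, centralizer_mem_transporter hC⟩ ≫ L.δ P Q ⟨h, hh⟩ =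
      𝟙 P ≫ L.δ P Q ⟨h, hh⟩ := by
    rw [δ_comp, Category.id_comp, ← e]
    exact L.δ_congr _ _ (by group)
  have h4 := eq_one_of_δ_eq_id hF hC _ ((cancel_mono _).1 h3)
  exact (inv_mul_eq_one.1 h4).symm

/-- An isomorphism `θ : P → Q` with `Q` receptive extends to the subgroups `R ≥ P` of `N_S(P)`
which `θ` conjugates into `N_S(Q)`. -/
theorem exists_extension_of_receptive [Finite S] (hF : F.Saturated p) {P Q : L.Ob}
    (hR : F.Receptive Q.grp) (θ : P ⟶ Q) [IsIso θ] {R : Subgroup G} (hPR : P.grp ≤ R)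
    (h : ∀ g ∈ R, ∃ (hg : g ∈ transporter S P.grp P.grp) (k : G)
      (hk : k ∈ transporter S Q.grp Q.grp), L.δ P P ⟨g, hg⟩ ≫ θ = θ ≫ L.δ Q Q ⟨k, hk⟩) :
    ∃ v ∈ F.Hom R S, (∀ x : P.grp, (v (Subgroup.inclusion hPR x) : G) = L.π θ x) ∧
      ∀ (g : R) (hg : (g : G) ∈ transporter S P.grp P.grp) (k : G)
        (hk : k ∈ transporter S Q.grp Q.grp),
        L.δ P P ⟨g, hg⟩ ≫ θ = θ ≫ L.δ Q Q ⟨k, hk⟩ → (v g : G) = k := by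
  have hRS : R ≤ S := fun g hg => (h g hg).1.1
  have hP := L.obj_le _ P.mem
  have hQ := L.obj_le _ Q.mem
  obtain ⟨e, he⟩ := conj_of_mem_of_card_eq (L.π_mem θ) (L.card_eq_of_iso (asIso θ))
  have heF : e.toMonoidHom ∈ F.Hom P.grp Q.grp := he ▸ L.π_mem θ
  have he' : ∀ x, e x = L.π θ x := fun x => by rw [← he]; rfl
  have hRN : R ≤ extensionGroup S e := by
    intro g hg
    obtain ⟨hgt, k, hk, hgk⟩ := h g hg
    have hgt' := (h g⁻¹ (R.inv_mem hg)).1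
    refine ⟨⟨hgt.1, Subgroup.mem_normalizer_iff.2 fun x => ⟨hgt.2 x, fun hx => ?_⟩⟩, k, hk.1,
      fun x y hy => ?_⟩
    · simpa [mul_assoc] using hgt'.2 _ hx
    · have h1 := congrArg (fun f => (L.π f x : G)) hgk
      simp only [L.π_comp_apply] at h1
      rw [L.π_δ] at h1
      rw [he', he', ← h1]
      congr 2
      exact Subtype.ext (hy.trans (L.π_δ P P ⟨g, hgt⟩ x).symm)
  obtain ⟨φ, hφ, hext⟩ := hR P.grp e heF
  let R' : L.Ob := ⟨R, L.obj_overgroup _ P.mem _ hPR hRS⟩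
  let S' : L.Ob := ⟨S, L.top_mem P⟩
  have hPR' : P.grp ≤ R'.grp := hPR
  have hQS : Q.grp ≤ S'.grp := hQ
  obtain ⟨ψ, hψ⟩ := L.exists_lift (P := R') (Q := S')
    (F.comp_mem (F.inclusion_mem hRN (extensionGroup_le e)) hφ)
  have h1 : L.π (L.incl hQS) = L.π (inv θ ≫ L.incl hPR' ≫ ψ) := by
    ext x
    obtain ⟨y, rfl⟩ := e.surjective x
    have hy : L.π (inv θ) (e y) = y := by
      rw [he', ← L.π_comp_apply, IsIso.hom_inv_id, L.π_id]
      rfl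
    rw [L.π_incl, L.π_comp_apply, hy, L.π_comp_apply, hψ]
    exact (hext y _ (L.π_incl _ y)).symm
  obtain ⟨⟨c, hc⟩, hcC, h2⟩ := (L.π_eq_iff Q S' (hR.fullyCentralized hQ) _ _).1 h1
  have hcS : c⁻¹ ∈ transporter S S'.grp S'.grp :=
    self_mem_transporter le_rfl (S.inv_mem hc.1)
  -- On `P` the lift `ψ` is `θ` followed by `δ(c)` with `c ∈ C_S(Q)`. Composing with `δ_S(c⁻¹)`
  -- makes it restrict to `θ` in `L`, not merely in `F`, which is needed to identify the value at
  -- `g` with `k`.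
  let ψ' : R' ⟶ S' := ψ ≫ L.δ S' S' ⟨c⁻¹, hcS⟩
  have h3 : L.incl hPR' ≫ ψ' = θ ≫ L.incl hQS := by
    have h4 : L.incl hPR' ≫ ψ = θ ≫ L.δ Q Q ⟨c, hc⟩ ≫ L.incl hQS := by
      rw [← h2]
      simp
    simp only [ψ']
    rw [← Category.assoc, h4, Category.assoc, Category.assoc]
    congr 1
    unfold incl
    rw [δ_comp, δ_comp]
    exact L.δ_congr _ _ (by simp)
  clear_value ψ'
  refine ⟨L.π ψ', L.π_mem ψ', fun x => ?_, fun g hg k hk hgk => ?_⟩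
  · have h4 := congrArg (fun f => (L.π f x : G)) h3
    simp only [L.π_comp_apply] at h4
    rw [L.π_incl] at h4
    rw [← h4]
    congr 2
    exact Subtype.ext (L.π_incl hPR' x).symm
  · have hgR : (g : G) ∈ transporter S R'.grp R'.grp := self_mem_transporter hRS g.2
    have hvS : (L.π ψ' g : G) ∈ transporter S S'.grp S'.grp :=
      self_mem_transporter le_rfl (L.π ψ' g).2
    have hkS : k ∈ transporter S S'.grp S'.grp := self_mem_transporter le_rfl hk.1
    -- By (C) for `ψ'`, the element `v(g)` plays the role of `k`; injectivity of `δ` then identifies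
    -- the two.
    have h4 : θ ≫ L.incl hQS ≫ L.δ S' S' ⟨_, hvS⟩ = θ ≫ L.incl hQS ≫ L.δ S' S' ⟨k, hkS⟩ := by
      rw [← L.δ_comp_incl hQS hQS hk hkS, ← Category.assoc, ← Category.assoc θ, ← hgk, ← h3,
        Category.assoc, Category.assoc, ← h3, ← Category.assoc (L.δ P P _),
        L.δ_comp_incl hPR' hPR' hg hgR, Category.assoc]
      congr 1
      exact (L.δ_comm ψ' g _ _ rfl rfl).symm
    have h5 := (cancel_epi θ).1 h4
    unfold incl at h5
    rw [δ_comp, δ_comp] at h5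
    simpa using δ_injective hF _ _ h5

end LinkingSystem

end LinkingBasics

/-! ### Two lemmas on finite groups and coprime orders -/

section GroupLemmas

/-- Modulo `K ∩ N` the elements `g` and `x` commute. With `e ≡ 1` modulo the order of `g` and `e ≡
0` modulo that of `x`, the power `(gx)^e` commutes with `a` and equals `g` up to an element of `K ∩
N`. -/
theorem Commute.of_coprime_mul {A : Type*} [Group A] {K N : Subgroup A} (hK : K.Normal)
    (hN : N.Normal) {a g x : A} (hg : g ∈ K) (hx : x ∈ N)
    (hc : (orderOf g).Coprime (orderOf x)) (hgx : Commute (g * x) a)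
    (hZ : ∀ z ∈ K ⊓ N, Commute z a) : Commute g a := by
  obtain ⟨e, he1, he0⟩ := Nat.chineseRemainder hc 1 0
  have hge : g ^ e = g := by
    simpa using (pow_eq_pow_iff_modEq (x := g)).2 he1
  have hxe : x ^ e = 1 := by
    simpa using (pow_eq_pow_iff_modEq (x := x)).2 he0
  have hcomm : Commute (g : A ⧸ K ⊓ N) (x : A ⧸ K ⊓ N) := by
    change (g : A ⧸ K ⊓ N) * x = x * g
    rw [← QuotientGroup.mk_mul, ← QuotientGroup.mk_mul, QuotientGroup.eq]
    constructor
    · have h1 := K.mul_mem (hK.conj_mem _ (K.inv_mem hg) x⁻¹) hg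
      have h2 : (g * x)⁻¹ * (x * g) = x⁻¹ * g⁻¹ * x⁻¹⁻¹ * g := by group
      rw [h2]
      exact h1
    · have h1 := N.mul_mem (N.inv_mem hx) (hN.conj_mem _ hx g⁻¹)
      have h2 : (g * x)⁻¹ * (x * g) = x⁻¹ * (g⁻¹ * x * g⁻¹⁻¹) := by group
      rw [h2]
      exact h1
  have hz : ((g * x) ^ e)⁻¹ * g ∈ K ⊓ N := by
    rw [← QuotientGroup.eq, QuotientGroup.mk_pow, QuotientGroup.mk_mul, hcomm.mul_pow,
      ← QuotientGroup.mk_pow, ← QuotientGroup.mk_pow, hge, hxe]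
    simp
  have h3 := (hgx.pow_left e).mul_left (hZ _ hz)
  rwa [mul_inv_cancel_left] at h3

/-- For each prime `q ≠ p` the subgroup contains a Sylow `q`-subgroup, so no prime divides its
index. -/
theorem Subgroup.eq_top_of_coprime {K : Type*} [Group K] [Finite K] {p : ℕ} (hp : p.Prime)
    {H : Subgroup K} (h : ∀ g : K, (orderOf g).Coprime p → g ∈ H) (hi : ¬ p ∣ H.index) :
    H = ⊤ := by
  by_contra hne
  rw [← Subgroup.index_eq_one] at hne
  obtain ⟨q, hq, hqi⟩ := Nat.exists_prime_and_dvd hne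
  have hqp : q ≠ p := by
    rintro rfl
    exact hi hqi
  have : Fact q.Prime := ⟨hq⟩
  obtain ⟨Q⟩ : Nonempty (Sylow q K) := inferInstance
  have hQH : (Q : Subgroup K) ≤ H := by
    intro g hg
    obtain ⟨k, hk⟩ := IsPGroup.iff_orderOf.1 Q.2 ⟨g, hg⟩
    rw [Subgroup.orderOf_mk] at hk
    apply h
    rw [hk]
    exact Nat.Coprime.pow_left k ((Nat.coprime_primes hq hp).2 hqp)
  exact Q.not_dvd_index (hqi.trans (Subgroup.index_dvd_of_le hQH))

end GroupLemmas

/-! ### Weakly normal linking subsystems: factorization and normality -/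

section LinkingInclusion

variable {G : Type u} [Group G] {p : ℕ} {S T : Subgroup G} {F : FusionSystem S}
  {E : FusionSystem T}

namespace LinkingSystem

open FusionSystem

/-- The projection `Aut_L(P) → Aut_F(P)`. -/
def piAut (L : LinkingSystem.{u, v} p F) (P : L.Ob) :
    Aut P →* F.autGroup P.grp (L.obj_le _ P.mem) where
  toFun g := ⟨
    { toFun := L.π g.hom
      invFun := L.π g.inv
      left_inv := fun x => by
        rw [← L.π_comp_apply, g.hom_inv_id, L.π_id]
        rfl
      right_inv := fun x => by
        rw [← L.π_comp_apply, g.inv_hom_id, L.π_id]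
        rfl
      map_mul' := map_mul _ }, L.π_mem g.hom⟩
  map_one' := Subtype.ext (MulEquiv.ext fun x => by
    change L.π (𝟙 P) x = x
    rw [L.π_id]
    rfl)
  map_mul' g h := Subtype.ext (MulEquiv.ext fun x => L.π_comp_apply h.hom g.hom x)

theorem piAut_apply (L : LinkingSystem.{u, v} p F) (P : L.Ob) (g : Aut P) (x : P.grp) :
    (L.piAut P g : MulAut P.grp) x = L.π g.hom x := rfl

theorem mem_ker_piAut {L : LinkingSystem.{u, v} p F} {P : L.Ob} {g : Aut P} :
    g ∈ (L.piAut P).ker ↔ L.π g.hom = MonoidHom.id P.grp := by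
  rw [MonoidHom.mem_ker]
  constructor
  · intro h
    ext x
    rw [← L.piAut_apply, h]
    rfl
  · intro h
    refine Subtype.ext (MulEquiv.ext fun x => ?_)
    rw [L.piAut_apply, h]
    rfl

/-- Every morphism is an isomorphism onto its image followed by an inclusion. -/
theorem exists_image [Finite S] (L : LinkingSystem.{u, v} p F) {P Q : L.Ob} (ψ : P ⟶ Q) :
    ∃ (Q₀ : L.Ob) (h : Q₀.grp ≤ Q.grp) (e : P ≅ Q₀), e.hom ≫ L.incl h = ψ ∧
      Q₀.grp = imageOf (L.π ψ) P.grp := by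
  obtain ⟨R, hR, e, he, -, h3⟩ := F.factor (L.π_mem ψ)
  have h4 : ∀ x, (L.π ψ x : G) = e x := fun x =>
    congrArg (fun f : P.grp →* Q.grp => ((f x : Q.grp) : G)) h3
  let Q₀ : L.Ob := ⟨R, L.obj_conj _ P.mem _ ⟨e, he⟩⟩
  have hQ : Q₀.grp ≤ Q.grp := hR
  obtain ⟨χ, hχ⟩ := L.exists_factor ψ hQ (fun x => by rw [h4]; exact (e x).2)
  have := L.isIso_of_card_eq χ (Nat.card_congr e.toEquiv)
  refine ⟨Q₀, hQ, asIso χ, hχ, ?_⟩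
  ext y
  rw [mem_imageOf]
  constructor
  · intro hy
    obtain ⟨x, hx⟩ := e.surjective ⟨y, hy⟩
    exact ⟨x, x.2, by rw [h4, hx]⟩
  · rintro ⟨x, -, rfl⟩
    rw [h4]
    exact (e x).2

theorem imageOf_congr {P Q P' Q' : Subgroup G} {φ : P →* Q} {φ' : P' →* Q'} {R R' : Subgroup G}
    (h : ∀ (x : P), (x : G) ∈ R → ∃ x' : P', (x' : G) ∈ R' ∧ (φ' x' : G) = φ x)
    (h' : ∀ (x : P'), (x : G) ∈ R' → ∃ x' : P, (x' : G) ∈ R ∧ (φ x' : G) = φ' x) :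
    imageOf φ R = imageOf φ' R' := by
  ext y
  rw [mem_imageOf, mem_imageOf]
  constructor
  · rintro ⟨x, hx, rfl⟩
    exact h x hx
  · rintro ⟨x, hx, rfl⟩
    exact h' x hx

theorem exists_restriction [Finite S] (L : LinkingSystem.{u, v} p F) {P Q P₀ : L.Ob} (ψ : P ⟶ Q)
    (hP : P₀.grp ≤ P.grp) :
    ∃ (Q₀ : L.Ob) (h : Q₀.grp ≤ Q.grp) (e : P₀ ≅ Q₀), e.hom ≫ L.incl h = L.incl hP ≫ ψ ∧
      Q₀.grp = imageOf (L.π ψ) P₀.grp := by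
  obtain ⟨Q₀, h, e, he, hQ⟩ := L.exists_image (L.incl hP ≫ ψ)
  refine ⟨Q₀, h, e, he, hQ.trans (imageOf_congr (fun x _ => ?_) (fun x hx => ?_))⟩
  · exact ⟨L.π (L.incl hP) x, by rw [L.π_incl]; exact x.2, by rw [L.π_comp_apply]⟩
  · refine ⟨⟨x, hx⟩, hx, ?_⟩
    rw [L.π_comp_apply]
    congr 2
    exact Subtype.ext (L.π_incl hP ⟨x, hx⟩)

namespace Inclusion

variable {L₀ : LinkingSystem.{u, w} p E} {L : LinkingSystem.{u, v} p F}

/-- The inclusion functor. -/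
def functor (J : L₀.Inclusion L) : L₀.Ob ⥤ L.Ob where
  obj := J.obj
  map := J.map
  map_id := J.map_id
  map_comp := J.map_comp

variable (J : L₀.Inclusion L)

instance : J.functor.Faithful := ⟨fun h => J.map_injective _ _ h⟩

theorem π_functor_map {P Q : L₀.Ob} (ψ : P ⟶ Q) : L.π (J.functor.map ψ) = L₀.π ψ := J.π_map ψ

theorem functor_map_incl {P Q : L₀.Ob} (h : P.grp ≤ Q.grp) :
    J.functor.map (L₀.incl h) = L.incl (P := J.functor.obj P) (Q := J.functor.obj Q) h :=
  J.map_δ P Q _ _ rfl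

theorem functor_map_δ {P Q : L₀.Ob} {g : G} (hg : g ∈ transporter T P.grp Q.grp)
    (hg' : g ∈ transporter S (J.functor.obj P).grp (J.functor.obj Q).grp) :
    J.functor.map (L₀.δ P Q ⟨g, hg⟩) = L.δ (J.functor.obj P) (J.functor.obj Q) ⟨g, hg'⟩ :=
  J.map_δ P Q _ _ rfl

variable {J}

theorem WeaklyNormal.mem_of_le (hJ : J.WeaklyNormal) {P : Subgroup G} (hP : P ∈ L.Obj)
    (hPT : P ≤ T) : P ∈ L₀.Obj := by
  have := (hJ.obj_iff P (L.obj_le _ hP)).1 hP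
  rwa [inf_eq_left.2 hPT] at this

theorem WeaklyNormal.exists_conj (hJ : J.WeaklyNormal) {hT : T ∈ L₀.Obj}
    (γ : J.functor.obj ⟨T, hT⟩ ≅ J.functor.obj ⟨T, hT⟩) {P Q P' Q' : L₀.Ob}
    (r : J.functor.obj P ≅ J.functor.obj P') (s : J.functor.obj Q ≅ J.functor.obj Q')
    (hr : r.hom ≫ J.functor.map (L₀.incl (Q := ⟨T, hT⟩) (L₀.obj_le _ P'.mem)) =
      J.functor.map (L₀.incl (L₀.obj_le _ P.mem)) ≫ γ.hom)
    (hs : s.hom ≫ J.functor.map (L₀.incl (Q := ⟨T, hT⟩) (L₀.obj_le _ Q'.mem)) =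
      J.functor.map (L₀.incl (L₀.obj_le _ Q.mem)) ≫ γ.hom)
    (ψ : P ⟶ Q) : ∃ ψ' : P' ⟶ Q', J.functor.map ψ' = r.inv ≫ J.functor.map ψ ≫ s.hom := by
  rw [functor_map_incl, functor_map_incl] at hr hs
  exact hJ.conj_mem (J.obj_subset hT) γ P Q P' Q' r s hr hs ψ

/-- Conjugation back: if `r` is the restriction of `γ`, then `χ ∘ r = γ ∘ χ'` with `χ'` in
`L₀`. -/
theorem WeaklyNormal.exists_conj_inv (hJ : J.WeaklyNormal) {hT : T ∈ L₀.Obj}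
    (γ : J.functor.obj ⟨T, hT⟩ ≅ J.functor.obj ⟨T, hT⟩) {P P' : L₀.Ob}
    (r : J.functor.obj P ≅ J.functor.obj P')
    (hr : r.hom ≫ J.functor.map (L₀.incl (Q := ⟨T, hT⟩) (L₀.obj_le _ P'.mem)) =
      J.functor.map (L₀.incl (L₀.obj_le _ P.mem)) ≫ γ.hom)
    (χ : P' ⟶ ⟨T, hT⟩) :
    ∃ χ' : P ⟶ ⟨T, hT⟩, r.hom ≫ J.functor.map χ = J.functor.map χ' ≫ γ.hom := by
  obtain ⟨χ', hχ'⟩ := hJ.exists_conj γ.symm r.symm γ.symm (Q := ⟨T, hT⟩) (Q' := ⟨T, hT⟩)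
    (by rw [Iso.symm_hom, Iso.symm_hom, Iso.inv_comp_eq, ← Category.assoc, hr]; simp)
    (by simp [incl_refl]) χ
  refine ⟨χ', ?_⟩
  rw [hχ']
  simp

theorem le_of_conj_of_stronglyClosed (hT : F.StronglyClosed T) {P Q : Subgroup G}
    (h : F.Conj P Q) (hP : P ≤ T) : Q ≤ T := by
  intro y hy
  obtain ⟨e, he⟩ := h
  obtain ⟨x, hx⟩ := e.surjective ⟨y, hy⟩
  have := hT.2 P Q _ he x (hP x.2)
  rwa [show (e.toMonoidHom x : G) = y from congrArg (fun z : Q => (z : G)) hx] at this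

variable [Finite S]

theorem eq_of_conj_of_stronglyClosed (hT : F.StronglyClosed T) {Q : Subgroup G}
    (h : F.Conj T Q) : Q = T := by
  have := finite_of_le hT.1
  have hQ : Q ≤ T := by
    intro y hy
    obtain ⟨e, he⟩ := h
    obtain ⟨x, hx⟩ := e.surjective ⟨y, hy⟩
    have := hT.2 T Q _ he x x.2
    rwa [show (e.toMonoidHom x : G) = y from congrArg (fun z : Q => (z : G)) hx] at this
  exact eq_of_le_of_card_eq hQ h.card_eq.symm

/-- `T` is alone in its `F`-conjugacy class. -/
theorem fullyCentralized_of_stronglyClosed (hT : F.StronglyClosed T) :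
    F.FullyCentralized T :=
  ⟨hT.1, fun Q hQ => by rw [eq_of_conj_of_stronglyClosed hT hQ]⟩

theorem conj_of_iso {P Q : L.Ob} (e : P ≅ Q) : F.Conj P.grp Q.grp := by
  obtain ⟨f, hf⟩ := conj_of_mem_of_card_eq (L.π_mem e.hom) (L.card_eq_of_iso e)
  exact ⟨f, hf ▸ L.π_mem e.hom⟩

/-- The Frattini condition, lifted to `L`. Lifting `α` and `φ₀` recovers `ψ` only up to `δ_P(c)`
with `c ∈ C_S(P)`, but this is the restriction of `δ_T(c)`, and weak normality moves it past `ψ₀`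
into the factor `γ`. -/
theorem WeaklyNormal.exists_factorization_of_fullyCentralized (hJ : J.WeaklyNormal)
    (hEF : F.WeaklyNormal p E) {hT : T ∈ L₀.Obj} {P : L₀.Ob} (hP : F.FullyCentralized P.grp)
    (ψ : J.functor.obj P ⟶ J.functor.obj ⟨T, hT⟩) :
    ∃ (ψ₀ : P ⟶ ⟨T, hT⟩) (γ : J.functor.obj ⟨T, hT⟩ ≅ J.functor.obj ⟨T, hT⟩),
      ψ = J.functor.map ψ₀ ≫ γ.hom := by
  have hPT := L₀.obj_le _ P.mem
  obtain ⟨α, hα, φ₀, hφ₀, h⟩ := hEF.frattini P.grp hPT (L.π ψ) (L.π_mem ψ)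
  obtain ⟨γ, hγ⟩ := L.exists_lift (P := J.functor.obj ⟨T, hT⟩) (Q := J.functor.obj ⟨T, hT⟩) hα
  have := L.isIso_of_card_eq γ rfl
  obtain ⟨ψ₀, hψ₀⟩ := L₀.exists_lift (P := P) (Q := ⟨T, hT⟩) hφ₀
  have h1 : L.π (J.functor.map ψ₀ ≫ γ) = L.π ψ := by
    rw [L.π_comp, h, hγ, π_functor_map, hψ₀]
    rfl
  obtain ⟨⟨c, hc⟩, hcC, h2⟩ := (L.π_eq_iff _ _ hP _ _).1 h1
  have hcn : c ∈ S ⊓ Subgroup.normalizer ((J.functor.obj P).grp : Set G) :=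
    centralizerIn_le_normalizer _ _ hcC
  -- Strong closure makes `T` invariant under conjugation by `S`, so `δ_T(c)` makes sense.
  have hcT : c ∈ S ⊓ Subgroup.normalizer ((J.functor.obj ⟨T, hT⟩).grp : Set G) := by
    refine ⟨hcn.1, ?_⟩
    have hconj : ∀ g ∈ S, ∀ x ∈ T, g * x * g⁻¹ ∈ T := by
      intro g hg x hx
      have hTS := hEF.stronglyClosed.1
      let φ : T →* S := ((MulAut.conj g).toMonoidHom.comp T.subtype).codRestrict S fun y =>
        S.mul_mem (S.mul_mem hg (hTS y.2)) (S.inv_mem hg)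
      have hφ : φ ∈ F.Hom T S := F.conj_mem hTS le_rfl g
        ⟨hg, fun y hy => S.mul_mem (S.mul_mem hg (hTS hy)) (S.inv_mem hg)⟩ _ fun y => rfl
      exact hEF.stronglyClosed.2 T S φ hφ ⟨x, hx⟩ hx
    refine Subgroup.mem_normalizer_iff.2 fun x => ⟨hconj c hcn.1 x, fun hx => ?_⟩
    have h3 := hconj c⁻¹ (S.inv_mem hcn.1) _ hx
    rwa [show c⁻¹ * (c * x * c⁻¹) * c⁻¹⁻¹ = x by group] at h3
  let r : J.functor.obj P ≅ J.functor.obj P := L.deltaAut (J.functor.obj P) ⟨c, hcn⟩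
  let s : J.functor.obj ⟨T, hT⟩ ≅ J.functor.obj ⟨T, hT⟩ :=
    L.deltaAut (J.functor.obj ⟨T, hT⟩) ⟨c, hcT⟩
  obtain ⟨χ, hχ⟩ := hJ.exists_conj_inv s (P := P) (P' := P) r (by
    rw [functor_map_incl]
    exact L.δ_comp_incl _ _ _ _) ψ₀
  refine ⟨χ, s.trans (asIso γ), ?_⟩
  rw [h2]
  change r.hom ≫ _ = _
  rw [← Category.assoc, hχ]
  simp

/-- The fully centralized case is applied at an isomorphic object to two morphisms: one corresponds
to `ψ`, the other to the inclusion of `P` in `T`. The second exhibits an isomorphism out of `P` as a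
restriction of an element of `Aut_L(T)`, which brings the first factorization back to `P`. -/
theorem WeaklyNormal.exists_factorization (hJ : J.WeaklyNormal)
    (hEF : F.WeaklyNormal p E) {hT : T ∈ L₀.Obj} {P : L₀.Ob}
    (ψ : J.functor.obj P ⟶ J.functor.obj ⟨T, hT⟩) :
    ∃ (ψ₀ : P ⟶ ⟨T, hT⟩) (γ : J.functor.obj ⟨T, hT⟩ ≅ J.functor.obj ⟨T, hT⟩),
      ψ = J.functor.map ψ₀ ≫ γ.hom := by
  have := finite_of_le hEF.stronglyClosed.1
  have hPT := L₀.obj_le _ P.mem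
  obtain ⟨Q, hQ, ⟨e⟩⟩ := L.iso_fullyCentralized (J.functor.obj P)
  have hQT : Q.grp ≤ T := le_of_conj_of_stronglyClosed hEF.stronglyClosed (conj_of_iso e) hPT
  obtain ⟨P', rfl⟩ : ∃ P' : L₀.Ob, J.functor.obj P' = Q :=
    ⟨⟨Q.grp, hJ.mem_of_le Q.mem hQT⟩, rfl⟩
  obtain ⟨ω, γ₁, h₁⟩ := hJ.exists_factorization_of_fullyCentralized hEF hQ
    (e.inv ≫ J.functor.map (L₀.incl (Q := ⟨T, hT⟩) hPT))
  obtain ⟨χ, γ₂, h₂⟩ := hJ.exists_factorization_of_fullyCentralized hEF hQ (e.inv ≫ ψ)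
  obtain ⟨P₁, hP₁, ε, rfl, -⟩ := L₀.exists_image ω
  let r : J.functor.obj P ≅ J.functor.obj P₁ := e.trans (J.functor.mapIso ε)
  have hr : r.hom ≫ J.functor.map (L₀.incl hP₁) =
      J.functor.map (L₀.incl (Q := ⟨T, hT⟩) hPT) ≫ γ₁.symm.hom := by
    rw [Iso.symm_hom, Iso.eq_comp_inv]
    rw [Iso.inv_comp_eq] at h₁
    simp [r, h₁]
  obtain ⟨χ', hχ'⟩ := hJ.exists_conj_inv γ₁.symm r hr (ε.inv ≫ χ)
  refine ⟨χ', γ₁.symm.trans γ₂, ?_⟩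
  rw [Iso.inv_comp_eq] at h₂
  rw [h₂, Iso.trans_hom, ← Category.assoc (J.functor.map χ'), ← hχ']
  simp [r]

/-- By factorization, `θ` is an isomorphism of `L₀` followed by a restriction of some `γ ∈
Aut_L(T)`, and conjugation by either preserves `L₀`. -/
theorem WeaklyNormal.exists_conj_self (hJ : J.WeaklyNormal) (hEF : F.WeaklyNormal p E)
    {P : L₀.Ob} (θ : J.functor.obj P ≅ J.functor.obj P) (g : P ⟶ P) :
    ∃ g' : P ⟶ P, J.functor.map g' = θ.inv ≫ J.functor.map g ≫ θ.hom := by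
  have := finite_of_le hEF.stronglyClosed.1
  have hT := L₀.top_mem P
  have hPT := L₀.obj_le _ P.mem
  obtain ⟨ω, γ, h⟩ := hJ.exists_factorization hEF (hT := hT)
    (θ.hom ≫ J.functor.map (L₀.incl hPT))
  obtain ⟨P₁, hP₁, ε, rfl, -⟩ := L₀.exists_image ω
  let r : J.functor.obj P₁ ≅ J.functor.obj P := (J.functor.mapIso ε).symm.trans θ
  have hr : r.hom ≫ J.functor.map (L₀.incl hPT) = J.functor.map (L₀.incl hP₁) ≫ γ.hom := by
    simp [r, h]
  obtain ⟨g', hg'⟩ := hJ.exists_conj γ r r hr hr (ε.inv ≫ g ≫ ε.hom)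
  refine ⟨g', ?_⟩
  rw [hg']
  simp [r]

/-- `Aut_{L₀}(P)` is normal in `Aut_L(P)`. -/
theorem WeaklyNormal.normal_range_mapAut (hJ : J.WeaklyNormal)
    (hEF : F.WeaklyNormal p E) (P : L₀.Ob) : (J.functor.mapAut P).range.Normal := by
  have := finite_of_le hEF.stronglyClosed.1
  constructor
  rintro _ ⟨g, rfl⟩ θ
  obtain ⟨g', hg'⟩ := hJ.exists_conj_self hEF θ g.hom
  have hgi : IsIso g' := L₀.isIso_of_card_eq g' rfl
  refine ⟨asIso g', Iso.ext ?_⟩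
  exact hg'

end Inclusion

end LinkingSystem

end LinkingInclusion

/-! ### Elements of `C_S(E)` commute with `L₀` -/

section Centralizing

variable {G : Type u} [Group G] {p : ℕ} {S T : Subgroup G} {F : FusionSystem S}
  {E : FusionSystem T}

namespace LinkingSystem

open FusionSystem

/-- Transported to a fully centralized `P'`, a kernel element becomes `δ(c)` for some `c` in the
`p`-group `S`. -/
theorem isPGroup_ker_piAut (hS : IsPGroup p S) (L : LinkingSystem.{u, v} p F) (P : L.Ob) :
    IsPGroup p (L.piAut P).ker := by
  rintro ⟨x, hx⟩
  obtain ⟨P', hP', ⟨i⟩⟩ := L.iso_fullyCentralized P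
  have hx' : L.π (𝟙 P') = L.π (i.conjAut x).hom := by
    rw [Iso.conjAut_hom, Iso.conj_apply, L.π_comp, L.π_comp, mem_ker_piAut.1 hx,
      MonoidHom.comp_id, ← L.π_comp, i.inv_hom_id]
  obtain ⟨⟨c, hc⟩, hcC, h⟩ := (L.π_eq_iff P' P' hP' _ _).1 hx'
  rw [Category.comp_id] at h
  have h1 : i.conjAut x = L.deltaAut P' ⟨c, centralizerIn_le_normalizer _ _ hcC⟩ := Iso.ext h
  obtain ⟨k, hk⟩ := hS ⟨c, hc.1⟩
  refine ⟨k, Subtype.ext ?_⟩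
  apply i.conjAut.injective
  change i.conjAut (x ^ p ^ k) = i.conjAut 1
  rw [map_pow, h1, ← map_pow, map_one, ← map_one (L.deltaAut P')]
  congr 1
  exact Subtype.ext (congrArg (fun z : S => (z : G)) hk)

theorem piAut_surjective [Finite S] (L : LinkingSystem.{u, v} p F) (P : L.Ob) :
    Function.Surjective (L.piAut P) := by
  rintro ⟨e, he⟩
  obtain ⟨ψ, hψ⟩ := L.exists_lift (P := P) (Q := P) he
  have := L.isIso_of_card_eq ψ rfl
  refine ⟨asIso ψ, Subtype.ext (MulEquiv.ext fun x => ?_)⟩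
  exact DFunLike.congr_fun hψ x

theorem finite_aut (L : LinkingSystem.{u, v} p F) (P : L.Ob) : Finite (Aut P) := by
  have := L.finite_hom P P
  exact Finite.of_injective (fun g : Aut P => g.hom) fun _ _ h => Iso.ext h

namespace Inclusion

variable {L₀ : LinkingSystem.{u, w} p E} {L : LinkingSystem.{u, v} p F} (J : L₀.Inclusion L)

theorem mem_normalizer_of_mem_centralizer {a : G} (ha : a ∈ centralizerIn S T) (P : L₀.Ob) :
    a ∈ S ⊓ Subgroup.normalizer ((J.functor.obj P).grp : Set G) := by
  refine centralizerIn_le_normalizer _ _ (mem_centralizerIn.2 ⟨ha.1, fun x hx => ?_⟩)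
  exact (mem_centralizerIn.1 ha).2 x (L₀.obj_le _ P.mem hx)

/-- `δ_P(a) ∈ Aut_L(P)` for `a ∈ C_S(T)` and `P ∈ Ob(L₀)`. -/
def central {a : G} (ha : a ∈ centralizerIn S T) (P : L₀.Ob) :
    J.functor.obj P ≅ J.functor.obj P :=
  L.deltaAut (J.functor.obj P) ⟨a, J.mem_normalizer_of_mem_centralizer ha P⟩

/-- `δ(a)` commutes with the morphism `ψ` of `L₀`. -/
def Commutes {a : G} (ha : a ∈ centralizerIn S T) {P Q : L₀.Ob} (ψ : P ⟶ Q) : Prop :=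
  (J.central ha P).hom ≫ J.functor.map ψ = J.functor.map ψ ≫ (J.central ha Q).hom

variable {J} {a : G} {ha : a ∈ centralizerIn S T}

theorem Commutes.comp {P Q R : L₀.Ob} {ψ : P ⟶ Q} {χ : Q ⟶ R} (hψ : J.Commutes ha ψ)
    (hχ : J.Commutes ha χ) : J.Commutes ha (ψ ≫ χ) := by
  unfold Commutes at *
  rw [Functor.map_comp, Category.assoc, ← hχ, ← Category.assoc, hψ, Category.assoc]

theorem Commutes.inv {P Q : L₀.Ob} {e : P ≅ Q} (h : J.Commutes ha e.hom) :
    J.Commutes ha e.inv := by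
  unfold Commutes at *
  rw [← cancel_epi (J.functor.map e.hom), ← Category.assoc, ← h, Category.assoc,
    ← Functor.map_comp, e.hom_inv_id, ← Category.assoc, ← Functor.map_comp, e.hom_inv_id]
  simp

theorem commutes_incl {P Q : L₀.Ob} (h : P.grp ≤ Q.grp) : J.Commutes ha (L₀.incl h) := by
  unfold Commutes
  rw [functor_map_incl]
  exact L.δ_comp_incl _ _ _ _

theorem Commutes.of_comp_incl {P Q R : L₀.Ob} {ψ : P ⟶ Q} {h : Q.grp ≤ R.grp}
    (hψ : J.Commutes ha (ψ ≫ L₀.incl h)) : J.Commutes ha ψ := by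
  have h1 := J.commutes_incl (ha := ha) h
  unfold Commutes at *
  rw [← cancel_mono (J.functor.map (L₀.incl h)), Category.assoc, ← Functor.map_comp, hψ,
    Functor.map_comp, Category.assoc, Category.assoc, h1]

theorem commutes_δ {P Q : L₀.Ob} (g : transporter T P.grp Q.grp) (hTS : T ≤ S) :
    J.Commutes ha (L₀.δ P Q g) := by
  obtain ⟨g, hg⟩ := g
  unfold Commutes
  rw [J.functor_map_δ hg ⟨hTS hg.1, hg.2⟩]
  refine L.δ_comp_congr _ _ _ _ ?_
  have := (mem_centralizerIn.1 ha).2 g hg.1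
  exact (mul_inv_eq_iff_eq_mul.1 this).symm

theorem mem_centralizerIn_of_mem_subsystemCentralizer (h : a ∈ F.subsystemCentralizer E) :
    a ∈ centralizerIn S T := by
  refine mem_centralizerIn.2 ⟨h.1, fun x hx => ?_⟩
  have h1 := (mem_centralizerIn.1 (h.2.1 hx)).2 a (Subgroup.mem_zpowers a)
  rw [mul_inv_eq_iff_eq_mul] at h1
  rw [mul_inv_eq_iff_eq_mul]
  exact h1.symm

/-- For `a ∈ C_S(E)`, each morphism of `E` lifts to a morphism of `L` commuting with `δ(a)`. -/
theorem exists_commuting_lift (h : a ∈ F.subsystemCentralizer E)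
    {P Q : L₀.Ob} {φ : P.grp →* Q.grp} (hφ : φ ∈ E.Hom P.grp Q.grp) :
    ∃ y : J.functor.obj P ⟶ J.functor.obj Q, L.π y = φ ∧
      (J.central ha P).hom ≫ y = y ≫ (J.central ha Q).hom := by
  obtain ⟨-, -, -, ψ, hψ, hext, hid⟩ := h.2.2 _ _ hφ
  have hle := F.le_of_mem hψ
  -- Now `a` belongs to the source `P⟨a⟩`, so (C) applies to it: a lift of the extension fixing `a`
  -- commutes with `δ(a)`, and so does its restriction to `P`.
  let P' : L.Ob := ⟨P.grp ⊔ Subgroup.zpowers a,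
    L.obj_overgroup _ (J.functor.obj P).mem _ le_sup_left hle.1⟩
  let Q' : L.Ob := ⟨Q.grp ⊔ Subgroup.zpowers a,
    L.obj_overgroup _ (J.functor.obj Q).mem _ le_sup_left hle.2⟩
  have hP : (J.functor.obj P).grp ≤ P'.grp := le_sup_left
  have hQ : (J.functor.obj Q).grp ≤ Q'.grp := le_sup_left
  have haP : a ∈ P'.grp := (le_sup_right : _ ≤ P.grp ⊔ Subgroup.zpowers a) (Subgroup.mem_zpowers a)
  have haQ : a ∈ Q'.grp := (le_sup_right : _ ≤ Q.grp ⊔ Subgroup.zpowers a) (Subgroup.mem_zpowers a)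
  obtain ⟨χ, hχ⟩ := L.exists_lift (P := P') (Q := Q') hψ
  have hval : ∀ x : (J.functor.obj P).grp, (L.π (L.incl hP ≫ χ) x : G) = φ x := fun x => by
    rw [L.π_comp_apply, hχ]
    exact hext x _ (L.π_incl hP x)
  obtain ⟨y, hy⟩ := L.exists_factor (L.incl hP ≫ χ) hQ (fun x => by
    rw [hval]
    exact (φ x).2)
  refine ⟨y, ?_, ?_⟩
  · ext x
    have h1 := hval x
    rw [← hy, L.π_comp_apply, L.π_incl] at h1
    exact h1
  · have haP' : a ∈ transporter S P'.grp P'.grp := self_mem_transporter hle.1 haP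
    have haQ' : a ∈ transporter S Q'.grp Q'.grp := self_mem_transporter hle.2 haQ
    have h1 : L.δ P' P' ⟨a, haP'⟩ ≫ χ = χ ≫ L.δ Q' Q' ⟨a, haQ'⟩ :=
      L.δ_comm χ ⟨a, haP⟩ _ _ rfl (by
        rw [hχ]
        exact (hid ⟨a, haP⟩ (Subgroup.mem_zpowers a)).symm)
    have h2 : (J.central ha P).hom ≫ L.incl hP = L.incl hP ≫ L.δ P' P' ⟨a, haP'⟩ :=
      L.δ_comp_incl _ _ _ _
    have h3 : (J.central ha Q).hom ≫ L.incl hQ = L.incl hQ ≫ L.δ Q' Q' ⟨a, haQ'⟩ :=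
      L.δ_comp_incl _ _ _ _
    rw [← cancel_mono (L.incl hQ), Category.assoc, hy, ← Category.assoc, h2, Category.assoc, h1,
      Category.assoc, h3, ← Category.assoc y, hy, Category.assoc]

/-- Such a morphism is `δ_P(t)` with `t ∈ T`, and `a` centralizes `T`. -/
theorem commutes_of_mem_ker (hTS : T ≤ S) {P : L₀.Ob} (hP : E.FullyCentralized P.grp)
    {z : P ⟶ P} (hz : L₀.π z = MonoidHom.id P.grp) : J.Commutes ha z := by
  obtain ⟨t, -, h⟩ := (L₀.π_eq_iff P P hP (𝟙 P) z).1 (by rw [hz, L₀.π_id])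
  rw [h, Category.comp_id]
  exact commutes_δ t hTS

variable [Finite S]

/-- Write a commuting lift of `π(g)` as `g` times an element of the normal `p`-group `ker π`, and
apply `Commute.of_coprime_mul` with `Aut_{L₀}(P)` as the other normal subgroup. The intersection
consists of kernel elements of `L₀`, which commute with `δ(a)`. -/
theorem WeaklyNormal.commutes_of_coprime (hJ : J.WeaklyNormal) (hEF : F.WeaklyNormal p E)
    [Fact p.Prime] (hS : IsPGroup p S) (h : a ∈ F.subsystemCentralizer E) {P : L₀.Ob}
    (hP : E.FullyCentralized P.grp) (g : Aut P) (hg : (orderOf g).Coprime p) :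
    J.Commutes ha g.hom := by
  obtain ⟨y, hy, hya⟩ := J.exists_commuting_lift (ha := ha) h (L₀.π_mem g.hom)
  have hyi := L.isIso_of_card_eq y rfl
  let y' : Aut (J.functor.obj P) := asIso y
  let g' : Aut (J.functor.obj P) := J.functor.mapAut P g
  let a' : Aut (J.functor.obj P) := J.central ha P
  have hx : g'⁻¹ * y' ∈ (L.piAut (J.functor.obj P)).ker := by
    rw [mem_ker_piAut]
    change L.π (y ≫ J.functor.map g.inv) = _
    rw [L.π_comp, hy.trans (J.π_functor_map g.hom).symm, ← L.π_comp, ← Functor.map_comp,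
      show g.hom ≫ g.inv = 𝟙 P from Iso.hom_inv_id g, J.functor.map_id, L.π_id]
  have hcomm : Commute g' a' := by
    refine Commute.of_coprime_mul (hJ.normal_range_mapAut hEF P)
      (L.piAut (J.functor.obj P)).normal_ker (x := g'⁻¹ * y') ⟨g, rfl⟩ hx ?_ ?_ ?_
    · obtain ⟨k, hk⟩ := L.isPGroup_ker_piAut hS _ ⟨_, hx⟩
      have hk' : (g'⁻¹ * y') ^ p ^ k = 1 :=
        congrArg (fun z : (L.piAut (J.functor.obj P)).ker => (z : Aut (J.functor.obj P))) hk
      exact ((hg.pow_right k).coprime_dvd_left (orderOf_map_dvd _ g)).coprime_dvd_right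
        (orderOf_dvd_of_pow_eq_one hk')
    · rw [mul_inv_cancel_left]
      exact Iso.ext hya
    · rintro _ ⟨⟨z, rfl⟩, hz⟩
      have hz' : L₀.π z.hom = MonoidHom.id P.grp := by
        have := mem_ker_piAut.1 hz
        rw [← J.π_functor_map]
        exact this
      exact Iso.ext (J.commutes_of_mem_ker (ha := ha) hEF.stronglyClosed.1 hP hz')
  exact congrArg (fun z : Aut (J.functor.obj P) => z.hom) hcomm.eq

/-- The automorphisms commuting with `δ(a)` form a subgroup `H` containing all elements of order
prime to `p`, the kernel of `π`, and `δ_P(N_T(P))`. The last covers the Sylow subgroup `Aut_T(P)` of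
`Aut_E(P)`, so the index of `H` is prime to `p`. -/
theorem WeaklyNormal.commutes_aut (hJ : J.WeaklyNormal) (hEF : F.WeaklyNormal p E)
    [Fact p.Prime] (hS : IsPGroup p S) (h : a ∈ F.subsystemCentralizer E) {P : L₀.Ob}
    (hA : E.FullyAutomized p P.grp) (hR : E.Receptive P.grp) (g : Aut P) :
    J.Commutes ha g.hom := by
  have hTS := hEF.stronglyClosed.1
  have := finite_of_le hTS
  have := L₀.finite_aut P
  have hPT := L₀.obj_le _ P.mem
  have := finite_of_le hPT
  have hP : E.FullyCentralized P.grp := hR.fullyCentralized hPT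
  let a' : Aut (J.functor.obj P) := J.central ha P
  let H : Subgroup (Aut P) := (Subgroup.centralizer {a'}).comap (J.functor.mapAut P)
  have hH : ∀ g : Aut P, g ∈ H ↔ J.Commutes ha g.hom := by
    intro g
    rw [Subgroup.mem_comap, Subgroup.mem_centralizer_singleton_iff]
    exact ⟨fun h => congrArg (fun z : Aut (J.functor.obj P) => z.hom) h, fun h => Iso.ext h⟩
  suffices H = ⊤ from (hH g).1 (this ▸ Subgroup.mem_top g)
  refine Subgroup.eq_top_of_coprime (Fact.out : p.Prime)
    (fun g hg => (hH g).2 (hJ.commutes_of_coprime hEF hS h hP g hg)) fun hdvd => ?_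
  obtain ⟨hPT', A, hA⟩ := hA
  refine A.not_dvd_index (hdvd.trans ?_)
  -- Since `H` contains the kernel, its index can be computed in `Aut_E(P)`.
  rw [← H.index_map_eq (L₀.piAut_surjective P)
    fun z hz => (hH z).2 (commutes_of_mem_ker hTS hP (mem_ker_piAut.1 hz)), hA]
  refine Subgroup.index_dvd_of_le ?_
  rintro ⟨e, he⟩ ⟨t, ht, het⟩
  have htn : t ∈ T ⊓ Subgroup.normalizer (P.grp : Set G) := by
    refine ⟨ht, Subgroup.mem_normalizer_iff.2 fun x => ⟨fun hx => ?_, fun hx => ?_⟩⟩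
    · have := het ⟨x, hx⟩
      rw [← show (e ⟨x, hx⟩ : G) = t * x * t⁻¹ from this]
      exact (e _).2
    · obtain ⟨y, hy⟩ := (show Function.Surjective e from e.surjective) ⟨_, hx⟩
      have h1 : (e y : G) = t * y * t⁻¹ := het y
      rw [hy] at h1
      have h2 : x = y := by simpa using h1
      rw [h2]
      exact y.2
  refine ⟨L₀.deltaAut P ⟨t, htn⟩, (hH _).2 (commutes_δ _ hTS),
    Subtype.ext (MulEquiv.ext fun x => ?_)⟩
  exact Subtype.ext ((L₀.π_δ P P _ x).trans (het x).symm)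

/-- For `a ∈ C_S(E)`, `δ(a)` commutes with all morphisms of `L₀`. -/
theorem WeaklyNormal.commutes (hJ : J.WeaklyNormal) (hEF : F.WeaklyNormal p E)
    [Fact p.Prime] (hS : IsPGroup p S) (h : a ∈ F.subsystemCentralizer E) {P Q : L₀.Ob}
    (ψ : P ⟶ Q) : J.Commutes ha ψ := by
  have hTS := hEF.stronglyClosed.1
  have hfT := finite_of_le hTS
  have hTp := isPGroup_of_le hS hTS
  induction hn : Nat.card T - Nat.card P.grp using Nat.strong_induction_on generalizing P Q with
  | _ n ih =>
  obtain ⟨Q₀, hQ₀, e, rfl, -⟩ := L₀.exists_image ψ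
  refine Commutes.comp ?_ (commutes_incl hQ₀)
  have hPT := L₀.obj_le _ P.mem
  obtain ⟨R, hA, hR, hPR⟩ := exists_receptive_iso hEF.saturated_sub P
  -- As in Alperin's theorem, an isomorphism onto the receptive `R` extends to the strictly larger
  -- `N_T(P')`, where induction applies. Using one at each end of `e` leaves an automorphism of `R`.
  have key : ∀ P' : L₀.Ob, E.Conj P'.grp P.grp → ∃ f : P' ≅ R, J.Commutes ha f.hom := by
    intro P' hc
    have hP'T := L₀.obj_le _ P'.mem
    obtain ⟨φ, hφ, ψ, hψ, hext⟩ := exists_extension_normalizer hTp (hc.trans hPR) hA hR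
    have hle : P'.grp ≤ T ⊓ Subgroup.normalizer (P'.grp : Set G) :=
      le_inf hP'T Subgroup.le_normalizer
    let N : L₀.Ob := ⟨_, L₀.obj_overgroup _ P'.mem _ hle inf_le_left⟩
    let T' : L₀.Ob := ⟨T, L₀.top_mem P⟩
    have hP'N : P'.grp ≤ N.grp := hle
    have hRT : R.grp ≤ T'.grp := L₀.obj_le _ R.mem
    -- Here the normalizer does not grow, but `R = T` as well and the identity serves.
    by_cases hPeq : P'.grp = T
    · have hRT' : P' = R := by
        ext1
        have h1 := hc.trans hPR
        rw [hPeq] at h1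
        rw [hPeq, h1.eq_of_self]
      subst hRT'
      exact ⟨Iso.refl _, by simp [Commutes]⟩
    · obtain ⟨χ, hχ⟩ := L₀.exists_lift (P := N) (Q := T') hψ
      have hfN : Finite N.grp := finite_of_le (S := T) inf_le_left
      have hlt : Nat.card P'.grp < Nat.card N.grp :=
        card_lt_of_lt (lt_normalizer hTp (lt_of_le_of_ne hP'T hPeq))
      have hleT : Nat.card N.grp ≤ Nat.card T :=
        Nat.card_le_card_of_injective _ (Subgroup.inclusion_injective (L₀.obj_le _ N.mem))
      have hceq := hc.card_eq
      have hCχ : J.Commutes ha χ := ih _ (by omega) χ rfl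
      obtain ⟨f, hf⟩ := L₀.exists_factor (L₀.incl hP'N ≫ χ) hRT (fun x => by
        rw [L₀.π_comp_apply, hχ, hext x _ (L₀.π_incl _ x)]
        exact (φ x).2)
      have := L₀.isIso_of_card_eq f (Nat.card_congr φ.toEquiv)
      refine ⟨asIso f, Commutes.of_comp_incl (h := hRT) ?_⟩
      rw [asIso_hom, hf]
      exact (commutes_incl hP'N).comp hCχ
  obtain ⟨f₁, h₁⟩ := key P (Conj.refl hPT)
  obtain ⟨f₂, h₂⟩ := key Q₀ (conj_of_iso e).symm
  have h₃ := hJ.commutes_aut (ha := ha) hEF hS h hA hR ((f₁.symm.trans e).trans f₂)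
  have h₄ := (h₁.comp h₃).comp h₂.inv
  simpa using h₄

end Inclusion

end LinkingSystem

end Centralizing

/-! ### Commuting with `L₀` implies membership in `C_S(E)` -/

section CentralizerConverse

variable {G : Type u} [Group G] {p : ℕ} {S T : Subgroup G} {F : FusionSystem S}
  {E : FusionSystem T}

theorem Subgroup.map_mem_of_sup {A B : Subgroup G} {C : Type*} [Group C]
    (f : ↥(A ⊔ B) →* C) (D : Subgroup C) (hA : ∀ x : ↥(A ⊔ B), (x : G) ∈ A → f x ∈ D)
    (hB : ∀ x : ↥(A ⊔ B), (x : G) ∈ B → f x ∈ D) (x : ↥(A ⊔ B)) : f x ∈ D := by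
  have h : A ⊔ B ≤ (D.comap f).map (A ⊔ B).subtype := by
    refine sup_le (fun y hy => ?_) (fun y hy => ?_)
    · exact ⟨⟨y, (le_sup_left : A ≤ A ⊔ B) hy⟩, hA _ hy, rfl⟩
    · exact ⟨⟨y, (le_sup_right : B ≤ A ⊔ B) hy⟩, hB _ hy, rfl⟩
  obtain ⟨z, hz, hzx⟩ := h x.2
  rwa [← Subtype.ext hzx]

namespace FusionSystem

/-- `φ : P → Q` extends to a morphism `PX → QX` of `F` that is the identity on `X`. -/
def ExtendsOver (F : FusionSystem S) (X P Q : Subgroup G) (φ : P →* Q) : Prop :=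
  ∃ ψ ∈ F.Hom (P ⊔ X) (Q ⊔ X),
    (∀ (x : P) (y : ↥(P ⊔ X)), (y : G) = x → (ψ y : G) = φ x) ∧
    ∀ y : ↥(P ⊔ X), (y : G) ∈ X → (ψ y : G) = y

theorem ExtendsOver.comp {X P Q R : Subgroup G} {φ : P →* Q} {χ : Q →* R}
    (hφ : F.ExtendsOver X P Q φ) (hχ : F.ExtendsOver X Q R χ) :
    F.ExtendsOver X P R (χ.comp φ) := by
  obtain ⟨ψ, hψ, h1, h2⟩ := hφ
  obtain ⟨ψ', hψ', h1', h2'⟩ := hχ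
  refine ⟨ψ'.comp ψ, F.comp_mem hψ hψ', fun x y hy => h1' _ _ (h1 x y hy), fun y hy => ?_⟩
  have h3 := h2 y hy
  exact (h2' (ψ y) (by rwa [h3])).trans h3

/-- The range of the extension contains `Q` and `X`, so it is onto `QX` and can be inverted. -/
theorem ExtendsOver.symm {X P Q : Subgroup G} {e : P ≃* Q}
    (h : F.ExtendsOver X P Q e.toMonoidHom) : F.ExtendsOver X Q P e.symm.toMonoidHom := by
  obtain ⟨ψ, hψ, h1, h2⟩ := h
  have hsurj : Function.Surjective ψ := by
    intro z
    refine Subgroup.map_mem_of_sup (MonoidHom.id _) ψ.range (fun x hx => ?_) (fun x hx => ?_) z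
    · refine ⟨⟨e.symm ⟨x, hx⟩, (le_sup_left : P ≤ P ⊔ X) (e.symm ⟨x, hx⟩).2⟩, Subtype.ext ?_⟩
      rw [h1 (e.symm ⟨x, hx⟩) _ rfl]
      simp
    · exact ⟨⟨x, (le_sup_right : X ≤ P ⊔ X) hx⟩, Subtype.ext (h2 _ hx)⟩
  let ε := MulEquiv.ofBijective ψ ⟨F.injective hψ, hsurj⟩
  have hε : ε.toMonoidHom ∈ F.Hom (P ⊔ X) (Q ⊔ X) := hψ
  refine ⟨ε.symm.toMonoidHom, F.symm_mem hε, fun x y hy => ?_, fun y hy => ?_⟩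
  · have h3 : ε ⟨e.symm x, (le_sup_left : P ≤ P ⊔ X) (e.symm x).2⟩ = y := Subtype.ext (by
      rw [hy]
      exact (h1 (e.symm x) _ rfl).trans (by simp))
    rw [← h3]
    simp
  · have h3 : ε ⟨y, (le_sup_right : X ≤ P ⊔ X) hy⟩ = y := Subtype.ext (h2 _ hy)
    have h4 : ε.symm y = ⟨y, (le_sup_right : X ≤ P ⊔ X) hy⟩ := by
      rw [MulEquiv.symm_apply_eq, h3]
    exact congrArg (fun z : ↥(P ⊔ X) => (z : G)) h4

theorem ExtendsOver.restrict {X P Q P₀ Q₀ : Subgroup G} {φ : P →* Q} {φ₀ : P₀ →* Q₀}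
    (hX : X ≤ S) (hP : P₀ ≤ P) (hQ : Q₀ ≤ S)
    (hag : ∀ x : P₀, (φ₀ x : G) = φ (Subgroup.inclusion hP x)) (h : F.ExtendsOver X P Q φ) :
    F.ExtendsOver X P₀ Q₀ φ₀ := by
  obtain ⟨ψ, hψ, h1, h2⟩ := h
  have hle : P₀ ⊔ X ≤ P ⊔ X := sup_le_sup_right hP X
  have hag' : ∀ (x : P₀) (y : ↥(P₀ ⊔ X)), (y : G) = x →
      (ψ (Subgroup.inclusion hle y) : G) = φ₀ x := fun x y hy =>
    (h1 (Subgroup.inclusion hP x) _ hy).trans (hag x).symm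
  have him : ∀ x : ↥(P₀ ⊔ X), (ψ (Subgroup.inclusion hle x) : G) ∈ Q₀ ⊔ X := by
    refine Subgroup.map_mem_of_sup ((Q ⊔ X).subtype.comp (ψ.comp (Subgroup.inclusion hle))) _
      (fun x hx => ?_) (fun x hx => ?_)
    · refine (le_sup_left : Q₀ ≤ Q₀ ⊔ X) ?_
      change (ψ (Subgroup.inclusion hle x) : G) ∈ Q₀
      rw [hag' ⟨x, hx⟩ x rfl]
      exact (φ₀ _).2
    · refine (le_sup_right : X ≤ Q₀ ⊔ X) ?_
      change (ψ (Subgroup.inclusion hle x) : G) ∈ X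
      rw [h2 _ hx]
      exact hx
  exact ⟨restrictHom ψ hle him, restrictHom_mem hψ hle (sup_le hQ hX) him, hag',
    fun y hy => h2 _ hy⟩

end FusionSystem

namespace LinkingSystem

open FusionSystem

/-- Lift an extension of an isomorphism to `N_S(P)`. Each `g ∈ N_S(P)` lies in its source, so (C)
applies to `g`, and restricting to `P` gives `χ`. -/
theorem exists_iso_receptive [Finite S] [Fact p.Prime] (hS : IsPGroup p S) (hF : F.Saturated p)
    {L : LinkingSystem.{u, v} p F} (P : L.Ob) :
    ∃ (Q : L.Ob) (χ : P ≅ Q), F.Receptive Q.grp ∧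
      ∀ (g : G) (hg : g ∈ S ⊓ Subgroup.normalizer (P.grp : Set G)), ∃ (k : G)
        (hk : k ∈ transporter S Q.grp Q.grp),
        L.δ P P ⟨g, normalizer_mem_transporter hg⟩ ≫ χ.hom = χ.hom ≫ L.δ Q Q ⟨k, hk⟩ := by
  obtain ⟨Q, hA, hR, hPQ⟩ := exists_receptive_iso hF P
  obtain ⟨e, he, φ, hφ, hext⟩ := exists_extension_normalizer hS hPQ hA hR
  have hP := L.obj_le _ P.mem
  have hle : P.grp ≤ S ⊓ Subgroup.normalizer (P.grp : Set G) := le_inf hP Subgroup.le_normalizer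
  let N : L.Ob := ⟨_, L.obj_overgroup _ P.mem _ hle inf_le_left⟩
  let S' : L.Ob := ⟨S, L.top_mem P⟩
  have hPN : P.grp ≤ N.grp := hle
  have hQS : Q.grp ≤ S'.grp := L.obj_le _ Q.mem
  obtain ⟨ψ, hψ⟩ := L.exists_lift (P := N) (Q := S') hφ
  obtain ⟨χ, hχ⟩ := L.exists_factor (L.incl hPN ≫ ψ) hQS (fun x => by
    rw [L.π_comp_apply, hψ, hext x _ (L.π_incl _ x)]
    exact (e x).2)
  have := L.isIso_of_card_eq χ (Nat.card_congr e.toEquiv)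
  refine ⟨Q, asIso χ, hR, fun g hg => ?_⟩
  have hgN : g ∈ transporter S N.grp N.grp := self_mem_transporter inf_le_left hg
  have hkS : (φ ⟨g, hg⟩ : G) ∈ transporter S S'.grp S'.grp :=
    self_mem_transporter le_rfl (φ ⟨g, hg⟩).2
  have hk : (φ ⟨g, hg⟩ : G) ∈ transporter S Q.grp Q.grp := by
    refine ⟨(φ ⟨g, hg⟩).2, fun q hq => ?_⟩
    obtain ⟨x, hx⟩ := e.surjective ⟨q, hq⟩
    have hgx := (Subgroup.mem_normalizer_iff.1 hg.2 x).1 x.2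
    have h1 := hext ⟨_, hgx⟩ (⟨g, hg⟩ * Subgroup.inclusion hle x * ⟨g, hg⟩⁻¹) rfl
    have h2 : (φ (Subgroup.inclusion hle x) : G) = q := by
      rw [hext x _ rfl, hx]
    rw [map_mul, map_mul, map_inv] at h1
    have h3 : (φ ⟨g, hg⟩ : G) * q * (φ ⟨g, hg⟩ : G)⁻¹ = e ⟨_, hgx⟩ := by
      rw [← h1, ← h2]
      rfl
    rw [h3]
    exact (e _).2
  refine ⟨_, hk, ?_⟩
  have hcomm : L.δ N N ⟨g, hgN⟩ ≫ ψ = ψ ≫ L.δ S' S' ⟨_, hkS⟩ :=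
    L.δ_comm ψ ⟨g, hg⟩ _ _ rfl (by rw [hψ])
  rw [asIso_hom, ← cancel_mono (L.incl hQS), Category.assoc, hχ, ← Category.assoc,
    L.δ_comp_incl hPN hPN _ hgN, Category.assoc, hcomm, Category.assoc,
    L.δ_comp_incl hQS hQS hk hkS, ← Category.assoc, ← hχ, Category.assoc]

/-- An automorphism `θ` of `P` in `L` commuting with `δ_P(a)` extends over `⟨a⟩` in `F`. -/
theorem extendsOver_of_commute [Finite S] [Fact p.Prime] (hS : IsPGroup p S)
    (hF : F.Saturated p) {L : LinkingSystem.{u, v} p F} {P : L.Ob} (θ : P ≅ P) {a : G}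
    (ha : a ∈ S ⊓ Subgroup.normalizer (P.grp : Set G))
    (h : L.δ P P ⟨a, normalizer_mem_transporter ha⟩ ≫ θ.hom =
      θ.hom ≫ L.δ P P ⟨a, normalizer_mem_transporter ha⟩) :
    F.ExtendsOver (Subgroup.zpowers a) P.grp P.grp (L.π θ.hom) := by
  have hP := L.obj_le _ P.mem
  obtain ⟨Q, χ, hR, hχ⟩ := exists_iso_receptive hS hF P
  let X := Subgroup.zpowers a
  have hN : P.grp ⊔ X ≤ S ⊓ Subgroup.normalizer (P.grp : Set G) :=
    sup_le (le_inf hP Subgroup.le_normalizer) (Subgroup.zpowers_le.2 ha)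
  let θ' : Aut P := θ
  -- Conjugation by `θ` keeps `δ_P(P⟨a⟩)` within `δ_P(N_S(P))`: on `P` by (C), on `⟨a⟩` by the
  -- commutation hypothesis.
  have hθ : ∀ g : ↥(P.grp ⊔ X), (MulAut.conj θ').toMonoidHom
      (L.deltaAut P (Subgroup.inclusion hN g)) ∈ (L.deltaAut P).range := by
    refine Subgroup.map_mem_of_sup ((MulAut.conj θ').toMonoidHom.comp
      ((L.deltaAut P).comp (Subgroup.inclusion hN))) _ (fun x hx => ?_) (fun x hx => ?_)
    · have hk := (L.π θ.hom ⟨x, hx⟩).2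
      refine ⟨⟨L.π θ.hom ⟨x, hx⟩, hP hk, Subgroup.le_normalizer hk⟩, ?_⟩
      change _ = θ' * _ * θ'⁻¹
      rw [eq_mul_inv_iff_mul_eq]
      exact Iso.ext (L.δ_comm θ.hom ⟨x, hx⟩ _ _ rfl rfl).symm
    · obtain ⟨n, hn⟩ := Subgroup.mem_zpowers_iff.1 hx
      have h1 : Subgroup.inclusion hN x = ⟨a, ha⟩ ^ n := Subtype.ext hn.symm
      have h2 : Commute θ' (L.deltaAut P ⟨a, ha⟩) := Iso.ext h
      refine ⟨Subgroup.inclusion hN x, ?_⟩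
      change L.deltaAut P (Subgroup.inclusion hN x) =
        θ' * L.deltaAut P (Subgroup.inclusion hN x) * θ'⁻¹
      rw [eq_mul_inv_iff_mul_eq, h1, map_zpow]
      exact (h2.zpow_right n).eq.symm
  -- `P` need not be receptive, so `θ` is not extended directly. Instead `χ` and `θ ≫ χ` extend over
  -- `P⟨a⟩` to `u` and `v`, which agree at `a`, and `u⁻¹ ∘ v` is the extension sought.
  obtain ⟨u, hu, hu1, hu2⟩ := exists_extension_of_receptive hF hR χ.hom
    (le_sup_left : P.grp ≤ P.grp ⊔ X)
    (fun g hg => ⟨normalizer_mem_transporter (hN hg), hχ g (hN hg)⟩)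
  obtain ⟨v, hv, hv1, hv2⟩ := exists_extension_of_receptive hF hR (θ.hom ≫ χ.hom)
    (le_sup_left : P.grp ≤ P.grp ⊔ X) (fun g hg => by
      refine ⟨normalizer_mem_transporter (hN hg), ?_⟩
      obtain ⟨h, hh⟩ := hθ ⟨g, hg⟩
      have h1 : L.δ P P ⟨g, normalizer_mem_transporter (hN hg)⟩ ≫ θ.hom =
          θ.hom ≫ L.δ P P ⟨h, normalizer_mem_transporter h.2⟩ := by
        have h2 : L.deltaAut P h = θ' * L.deltaAut P ⟨g, hN hg⟩ * θ'⁻¹ := hh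
        rw [eq_mul_inv_iff_mul_eq] at h2
        exact congrArg (fun z : Aut P => z.hom) h2.symm
      obtain ⟨k, hk, hk'⟩ := hχ h h.2
      refine ⟨k, hk, ?_⟩
      rw [← Category.assoc, h1, Category.assoc, hk', Category.assoc])
  have haX : a ∈ P.grp ⊔ X := (le_sup_right : X ≤ P.grp ⊔ X) (Subgroup.mem_zpowers a)
  obtain ⟨k, hk, hka⟩ := hχ a ha
  have hua : (u ⟨a, haX⟩ : G) = k := hu2 ⟨a, haX⟩ _ k hk hka
  have hva : (v ⟨a, haX⟩ : G) = k := hv2 ⟨a, haX⟩ _ k hk (by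
    rw [← Category.assoc, h, Category.assoc, hka, Category.assoc])
  -- Inverting `u` on its image `R` requires that `v` also land in `R`, which is checked on `P` and
  -- on `⟨a⟩`.
  obtain ⟨R, hRS, e, he, he', hue⟩ := F.factor hu
  have hue' : ∀ x, (u x : G) = e x := fun x =>
    congrArg (fun f : ↥(P.grp ⊔ X) →* S => ((f x : S) : G)) hue
  have hvu : ∀ x : P.grp, (v (Subgroup.inclusion le_sup_left x) : G) =
      u (Subgroup.inclusion le_sup_left (L.π θ.hom x)) := fun x => by
    rw [hv1, hu1, L.π_comp_apply]
  have hpow : ∀ x : ↥(P.grp ⊔ X), (x : G) ∈ X → v x = u x := by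
    intro x hx
    obtain ⟨n, hn⟩ := Subgroup.mem_zpowers_iff.1 hx
    have h1 : x = ⟨a, haX⟩ ^ n := Subtype.ext hn.symm
    rw [h1, map_zpow, map_zpow, show v ⟨a, haX⟩ = u ⟨a, haX⟩ from
      Subtype.ext (hva.trans hua.symm)]
  have him : ∀ x : ↥(P.grp ⊔ X), (v (Subgroup.inclusion le_rfl x) : G) ∈ R := by
    refine Subgroup.map_mem_of_sup (S.subtype.comp v) R (fun x hx => ?_) (fun x hx => ?_)
    · change (v x : G) ∈ R
      rw [show x = Subgroup.inclusion le_sup_left (⟨x, hx⟩ : P.grp) from rfl, hvu, hue']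
      exact (e _).2
    · change (v x : G) ∈ R
      rw [hpow x hx, hue']
      exact (e _).2
  have hcancel : ∀ x y : ↥(P.grp ⊔ X), (v x : G) = u y →
      e.symm (restrictHom v le_rfl him x) = y := by
    intro x y hxy
    rw [MulEquiv.symm_apply_eq]
    exact Subtype.ext (hxy.trans (hue' y))
  refine ⟨e.symm.toMonoidHom.comp (restrictHom v le_rfl him),
    F.comp_mem (restrictHom_mem hv le_rfl (F.le_of_mem he).2 him) he', fun x y hy => ?_,
    fun y hy => ?_⟩
  · have hy' : y = Subgroup.inclusion le_sup_left x := Subtype.ext hy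
    exact congrArg (fun z : ↥(P.grp ⊔ X) => (z : G))
      (hcancel y (Subgroup.inclusion le_sup_left (L.π θ.hom x)) (by rw [hy', hvu]))
  · exact congrArg (fun z : ↥(P.grp ⊔ X) => (z : G)) (hcancel y y (by rw [hpow y hy]))

namespace Inclusion

variable {L₀ : LinkingSystem.{u, w} p E} {L : LinkingSystem.{u, v} p F} {J : L₀.Inclusion L}
  {a : G}

/-- If `δ(a)` commutes with all morphisms of `L₀`, then `a ∈ C_S(E)`. -/
theorem mem_subsystemCentralizer_of_commutes [Finite S] [Fact p.Prime] (hS : IsPGroup p S)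
    (hEF : F.WeaklyNormal p E) (ha : a ∈ centralizerIn S T)
    (h : ∀ (P Q : L₀.Ob) (ψ : P ⟶ Q), J.Commutes ha ψ) : a ∈ F.subsystemCentralizer E := by
  have hTS := hEF.stronglyClosed.1
  have := finite_of_le hTS
  have hTC : T ≤ centralizerIn S (Subgroup.zpowers a) := by
    refine le_inf hTS fun t ht => ?_
    rw [Subgroup.mem_centralizer_iff]
    intro y hy
    obtain ⟨n, rfl⟩ := Subgroup.mem_zpowers_iff.1 hy
    have h1 : Commute a t := mul_inv_eq_iff_eq_mul.1 ((mem_centralizerIn.1 ha).2 t ht)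
    exact (h1.zpow_left n).eq
  refine ⟨ha.1, hTC, fun P Q φ hφ => ?_⟩
  have hle := E.le_of_mem hφ
  refine ⟨hle.1.trans hTC, hle.2.trans hTC, hEF.subsystem P Q hφ, ?_⟩
  -- Centric radical subgroups of `E` are objects of `L₀`, so their automorphisms lift there and
  -- commute with `δ(a)`.
  refine hEF.saturated_sub.alperin (isPGroup_of_le hS hTS)
    (fun P Q φ => F.ExtendsOver (Subgroup.zpowers a) P Q φ)
    (fun _ _ _ _ _ _ _ h1 h2 => h1.comp h2) (fun _ _ _ _ h1 => h1.symm)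
    (fun _ _ _ _ _ _ hP _ h0 hag h1 =>
      h1.restrict (Subgroup.zpowers_le.2 ha.1) hP ((E.le_of_mem h0).2.trans hTS) hag)
    (fun R e hc hr he => ?_) P Q φ hφ
  let R' : L₀.Ob := ⟨R, L₀.obj_centric_radical R hc hr⟩
  obtain ⟨θ, hθ⟩ := L₀.exists_lift (P := R') (Q := R') he
  have := L₀.isIso_of_card_eq θ rfl
  have h2 := extendsOver_of_commute hS hEF.saturated (J.functor.mapIso (asIso θ))
    (J.mem_normalizer_of_mem_centralizer ha R') (h R' R' θ)
  rw [← hθ, ← J.π_functor_map]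
  exact h2

end Inclusion

end LinkingSystem

end CentralizerConverse

/-! ### The conjugation functors `c_γ` -/

section ConjugationFunctor

variable {G : Type u} [Group G] {p : ℕ} {S T : Subgroup G} {F : FusionSystem S}
  {E : FusionSystem T}

namespace LinkingSystem

open FusionSystem

theorem π_hom_surjective {L : LinkingSystem.{u, v} p F} {P Q : L.Ob} (e : P ≅ Q) :
    Function.Surjective (L.π e.hom) := fun y =>
  ⟨L.π e.inv y, by
    rw [← L.π_comp_apply, e.inv_hom_id, L.π_id]
    rfl⟩

theorem grp_eq_imageOf_of_restriction {L : LinkingSystem.{u, v} p F} {P Q P₀ Q₀ : L.Ob}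
    (hP : P₀.grp ≤ P.grp) (hQ : Q₀.grp ≤ Q.grp) {ψ : P ⟶ Q} (e : P₀ ≅ Q₀)
    (h : e.hom ≫ L.incl hQ = L.incl hP ≫ ψ) : Q₀.grp = imageOf (L.π ψ) P₀.grp := by
  have h1 : ∀ x : P₀.grp, (L.π ψ (Subgroup.inclusion hP x) : G) = L.π e.hom x := fun x => by
    have h2 := congrArg (fun f => (L.π f x : G)) h
    simp only [L.π_comp_apply] at h2
    rw [L.π_incl] at h2
    rw [h2]
    congr 2
    exact Subtype.ext (L.π_incl hP x).symm
  ext y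
  rw [mem_imageOf]
  constructor
  · intro hy
    obtain ⟨x, hx⟩ := π_hom_surjective e ⟨y, hy⟩
    exact ⟨Subgroup.inclusion hP x, x.2, by rw [h1, hx]⟩
  · rintro ⟨x, hx, rfl⟩
    rw [show x = Subgroup.inclusion hP ⟨x, hx⟩ from rfl, h1]
    exact (L.π e.hom _).2

namespace Inclusion

variable {L₀ : LinkingSystem.{u, w} p E} {L : LinkingSystem.{u, v} p F} {J : L₀.Inclusion L}
  {hT : T ∈ L₀.Obj}

/-- `r` is the restriction of `γ ∈ Aut_L(T)`. -/
def Restricts (J : L₀.Inclusion L) (γ : J.functor.obj ⟨T, hT⟩ ≅ J.functor.obj ⟨T, hT⟩)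
    {P P' : L₀.Ob} (r : J.functor.obj P ≅ J.functor.obj P') : Prop :=
  r.hom ≫ J.functor.map (L₀.incl (Q := ⟨T, hT⟩) (L₀.obj_le _ P'.mem)) =
    J.functor.map (L₀.incl (L₀.obj_le _ P.mem)) ≫ γ.hom

theorem Restricts.refl (P : L₀.Ob) :
    J.Restricts (Iso.refl (J.functor.obj ⟨T, hT⟩)) (Iso.refl (J.functor.obj P)) := by
  simp [Restricts]

theorem Restricts.trans {γ γ' : J.functor.obj ⟨T, hT⟩ ≅ J.functor.obj ⟨T, hT⟩} {P P' P'' : L₀.Ob}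
    {r : J.functor.obj P ≅ J.functor.obj P'} {r' : J.functor.obj P' ≅ J.functor.obj P''}
    (h : J.Restricts γ r) (h' : J.Restricts γ' r') :
    J.Restricts (γ.trans γ') (r.trans r') := by
  unfold Restricts at *
  rw [Iso.trans_hom, Category.assoc, h', ← Category.assoc, h, Category.assoc, Iso.trans_hom]

/-- Inclusions are monic, so a restriction is unique once its target is fixed; `eqToHom` compares
targets that are only provably equal. -/
theorem Restricts.comp_eqToHom {γ : J.functor.obj ⟨T, hT⟩ ≅ J.functor.obj ⟨T, hT⟩}
    {P P' P'' : L₀.Ob} {r : J.functor.obj P ≅ J.functor.obj P'}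
    {r' : J.functor.obj P ≅ J.functor.obj P''} (h : J.Restricts γ r) (h' : J.Restricts γ r')
    (e : P' = P'') : r.hom ≫ J.functor.map (eqToHom e) = r'.hom := by
  subst e
  unfold Restricts at *
  rw [eqToHom_refl, J.functor.map_id, Category.comp_id]
  exact (cancel_mono _).1 (h.trans h'.symm)

theorem Restricts.grp_eq {γ : J.functor.obj ⟨T, hT⟩ ≅ J.functor.obj ⟨T, hT⟩}
    {P P' : L₀.Ob} {r : J.functor.obj P ≅ J.functor.obj P'} (h : J.Restricts γ r) :
    P'.grp = imageOf (L.π γ.hom) P.grp := by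
  unfold Restricts at h
  rw [functor_map_incl, functor_map_incl] at h
  exact grp_eq_imageOf_of_restriction _ _ r h

/-- `Φ` is the conjugation functor `c_γ`, in terms of the inclusion functor. -/
def IsConjBy (J : L₀.Inclusion L) (γ : J.functor.obj ⟨T, hT⟩ ≅ J.functor.obj ⟨T, hT⟩)
    (Φ : L₀.Ob ⥤ L₀.Ob) : Prop :=
  ∃ r : ∀ P : L₀.Ob, J.functor.obj P ≅ J.functor.obj (Φ.obj P),
    (∀ P, J.Restricts γ (r P)) ∧
    ∀ (P Q : L₀.Ob) (ψ : P ⟶ Q),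
      J.functor.map (Φ.map ψ) = (r P).inv ≫ J.functor.map ψ ≫ (r Q).hom

/-- The formula for `c_γ` on objects is forced by the existence of the restrictions. -/
theorem isConjugation_iff (γ : J.functor.obj ⟨T, hT⟩ ≅ J.functor.obj ⟨T, hT⟩)
    (Φ : L₀.Ob ⥤ L₀.Ob) :
    J.IsConjugation (hT := J.obj_subset hT) γ Φ ↔ J.IsConjBy γ Φ := by
  have key : ∀ (P P' : L₀.Ob) (r : J.functor.obj P ≅ J.functor.obj P'), J.Restricts γ r ↔
      L.IsRestriction (L₀.obj_le _ P.mem) (L₀.obj_le _ P'.mem) γ.hom r.hom := by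
    intro P P' r
    unfold Restricts
    rw [functor_map_incl, functor_map_incl]
    rfl
  constructor
  · rintro ⟨-, r, hr, hm⟩
    exact ⟨r, fun P => (key P _ _).2 (hr P), hm⟩
  · rintro ⟨r, hr, hm⟩
    exact ⟨fun P => (hr P).grp_eq, r, fun P => (key P _ _).1 (hr P), hm⟩

theorem IsConjBy.refl : J.IsConjBy (Iso.refl (J.functor.obj ⟨T, hT⟩)) (𝟭 L₀.Ob) :=
  ⟨fun _ => Iso.refl _, fun P => Restricts.refl P, fun _ _ _ => by simp⟩

theorem IsConjBy.comp {γ γ' : J.functor.obj ⟨T, hT⟩ ≅ J.functor.obj ⟨T, hT⟩}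
    {Φ Φ' : L₀.Ob ⥤ L₀.Ob} (h : J.IsConjBy γ Φ) (h' : J.IsConjBy γ' Φ') :
    J.IsConjBy (γ.trans γ') (Φ ⋙ Φ') := by
  obtain ⟨r, hr, hm⟩ := h
  obtain ⟨r', hr', hm'⟩ := h'
  refine ⟨fun P => (r P).trans (r' (Φ.obj P)), fun P => (hr P).trans (hr' _), fun P Q ψ => ?_⟩
  rw [Functor.comp_map, hm', hm]
  simp

theorem IsConjBy.grp_eq {γ : J.functor.obj ⟨T, hT⟩ ≅ J.functor.obj ⟨T, hT⟩}
    {Φ : L₀.Ob ⥤ L₀.Ob} (h : J.IsConjBy γ Φ) (P : L₀.Ob) :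
    (Φ.obj P).grp = imageOf (L.π γ.hom) P.grp := by
  obtain ⟨r, hr, -⟩ := h
  exact (hr P).grp_eq

/-- Restrictions of `γ` determine the functor on objects through images and, being unique, on
morphisms through the faithful inclusion into `L`. -/
theorem IsConjBy.unique {γ : J.functor.obj ⟨T, hT⟩ ≅ J.functor.obj ⟨T, hT⟩}
    {Φ Φ' : L₀.Ob ⥤ L₀.Ob} (h : J.IsConjBy γ Φ) (h' : J.IsConjBy γ Φ') : Φ = Φ' := by
  have hobj : ∀ P, Φ.obj P = Φ'.obj P := fun P => by
    ext1
    rw [h.grp_eq, h'.grp_eq]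
  obtain ⟨r, hr, hm⟩ := h
  obtain ⟨r', hr', hm'⟩ := h'
  refine CategoryTheory.Functor.ext hobj fun P Q ψ => J.functor.map_injective ?_
  have h1 := (hr P).comp_eqToHom (hr' P) (hobj P)
  have h2 := (hr' Q).comp_eqToHom (hr Q) (hobj Q).symm
  rw [J.functor.map_comp, J.functor.map_comp, hm, hm', Iso.inv_comp_eq,
    ← Category.assoc (r P).hom, h1]
  simp only [Category.assoc, h2, Iso.hom_inv_id_assoc]

/-- By (C), `c_γ` sends `δ_P(g)` to `δ` of the image of `g` under the restriction of `π(γ)`, and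
that restriction is onto. -/
theorem range_of_isConjBy
    {γ : J.functor.obj ⟨T, hT⟩ ≅ J.functor.obj ⟨T, hT⟩} {Φ : L₀.Ob ⥤ L₀.Ob}
    (hTS : T ≤ S)
    (h : J.IsConjBy γ Φ) (P : L₀.Ob) :
    Set.range (fun g : P.grp => Φ.map (L₀.deltaSelf P g)) =
      Set.range (L₀.deltaSelf (Φ.obj P)) := by
  obtain ⟨r, -, hm⟩ := h
  have key : ∀ g : P.grp, Φ.map (L₀.deltaSelf P g) =
      L₀.deltaSelf (Φ.obj P) (L.π (r P).hom g) := by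
    intro g
    apply J.functor.map_injective
    rw [hm, Iso.inv_comp_eq]
    have hg : (g : G) ∈ transporter S (J.functor.obj P).grp (J.functor.obj P).grp :=
      self_mem_transporter ((L₀.obj_le _ P.mem).trans hTS) g.2
    have hg' := self_mem_transporter ((L₀.obj_le _ (Φ.obj P).mem).trans hTS) (L.π (r P).hom g).2
    have h1 : J.functor.map (L₀.deltaSelf P g) = L.δ _ _ ⟨g, hg⟩ := J.functor_map_δ _ _
    have h2 : J.functor.map (L₀.deltaSelf (Φ.obj P) (L.π (r P).hom g)) = L.δ _ _ ⟨_, hg'⟩ :=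
      J.functor_map_δ _ _
    rw [h1, h2]
    exact L.δ_comm (r P).hom g _ _ rfl rfl
  simp only [key]
  exact (π_hom_surjective (r P)).range_comp (L₀.deltaSelf (Φ.obj P))

theorem preservesInclusions_of_isConjBy
    {γ : J.functor.obj ⟨T, hT⟩ ≅ J.functor.obj ⟨T, hT⟩} {Φ : L₀.Ob ⥤ L₀.Ob}
    (h : J.IsConjBy γ Φ) : L₀.PreservesInclusions Φ := by
  intro P Q hPQ
  have hle : (Φ.obj P).grp ≤ (Φ.obj Q).grp := by
    rw [h.grp_eq, h.grp_eq]
    intro y hy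
    obtain ⟨x, hx, rfl⟩ := mem_imageOf.1 hy
    exact mem_imageOf.2 ⟨x, hPQ hx, rfl⟩
  refine ⟨hle, J.functor.map_injective ?_⟩
  obtain ⟨r, hr, hm⟩ := h
  have hP := hr P
  have hQ := hr Q
  unfold Restricts at hP hQ
  rw [hm, Iso.inv_comp_eq, ← cancel_mono (J.functor.map
    (L₀.incl (Q := ⟨T, hT⟩) (L₀.obj_le _ (Φ.obj Q).mem))), Category.assoc, hQ, Category.assoc,
    ← J.functor.map_comp, ← Category.assoc, ← J.functor.map_comp, incl_comp_incl, incl_comp_incl]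
  exact hP.symm

variable [Finite S]

theorem WeaklyNormal.exists_restricts (hJ : J.WeaklyNormal)
    (γ : J.functor.obj ⟨T, hT⟩ ≅ J.functor.obj ⟨T, hT⟩) (P : L₀.Ob) :
    ∃ (P' : L₀.Ob) (r : J.functor.obj P ≅ J.functor.obj P'), J.Restricts γ r := by
  have hP : (J.functor.obj P).grp ≤ (J.functor.obj ⟨T, hT⟩).grp := L₀.obj_le _ P.mem
  obtain ⟨Q, hQ, e, he, -⟩ := L.exists_restriction γ.hom hP
  refine ⟨⟨Q.grp, hJ.mem_of_le Q.mem hQ⟩, e, ?_⟩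
  unfold Restricts
  rw [functor_map_incl, functor_map_incl]
  exact he

theorem WeaklyNormal.exists_isConjBy (hJ : J.WeaklyNormal)
    (γ : J.functor.obj ⟨T, hT⟩ ≅ J.functor.obj ⟨T, hT⟩) :
    ∃ Φ : L₀.Ob ⥤ L₀.Ob, J.IsConjBy γ Φ := by
  choose obj r hr using hJ.exists_restricts γ
  choose map hmap using fun (P Q : L₀.Ob) (ψ : P ⟶ Q) =>
    hJ.exists_conj γ (r P) (r Q) (hr P) (hr Q) ψ
  let Φ : L₀.Ob ⥤ L₀.Ob :=
    { obj := obj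
      map := fun {P Q} ψ => map P Q ψ
      map_id := fun P => J.functor.map_injective (by rw [hmap]; simp)
      map_comp := fun ψ χ => J.functor.map_injective (by
        rw [hmap, J.functor.map_comp, J.functor.map_comp, hmap, hmap]
        simp) }
  exact ⟨Φ, ⟨r, hr, hmap⟩⟩

/-- By uniqueness, the functor of `γ⁻¹` is a strict inverse. -/
theorem WeaklyNormal.isEquivalence_of_isConjBy (hJ : J.WeaklyNormal)
    {γ : J.functor.obj ⟨T, hT⟩ ≅ J.functor.obj ⟨T, hT⟩} {Φ : L₀.Ob ⥤ L₀.Ob}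
    (h : J.IsConjBy γ Φ) : Φ.IsEquivalence := by
  obtain ⟨Ψ, h'⟩ := hJ.exists_isConjBy γ.symm
  have h1 : Φ ⋙ Ψ = 𝟭 _ := by
    have h2 := h.comp h'
    rw [Iso.self_symm_id] at h2
    exact h2.unique IsConjBy.refl
  have h2 : Ψ ⋙ Φ = 𝟭 _ := by
    have h2 := h'.comp h
    rw [Iso.symm_self_id] at h2
    exact h2.unique IsConjBy.refl
  exact (CategoryTheory.Equivalence.mk Φ Ψ (eqToIso h1.symm) (eqToIso h2)).isEquivalence_functor

theorem WeaklyNormal.exists_conjugationHom (hJ : J.WeaklyNormal) (hTS : T ≤ S)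
    (hT : T ∈ L₀.Obj) :
    ∃ c : Aut (J.functor.obj ⟨T, hT⟩) →* L₀.AutTypI,
      ∀ (γ : Aut (J.functor.obj ⟨T, hT⟩)) (Φ : L₀.Ob ⥤ L₀.Ob),
        J.IsConjugation (hT := J.obj_subset hT) γ Φ ↔ Φ = (c γ).1 := by
  choose c hc using fun γ : Aut (J.functor.obj ⟨T, hT⟩) => hJ.exists_isConjBy (hT := hT) γ
  refine ⟨
    { toFun := fun γ => ⟨c γ, ⟨hJ.isEquivalence_of_isConjBy (hc γ),
        range_of_isConjBy hTS (hc γ)⟩, preservesInclusions_of_isConjBy (hc γ)⟩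
      map_one' := Subtype.ext ((hc 1).unique IsConjBy.refl)
      -- A product in `Aut` applies its right factor first, as does the product of functors here.
      map_mul' := fun γ γ' => Subtype.ext ((hc (γ * γ')).unique ((hc γ').comp (hc γ))) },
    fun γ Φ => (isConjugation_iff γ Φ).trans ⟨fun h => h.unique (hc γ), ?_⟩⟩
  rintro rfl
  exact hc γ

end Inclusion

end LinkingSystem

end ConjugationFunctor

/-! ### Isotypical equivalences that preserve inclusions -/

section Isotypical

variable {G : Type u} [Group G] {p : ℕ} {S : Subgroup G} {F : FusionSystem S}

theorem CategoryTheory.Functor.finite_of_finite {C : Type*} [Category C] {D : Type*} [Category D]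
    [Finite C] [∀ X Y : C, Finite (X ⟶ Y)] [Finite D] [∀ X Y : D, Finite (X ⟶ Y)] :
    Finite (C ⥤ D) := by
  let f : (C ⥤ D) → (Σ (X : C) (Y : C), (X ⟶ Y)) → Σ (X : D) (Y : D), (X ⟶ Y) :=
    fun Φ x => ⟨Φ.obj x.1, Φ.obj x.2.1, Φ.map x.2.2⟩
  refine Finite.of_injective f fun Φ Ψ h => ?_
  refine CategoryTheory.Functor.hext
    (fun X => congrArg Sigma.fst (congrFun h ⟨X, X, 𝟙 X⟩)) fun X Y g => ?_
  have h1 := (Sigma.mk.inj_iff.1 (congrFun h ⟨X, Y, g⟩))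
  have hX : Φ.obj X = Ψ.obj X := h1.1
  have h2 := h1.2
  have hY : Φ.obj Y = Ψ.obj Y := congrArg Sigma.fst (congrFun h ⟨Y, Y, 𝟙 Y⟩)
  generalize Φ.map g = a at *
  generalize Ψ.map g = b at *
  generalize Φ.obj X = A at *
  generalize Φ.obj Y = B at *
  subst hX hY
  exact (Sigma.mk.inj_iff.1 (eq_of_heq h2)).2

theorem CategoryTheory.Functor.heq_of_map_heq {C : Type*} [Category C] {D : Type*} [Category D]
    (Φ : C ⥤ D) [Φ.Faithful] {X Y X' Y' : C} (hX : X = X') (hY : Y = Y') {f : X ⟶ Y}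
    {g : X' ⟶ Y'} (h : Φ.map f ≍ Φ.map g) : f ≍ g := by
  subst hX hY
  exact heq_of_eq (Φ.map_injective (eq_of_heq h))

namespace LinkingSystem

open FusionSystem

variable {L : LinkingSystem.{u, v} p F}

theorem deltaSelf_comp_incl {P Q : L.Ob} (h : P.grp ≤ Q.grp) (g : P.grp) :
    L.deltaSelf P g ≫ L.incl h = L.incl h ≫ L.deltaSelf Q (Subgroup.inclusion h g) :=
  L.δ_comp_incl h h _ _

theorem deltaSelf_comm {P Q : L.Ob} (ψ : P ⟶ Q) (g : P.grp) :
    L.deltaSelf P g ≫ ψ = ψ ≫ L.deltaSelf Q (L.π ψ g) :=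
  L.δ_comm ψ g _ _ rfl rfl

variable [Finite S]

theorem finite_ob (L : LinkingSystem.{u, v} p F) : Finite L.Ob := by
  refine Finite.of_injective (fun P : L.Ob => P.grp.subgroupOf S) fun P Q h => ?_
  ext1
  rw [← inf_eq_left.2 (L.obj_le _ P.mem), ← inf_eq_left.2 (L.obj_le _ Q.mem)]
  exact Subgroup.subgroupOf_inj.1 h

theorem finite_autTypI (L : LinkingSystem.{u, v} p F) : Finite L.AutTypI := by
  have := L.finite_ob
  have := L.finite_hom
  have : Finite (L.Ob ⥤ L.Ob) := CategoryTheory.Functor.finite_of_finite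
  exact Subtype.finite

theorem deltaSelf_injective (hF : F.Saturated p) (P : L.Ob) :
    Function.Injective (L.deltaSelf P) := fun _ _ h => Subtype.ext (δ_injective hF _ _ h)

/-- `α` is faithful and `δ` is injective, so the two equal sets of automorphisms have the orders of
`P` and `α(P)`. -/
theorem IsIsotypicalEquivalence.card_eq (hF : F.Saturated p) {α : L.Ob ⥤ L.Ob}
    (hα : L.IsIsotypicalEquivalence α) (P : L.Ob) :
    Nat.card (α.obj P).grp = Nat.card P.grp := by
  have := hα.1
  have h1 : Function.Injective (fun g : P.grp => α.map (L.deltaSelf P g)) :=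
    fun g h hgh => deltaSelf_injective hF P (α.map_injective hgh)
  rw [← Nat.card_range_of_injective h1, ← Nat.card_range_of_injective
    (deltaSelf_injective hF (α.obj P)), hα.2 P]

/-- An isotypical equivalence preserving inclusions acts on objects through an injective map
`S → S`. -/
theorem injective_obj (hF : F.Saturated p) {α : L.Ob ⥤ L.Ob}
    (hα : L.IsIsotypicalEquivalence α) (hI : L.PreservesInclusions α) :
    Function.Injective α.obj := by
  intro P Q hPQ
  have := hα.1
  let S' : L.Ob := ⟨S, L.top_mem P⟩
  have hβ : ∀ g : S'.grp, ∃ b : (α.obj S').grp,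
      α.map (L.deltaSelf S' g) = L.deltaSelf (α.obj S') b := by
    intro g
    have h1 : α.map (L.deltaSelf S' g) ∈ Set.range (L.deltaSelf (α.obj S')) := by
      rw [← hα.2]
      exact ⟨g, rfl⟩
    obtain ⟨b, hb⟩ := h1
    exact ⟨b, hb.symm⟩
  choose β hβ using hβ
  have hinj : ∀ g h : S'.grp, (β g : G) = β h → g = h := by
    intro g h hgh
    apply deltaSelf_injective hF S'
    apply α.map_injective
    rw [hβ, hβ, Subtype.ext hgh]
  -- Since `α` preserves the inclusion of `R` in `S`, its effect on `δ_R(g)` is given by the same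
  -- element `β(g)` as on `δ_S(g)`.
  have key : ∀ (R : L.Ob) (hR : R.grp ≤ S'.grp) (g : R.grp) (y : (α.obj R).grp),
      α.map (L.deltaSelf R g) = L.deltaSelf (α.obj R) y →
      (y : G) = β (Subgroup.inclusion hR g) := by
    intro R hR g y h
    obtain ⟨h', hι⟩ := hI R S' hR
    have h1 := congrArg α.map (L.deltaSelf_comp_incl hR g)
    rw [α.map_comp, α.map_comp, hι, h, hβ, deltaSelf_comp_incl] at h1
    unfold incl deltaSelf at h1
    rw [δ_comp, δ_comp] at h1
    simpa using δ_injective hF _ _ h1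
  -- So `R` is the preimage of `α(R)` under `β`, and `α(R)` determines `R`.
  have hchar : ∀ (R : L.Ob) (hR : R.grp ≤ S'.grp) (g : S'.grp),
      (g : G) ∈ R.grp ↔ (β g : G) ∈ (α.obj R).grp := by
    intro R hR g
    constructor
    · intro hg
      have h1 : α.map (L.deltaSelf R ⟨g, hg⟩) ∈ Set.range (L.deltaSelf (α.obj R)) := by
        rw [← hα.2]
        exact ⟨_, rfl⟩
      obtain ⟨y, hy⟩ := h1
      have h2 := key R hR ⟨g, hg⟩ y hy.symm
      rw [show β g = β (Subgroup.inclusion hR ⟨g, hg⟩) from rfl, ← h2]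
      exact y.2
    · intro hg
      have h1 : L.deltaSelf (α.obj R) ⟨β g, hg⟩ ∈
          Set.range (fun g : R.grp => α.map (L.deltaSelf R g)) := by
        rw [hα.2]
        exact ⟨_, rfl⟩
      obtain ⟨x, hx⟩ := h1
      have h2 := key R hR x _ hx
      rw [hinj g _ h2]
      exact x.2
  have hP : P.grp ≤ S'.grp := L.obj_le _ P.mem
  have hQ : Q.grp ≤ S'.grp := L.obj_le _ Q.mem
  ext g
  constructor
  · intro hg
    exact (hchar Q hQ ⟨g, hP hg⟩).2 (hPQ ▸ (hchar P hP ⟨g, hP hg⟩).1 hg)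
  · intro hg
    exact (hchar P hP ⟨g, hQ hg⟩).2 (hPQ ▸ (hchar Q hQ ⟨g, hQ hg⟩).1 hg)

/-- Faithfulness and injectivity on objects make left multiplication by `α` injective, hence
surjective on a finite monoid. -/
theorem autTypI_isUnit (hF : F.Saturated p) (α : L.AutTypI) : IsUnit α := by
  have hfin := L.finite_autTypI
  have hinj := injective_obj hF α.2.1 α.2.2
  have hfaith : α.1.Faithful := α.2.1.1.faithful
  have hcancel : Function.Injective (fun β : L.AutTypI => α * β) := by
    intro β γ h
    have h1 : β.1 ⋙ α.1 = γ.1 ⋙ α.1 := congrArg Subtype.val h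
    have hobj : ∀ P, β.1.obj P = γ.1.obj P := fun P => hinj (CategoryTheory.Functor.congr_obj h1 P)
    refine Subtype.ext (CategoryTheory.Functor.hext hobj fun P Q f => ?_)
    exact α.1.heq_of_map_heq (hobj P) (hobj Q) (CategoryTheory.Functor.hcongr_hom h1 f)
  obtain ⟨β, hβ⟩ := (Finite.injective_iff_surjective.1 hcancel) 1
  have hβ : α * β = 1 := hβ
  refine ⟨⟨α, β, hβ, hcancel ?_⟩, rfl⟩
  change α * (β * α) = α * 1
  rw [← mul_assoc, hβ, one_mul, mul_one]

/-- Every isotypical equivalence is naturally isomorphic to one preserving inclusions. -/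
theorem exists_iso_preservesInclusions (hT : S ∈ L.Obj) {α : L.Ob ⥤ L.Ob}
    (hα : L.IsIsotypicalEquivalence α) :
    ∃ β : L.Ob ⥤ L.Ob, L.IsIsotypicalEquivalence β ∧ L.PreservesInclusions β ∧
      Nonempty (α ≅ β) := by
  let S' : L.Ob := ⟨S, hT⟩
  have hle : ∀ P : L.Ob, P.grp ≤ S'.grp := fun P => L.obj_le _ P.mem
  have hαi := hα.1
  obtain ⟨β, e, hobj, he, hβmap, ⟨hiso⟩⟩ : ∃ (β : L.Ob ⥤ L.Ob)
      (e : ∀ P, α.obj P ≅ β.obj P) (hobj : ∀ P, (β.obj P).grp ≤ (α.obj S').grp),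
      (∀ P, (e P).hom ≫ L.incl (hobj P) = α.map (L.incl (hle P))) ∧
      (∀ (P Q : L.Ob) (ψ : P ⟶ Q), β.map ψ = (e P).inv ≫ α.map ψ ≫ (e Q).hom) ∧
      Nonempty (α ≅ β) := by
    -- Each `α(P)` is replaced by its image in `α(S)`; the new objects are subgroups of one group,
    -- and cancelling the inclusions into it shows that inclusions are preserved.
    choose obj hobj e he _ using fun P : L.Ob => L.exists_image (α.map (L.incl (hle P)))
    exact ⟨α.copyObj obj e, e, hobj, he, fun _ _ _ => rfl, ⟨α.isoCopyObj obj e⟩⟩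
  have hβi : β.IsEquivalence := CategoryTheory.Functor.isEquivalence_of_iso hiso
  refine ⟨β, ⟨hβi, fun P => ?_⟩, fun P Q h => ?_, ⟨hiso⟩⟩
  · have key : ∀ g : P.grp, ∀ y : (α.obj P).grp,
        α.map (L.deltaSelf P g) = L.deltaSelf (α.obj P) y →
        β.map (L.deltaSelf P g) = L.deltaSelf (β.obj P) (L.π (e P).hom y) := by
      intro g y h
      rw [hβmap, h, Iso.inv_comp_eq]
      exact deltaSelf_comm _ _
    ext f
    constructor
    · rintro ⟨g, rfl⟩
      have h1 : α.map (L.deltaSelf P g) ∈ Set.range (L.deltaSelf (α.obj P)) := by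
        rw [← hα.2]
        exact ⟨g, rfl⟩
      obtain ⟨y, hy⟩ := h1
      exact ⟨_, (key g y hy.symm).symm⟩
    · rintro ⟨y, rfl⟩
      obtain ⟨x, rfl⟩ := π_hom_surjective (e P) y
      have h1 : L.deltaSelf (α.obj P) x ∈
          Set.range (fun g : P.grp => α.map (L.deltaSelf P g)) := by
        rw [hα.2]
        exact ⟨x, rfl⟩
      obtain ⟨g, hg⟩ := h1
      exact ⟨g, key g x hg⟩
  · have h1 : β.map (L.incl h) ≫ L.incl (hobj Q) = L.incl (hobj P) := by
      rw [hβmap, Category.assoc, Category.assoc, he, ← α.map_comp, incl_comp_incl,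
        Iso.inv_comp_eq, he]
    have hle' : (β.obj P).grp ≤ (β.obj Q).grp := by
      intro x hx
      have h2 := congrArg (fun f => (L.π f ⟨x, hx⟩ : G)) h1
      simp only [L.π_comp_apply] at h2
      rw [L.π_incl, L.π_incl] at h2
      rw [← show ((L.π (β.map (L.incl h)) ⟨x, hx⟩ : (β.obj Q).grp) : G) = x from h2]
      exact (L.π (β.map (L.incl h)) ⟨x, hx⟩).2
    refine ⟨hle', ?_⟩
    rw [← cancel_mono (L.incl (hobj Q)), h1]
    exact (L.incl_comp_incl hle' (hobj Q)).symm

end LinkingSystem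

end Isotypical

/-! ### Exactness and strong closure -/

section ExactSequence

variable {G : Type u} [Group G] {p : ℕ} {S T : Subgroup G} {F : FusionSystem S}
  {E : FusionSystem T}

namespace LinkingSystem

open FusionSystem

theorem self_mem_obj [Fact p.Prime] [Finite S] (hS : IsPGroup p S) (hF : F.Saturated p)
    (L : LinkingSystem.{u, v} p F) : S ∈ L.Obj :=
  L.obj_centric_radical S F.centric_self (hF.radical_self hS)

namespace Inclusion

variable {L₀ : LinkingSystem.{u, w} p E} {L : LinkingSystem.{u, v} p F} {J : L₀.Inclusion L}
  {hT : T ∈ L₀.Obj}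

theorem lNaturallyIso_iff (α β : L₀.AutTyp) :
    J.LNaturallyIso α β ↔ Nonempty (α.1 ⋙ J.functor ⟶ β.1 ⋙ J.functor) :=
  ⟨fun ⟨η, hη⟩ => ⟨{ app := η, naturality := hη }⟩, fun ⟨η⟩ => ⟨η.app, η.naturality⟩⟩

variable [Finite S]

/-- Isotypical equivalences preserve orders, so the components are automatically isomorphisms; this
gives symmetry. -/
theorem lNaturallyIso_equivalence (hEF : F.WeaklyNormal p E) : Equivalence J.LNaturallyIso := by
  have := finite_of_le hEF.stronglyClosed.1
  refine ⟨fun α => (lNaturallyIso_iff _ _).2 ⟨𝟙 _⟩, fun {α β} h => ?_, fun {α β γ} h h' => ?_⟩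
  · obtain ⟨η⟩ := (lNaturallyIso_iff _ _).1 h
    have hi : ∀ R, IsIso (η.app R) := fun R => L.isIso_of_card_eq (η.app R)
      ((α.2.card_eq hEF.saturated_sub R).trans (β.2.card_eq hEF.saturated_sub R).symm)
    have := NatIso.isIso_of_isIso_app η
    exact (lNaturallyIso_iff _ _).2 ⟨inv η⟩
  · obtain ⟨η⟩ := (lNaturallyIso_iff _ _).1 h
    obtain ⟨θ⟩ := (lNaturallyIso_iff _ _).1 h'
    exact (lNaturallyIso_iff _ _).2 ⟨η ≫ θ⟩

/-- A functor in `Aut_typ^I(L₀)` that is `L`-naturally isomorphic to the identity is a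
conjugation functor. -/
theorem exists_isConjBy_of_natural (hEF : F.WeaklyNormal p E) {α : L₀.Ob ⥤ L₀.Ob}
    (hα : L₀.IsIsotypicalEquivalence α) (hI : L₀.PreservesInclusions α)
    (η : ∀ R : L₀.Ob, J.functor.obj R ⟶ J.functor.obj (α.obj R))
    (hη : ∀ (R R' : L₀.Ob) (φ : R ⟶ R'),
      J.functor.map φ ≫ η R' = η R ≫ J.functor.map (α.map φ)) :
    ∃ γ : J.functor.obj ⟨T, hT⟩ ≅ J.functor.obj ⟨T, hT⟩, J.IsConjBy γ α := by
  have := finite_of_le hEF.stronglyClosed.1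
  have hi : ∀ R, IsIso (η R) := fun R => L.isIso_of_card_eq (η R)
    (hα.card_eq hEF.saturated_sub R).symm
  have hle := L₀.obj_le _ (α.obj ⟨T, hT⟩).mem
  -- Naturality at the inclusions into `T` makes each `η_R` a restriction of this `γ`, and
  -- naturality at an arbitrary morphism is then the formula for `c_γ`.
  let γ := η ⟨T, hT⟩ ≫ J.functor.map (L₀.incl (Q := ⟨T, hT⟩) hle)
  have hγ := L.isIso_of_card_eq γ rfl
  refine ⟨asIso γ, fun R => asIso (η R), fun R => ?_, fun P Q ψ => ?_⟩
  · unfold Restricts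
    obtain ⟨h', hι⟩ := hI R ⟨T, hT⟩ (L₀.obj_le _ R.mem)
    rw [asIso_hom, asIso_hom, ← Category.assoc, hη, hι, Category.assoc, ← J.functor.map_comp,
      incl_comp_incl]
  · rw [asIso_inv, asIso_hom, hη, IsIso.inv_hom_id_assoc]

/-- `c_γ` is trivial for `γ = δ_T(a)` with `a ∈ C_S(E)`. -/
theorem WeaklyNormal.isConjBy_central [Fact p.Prime] (hS : IsPGroup p S)
    (hEF : F.WeaklyNormal p E) (hJ : J.WeaklyNormal) {a : G} (ha : a ∈ centralizerIn S T)
    (h : a ∈ F.subsystemCentralizer E) : J.IsConjBy (J.central ha ⟨T, hT⟩) (𝟭 L₀.Ob) := by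
  -- The restriction of `δ_T(a)` to `P` is `δ_P(a)`.
  refine ⟨fun P => J.central ha P, fun P => commutes_incl _, fun P Q ψ => ?_⟩
  rw [Iso.eq_inv_comp]
  exact hJ.commutes hEF hS h ψ

/-- If `c_γ` is trivial, then `γ = δ_T(a)` for some `a ∈ C_S(E)`. -/
theorem exists_eq_central_of_isConjBy [Fact p.Prime] (hS : IsPGroup p S)
    (hEF : F.WeaklyNormal p E) {γ : J.functor.obj ⟨T, hT⟩ ≅ J.functor.obj ⟨T, hT⟩}
    (h : J.IsConjBy γ (𝟭 L₀.Ob)) :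
    ∃ (a : G) (ha : a ∈ centralizerIn S T), a ∈ F.subsystemCentralizer E ∧
      γ = J.central ha ⟨T, hT⟩ := by
  have hTS := hEF.stronglyClosed.1
  obtain ⟨r, hr, hm⟩ : ∃ r : ∀ P : L₀.Ob, J.functor.obj P ≅ J.functor.obj P,
      (∀ P, J.Restricts γ (r P)) ∧ ∀ (P Q : L₀.Ob) (ψ : P ⟶ Q),
        J.functor.map ψ = (r P).inv ≫ J.functor.map ψ ≫ (r Q).hom := h
  have hrT : (r ⟨T, hT⟩).hom = γ.hom := by
    have h1 := hr ⟨T, hT⟩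
    unfold Restricts at h1
    simpa [incl_refl] using h1
  -- `γ` commutes with `δ_T(t)`; comparison with (C) gives `π(γ)(t) = t`.
  have hπ : L.π (𝟙 (J.functor.obj ⟨T, hT⟩)) = L.π γ.hom := by
    rw [L.π_id]
    ext t
    have ht : (t : G) ∈ transporter T T T := self_mem_transporter le_rfl t.2
    have ht' : (t : G) ∈ transporter S T T := self_mem_transporter hTS t.2
    have hk' : (L.π γ.hom t : G) ∈ transporter S T T :=
      self_mem_transporter hTS (L.π γ.hom t).2
    have h1 := hm ⟨T, hT⟩ ⟨T, hT⟩ (L₀.δ _ _ ⟨t, ht⟩)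
    rw [Iso.eq_inv_comp] at h1
    rw [hrT, J.functor_map_δ ht ht', L.δ_comm γ.hom t ⟨t, ht'⟩ ⟨_, hk'⟩ rfl rfl,
      cancel_epi] at h1
    exact δ_injective hEF.saturated ht' hk' h1
  obtain ⟨⟨a, hat⟩, ha, hγ⟩ := (L.π_eq_iff _ _
    (fullyCentralized_of_stronglyClosed hEF.stronglyClosed) _ _).1 hπ
  have hγ' : γ = J.central (a := a) ha ⟨T, hT⟩ := Iso.ext (by rwa [Category.comp_id] at hγ)
  refine ⟨a, ha, mem_subsystemCentralizer_of_commutes (J := J) hS hEF ha fun P Q ψ => ?_, hγ'⟩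
  have hrP : ∀ P : L₀.Ob, (r P).hom = (J.central (a := a) ha P).hom := by
    intro P
    have h1 := hr P
    unfold Restricts at h1
    rw [hγ'] at h1
    exact (cancel_mono _).1 (h1.trans (commutes_incl (ha := ha) (L₀.obj_le _ P.mem)).symm)
  have h1 := hm P Q ψ
  rw [Iso.eq_inv_comp, hrP, hrP] at h1
  exact h1

/-- The image of `a ∈ C_S(E)` under an automorphism of an object of `L` is in `C_S(E)`. -/
theorem WeaklyNormal.map_mem_subsystemCentralizer [Fact p.Prime] (hS : IsPGroup p S)
    (hEF : F.WeaklyNormal p E) (hJ : J.WeaklyNormal) {R : L.Ob} (θ : R ⟶ R) (a : R.grp)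
    (h : (a : G) ∈ F.subsystemCentralizer E) :
    (L.π θ a : G) ∈ F.subsystemCentralizer E := by
  have hTS := hEF.stronglyClosed.1
  have hRS := L.obj_le _ R.mem
  have ha := mem_centralizerIn_of_mem_subsystemCentralizer h
  let P : L₀.Ob := ⟨R.grp ⊓ T, (hJ.obj_iff R.grp hRS).1 R.mem⟩
  have hT : T ∈ L₀.Obj := L₀.top_mem P
  let T' : L₀.Ob := ⟨T, hT⟩
  have hPT : P.grp ≤ T'.grp := inf_le_right
  have hPR : (J.functor.obj P).grp ≤ R.grp := inf_le_left
  -- Strong closure of `T` lets `θ` restrict to `P = R ∩ T`, an object of `L₀` where factorization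
  -- is available.
  obtain ⟨θ₀, hθ₀⟩ := L.exists_factor (L.incl hPR ≫ θ) hPR (fun x => by
    refine ⟨(L.π (L.incl hPR ≫ θ) x).2, ?_⟩
    exact hEF.stronglyClosed.2 _ _ _ (L.π_mem (L.incl hPR ≫ θ)) x x.2.2)
  have hθi := L.isIso_of_card_eq θ₀ rfl
  obtain ⟨ψ, γ, hψ⟩ := hJ.exists_factorization hEF (θ₀ ≫ J.functor.map (L₀.incl hPT))
  obtain ⟨Φ, hΦ⟩ := hJ.exists_isConjBy γ
  obtain ⟨Ψ, hΨ⟩ := hJ.exists_isConjBy γ.symm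
  -- A conjugate of `δ_T(a)` by `γ` again acts trivially on `L₀`, so it is `δ_T(b)` with `b ∈
  -- C_S(E)`. The rest shows `b = π(θ)(a)`: `δ(a)` passes through `θ₀` as `δ(b)`, because it
  -- commutes with `ψ`, and as `δ(π(θ)(a))`, by (C).
  let κ := (γ.symm.trans (J.central ha T')).trans γ
  have hκ : J.IsConjBy κ (𝟭 L₀.Ob) := by
    have h1 := hΨ.comp hΦ
    have h2 := (hΨ.comp (hJ.isConjBy_central hS hEF ha h (hT := hT))).comp hΦ
    have h3 : γ.symm.trans γ = Iso.refl _ := by simp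
    rw [h3] at h1
    rw [← h1.unique IsConjBy.refl]
    exact h2
  obtain ⟨b, hb, hbC, hbκ⟩ := exists_eq_central_of_isConjBy hS hEF hκ
  have hcomm := hJ.commutes (ha := ha) hEF hS h ψ
  unfold Commutes at hcomm
  have h1 : (J.central ha P).hom ≫ θ₀ ≫ J.functor.map (L₀.incl hPT) =
      θ₀ ≫ J.functor.map (L₀.incl hPT) ≫ (J.central hb T').hom := by
    rw [← hbκ, ← Category.assoc θ₀, hψ, ← Category.assoc, hcomm]
    simp [κ, T']
  let S' : L.Ob := ⟨S, L.top_mem R⟩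
  have hTS' : (J.functor.obj T').grp ≤ S'.grp := hTS
  have hRS' : R.grp ≤ S'.grp := hRS
  have hPS' : (J.functor.obj P).grp ≤ S'.grp := hPR.trans hRS
  have hbS : b ∈ transporter S S'.grp S'.grp := self_mem_transporter le_rfl hb.1
  have haR : (a : G) ∈ transporter S R.grp R.grp := self_mem_transporter hRS a.2
  have hcR : (L.π θ a : G) ∈ transporter S R.grp R.grp := self_mem_transporter hRS (L.π θ a).2
  have hcS : (L.π θ a : G) ∈ transporter S S'.grp S'.grp :=
    self_mem_transporter le_rfl (hRS (L.π θ a).2)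
  have h2 : (J.central ha P).hom ≫ θ₀ ≫ L.incl hPS' =
      θ₀ ≫ L.incl hPS' ≫ L.δ S' S' ⟨b, hbS⟩ := by
    have h3 : (J.central hb T').hom ≫ L.incl hTS' = L.incl hTS' ≫ L.δ S' S' ⟨b, hbS⟩ :=
      L.δ_comp_incl _ _ _ _
    have h4 := congrArg (fun f => f ≫ L.incl hTS') h1
    simp only [Category.assoc] at h4
    have h6 : J.functor.map (L₀.incl hPT) ≫ L.incl hTS' = L.incl hPS' := by
      rw [functor_map_incl]
      exact L.incl_comp_incl _ _
    rw [h3, ← Category.assoc (J.functor.map _) (L.incl hTS'), h6] at h4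
    exact h4
  have h5 : (J.central ha P).hom ≫ θ₀ ≫ L.incl hPS' =
      θ₀ ≫ L.incl hPS' ≫ L.δ S' S' ⟨L.π θ a, hcS⟩ := by
    have h6 : (J.central ha P).hom ≫ L.incl hPR = L.incl hPR ≫ L.δ R R ⟨a, haR⟩ :=
      L.δ_comp_incl _ _ _ _
    rw [← L.incl_comp_incl hPR hRS', ← Category.assoc θ₀, hθ₀, Category.assoc,
      ← Category.assoc (J.central ha P).hom, h6, Category.assoc,
      ← Category.assoc (L.δ R R _), L.δ_comm θ a ⟨a, haR⟩ ⟨_, hcR⟩ rfl rfl, Category.assoc,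
      L.δ_comp_incl hRS' hRS' hcR hcS, Category.assoc, ← Category.assoc θ₀, hθ₀, Category.assoc]
  have h7 := (cancel_epi θ₀).1 (h2.symm.trans h5)
  unfold incl at h7
  rw [δ_comp, δ_comp] at h7
  have h8 : b = L.π θ a := by simpa using δ_injective hEF.saturated _ _ h7
  rwa [← h8]

theorem WeaklyNormal.stronglyClosed_subsystemCentralizer [Fact p.Prime] (hS : IsPGroup p S)
    (hEF : F.WeaklyNormal p E) (hJ : J.WeaklyNormal) {C : Subgroup G}
    (hC : (C : Set G) = F.subsystemCentralizer E) : F.StronglyClosed C := by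
  have hmem : ∀ x, x ∈ C ↔ x ∈ F.subsystemCentralizer E := fun x => by
    rw [← hC]
    rfl
  refine ⟨fun x hx => ((hmem x).1 hx).1, fun P Q φ hφ => ?_⟩
  -- The two-sided form is stable under inverses, as Alperin's theorem requires.
  suffices h : ∀ x : P, (x : G) ∈ C ↔ (φ x : G) ∈ C from fun x => (h x).1
  refine hEF.saturated.alperin hS (fun P Q φ => ∀ x : P, (x : G) ∈ C ↔ (φ x : G) ∈ C)
    (fun _ _ _ φ ψ _ _ h1 h2 x => (h1 x).trans (h2 (φ x)))
    (fun _ _ e _ h1 x => ?_) (fun _ _ _ _ _ _ hP _ _ hag h1 x => ?_)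
    (fun R e hc hr he x => ?_) P Q φ hφ
  · have h2 := h1 (e.symm x)
    simp only [MulEquiv.toMonoidHom_eq_coe, MonoidHom.coe_coe, MulEquiv.apply_symm_apply] at h2
    exact h2.symm
  · rw [hag]
    exact h1 (Subgroup.inclusion hP x)
  · let R' : L.Ob := ⟨R, L.obj_centric_radical R hc hr⟩
    have key : ∀ f : R ≃* R, f.toMonoidHom ∈ F.Hom R R → ∀ x : R, (x : G) ∈ C →
        (f x : G) ∈ C := by
      intro f hf x hx
      obtain ⟨θ, hθ⟩ := L.exists_lift (P := R') (Q := R') hf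
      have h1 := hJ.map_mem_subsystemCentralizer hS hEF θ x ((hmem _).1 hx)
      rw [hθ] at h1
      exact (hmem _).2 h1
    refine ⟨key e he x, fun hx => ?_⟩
    have h1 := key e.symm (F.symm_mem he) (e x) hx
    rwa [MulEquiv.symm_apply_apply] at h1

/-- The restrictions of `γ` are themselves an `L`-natural isomorphism from the identity to `c_γ`;
the other direction reads `γ` off the component at `T`. -/
theorem toOutTyp_eq_one_iff (hEF : F.WeaklyNormal p E)
    {c : Aut (J.functor.obj ⟨T, hT⟩) →* L₀.AutTypI}
    (hc : ∀ (γ : Aut (J.functor.obj ⟨T, hT⟩)) (Φ : L₀.Ob ⥤ L₀.Ob),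
      J.IsConjBy γ Φ ↔ Φ = (c γ).1) (α : L₀.AutTypI) :
    J.toOutTyp α = J.toOutTyp 1 ↔ α ∈ Set.range c := by
  have hequiv := J.lNaturallyIso_equivalence hEF
  refine (hequiv.quot_mk_eq_iff _ _).trans ⟨?_, ?_⟩
  · intro h
    obtain ⟨η, hη⟩ := hequiv.symm h
    obtain ⟨γ, hγ⟩ := exists_isConjBy_of_natural (J := J) (hT := hT) hEF α.2.1 α.2.2 η hη
    exact ⟨γ, Subtype.ext ((hc γ α.1).1 hγ).symm⟩
  · rintro ⟨γ, rfl⟩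
    obtain ⟨r, -, hm⟩ := (hc γ _).2 rfl
    refine hequiv.symm ⟨fun R => (r R).hom, fun R R' φ => ?_⟩
    have h1 := hm R R' φ
    rw [Iso.eq_inv_comp] at h1
    exact h1.symm

theorem toOutTyp_surjective (hEF : F.WeaklyNormal p E) (hT : T ∈ L₀.Obj) :
    Function.Surjective J.toOutTyp := by
  have := finite_of_le hEF.stronglyClosed.1
  intro x
  obtain ⟨α, rfl⟩ := Quot.exists_rep x
  obtain ⟨β, hβ, hI, ⟨i⟩⟩ := exists_iso_preservesInclusions hT α.2
  refine ⟨⟨β, hβ, hI⟩, Quot.sound ⟨fun R => J.functor.map (i.inv.app R), fun R R' φ => ?_⟩⟩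
  change J.functor.map (β.map φ) ≫ J.functor.map (i.inv.app R') =
    J.functor.map (i.inv.app R) ≫ J.functor.map (α.1.map φ)
  rw [← J.functor.map_comp, ← J.functor.map_comp, i.inv.naturality]

end Inclusion

end LinkingSystem

end ExactSequence

/-! ### Assembly of the exact sequence -/

theorem theoremA {G : Type u} [Group G] (p : ℕ) [Fact p.Prime] {S T : Subgroup G}
    [Finite S] (hS : IsPGroup p S) (F : FusionSystem S) (E : FusionSystem T)
    (hEF : F.WeaklyNormal p E) (L : LinkingSystem.{u, v} p F) (L₀ : LinkingSystem.{u, w} p E)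
    (J : L₀.Inclusion L) (hJ : J.WeaklyNormal) :
    -- `L`-natural isomorphism is an equivalence relation on `Aut_typ(L₀)`
    Equivalence J.LNaturallyIso ∧
    -- the monoid `Aut_typ^I(L₀)` is a group
    (∀ α : L₀.AutTypI, IsUnit α) ∧
    ∃ (hT : T ∈ L.Obj) (C : Subgroup G)
      (hC : C ≤ S ⊓ Subgroup.normalizer (((⟨T, hT⟩ : L.Ob).grp : Subgroup G) : Set G))
      (c : Aut (⟨T, hT⟩ : L.Ob) →* L₀.AutTypI),
      -- `C` is `C_S(E)`, and `c` is `γ ↦ c_γ`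
      (C : Set G) = F.subsystemCentralizer E ∧
      (∀ (γ : Aut (⟨T, hT⟩ : L.Ob)) (Φ : L₀.Ob ⥤ L₀.Ob),
        J.IsConjugation γ Φ ↔ Φ = (c γ).1) ∧
      -- exactness at `C_S(E)`, `Aut_L(T)`, `Aut_typ^I(L₀)` and `Out_typ^L(L₀)`
      Function.Injective ((L.deltaAut ⟨T, hT⟩).comp (Subgroup.inclusion hC)) ∧
      ((L.deltaAut ⟨T, hT⟩).comp (Subgroup.inclusion hC)).range = c.ker ∧
      (∀ α : L₀.AutTypI, J.toOutTyp α = J.toOutTyp 1 ↔ α ∈ Set.range c) ∧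
      Function.Surjective J.toOutTyp ∧
      F.StronglyClosed C := by
  have hTS := hEF.stronglyClosed.1
  have := FusionSystem.finite_of_le hTS
  have hT₀ : T ∈ L₀.Obj :=
    L₀.self_mem_obj (FusionSystem.isPGroup_of_le hS hTS) hEF.saturated_sub
  obtain ⟨c, hc⟩ := hJ.exists_conjugationHom hTS hT₀
  have hc' : ∀ (γ : Aut (J.functor.obj ⟨T, hT₀⟩)) (Φ : L₀.Ob ⥤ L₀.Ob),
      J.IsConjBy γ Φ ↔ Φ = (c γ).1 := fun γ Φ =>
    (LinkingSystem.Inclusion.isConjugation_iff γ Φ).symm.trans (hc γ Φ)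
  have hker : ∀ γ : Aut (J.functor.obj ⟨T, hT₀⟩), γ ∈ c.ker ↔ J.IsConjBy γ (𝟭 L₀.Ob) :=
    fun γ => by
      rw [hc', MonoidHom.mem_ker]
      exact ⟨fun h => by rw [h]; rfl, fun h => Subtype.ext h.symm⟩
  let δT := L.deltaAut (J.functor.obj ⟨T, hT₀⟩)
  let N := S ⊓ Subgroup.normalizer ((J.functor.obj ⟨T, hT₀⟩).grp : Set G)
  have hδ : Function.Injective δT := fun g h hgh => Subtype.ext
    (LinkingSystem.δ_injective hEF.saturated _ _
      (congrArg (fun z : Aut (J.functor.obj ⟨T, hT₀⟩) => z.hom) hgh))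
  have hmem : ∀ a : N, δT a ∈ c.ker ↔ (a : G) ∈ F.subsystemCentralizer E := by
    intro a
    rw [hker]
    constructor
    · intro h
      obtain ⟨b, hb, hbC, hab⟩ :=
        LinkingSystem.Inclusion.exists_eq_central_of_isConjBy hS hEF h
      have h1 := hδ (a₁ := a) (a₂ := ⟨b, J.mem_normalizer_of_mem_centralizer hb _⟩) hab
      rwa [h1]
    · intro h
      exact hJ.isConjBy_central hS hEF
        (LinkingSystem.Inclusion.mem_centralizerIn_of_mem_subsystemCentralizer h) h
  -- Taking the preimage of the kernel of `c` makes `C_S(E)` a subgroup, which its definition does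
  -- not show.
  let C : Subgroup G := (c.ker.comap δT).map N.subtype
  have hCN : C ≤ N := Subgroup.map_subtype_le _
  have hC : (C : Set G) = F.subsystemCentralizer E := by
    ext a
    constructor
    · rintro ⟨b, hb, rfl⟩
      exact (hmem b).1 hb
    · intro h
      have ha := LinkingSystem.Inclusion.mem_centralizerIn_of_mem_subsystemCentralizer h
      exact ⟨⟨a, J.mem_normalizer_of_mem_centralizer ha ⟨T, hT₀⟩⟩, (hmem _).2 h, rfl⟩
  refine ⟨J.lNaturallyIso_equivalence hEF, L₀.autTypI_isUnit hEF.saturated_sub,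
    J.obj_subset hT₀, C, hCN, c, hC, hc, ?_, ?_, J.toOutTyp_eq_one_iff hEF hc',
    J.toOutTyp_surjective hEF hT₀, hJ.stronglyClosed_subsystemCentralizer hS hEF hC⟩
  · exact hδ.comp (Subgroup.inclusion_injective hCN)
  · ext γ
    constructor
    · rintro ⟨a, rfl⟩
      exact (hmem (Subgroup.inclusion hCN a)).2 (hC ▸ a.2)
    · intro hγ
      obtain ⟨a, ha, haC, h⟩ :=
        LinkingSystem.Inclusion.exists_eq_central_of_isConjBy hS hEF ((hker γ).1 hγ)
      exact ⟨⟨a, (Set.ext_iff.1 hC a).2 haC⟩, h.symm⟩
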